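/- Let $k$ be a perfect field, and fix one of three qualities of power series over $k$: formal; convergent with respect to a given absolute value $|\cdot|:k\to\mathbb R$ (a series $\sum_\alpha c_\alpha x^\alpha$ converges if $\sum_\alpha|c_\alpha|s^{|\alpha|}<\infty$ for some $s>0$); or algebraic (algebraic over the polynomial ring in the same variables). Let $\mathcal A_\circ$ be the set of series $y(t)$ in one variable of this quality with $y(0)=0$, and let $\mathcal B$ be the ring of series of this quality in $t,y_1,\dots,y_m$. For $f=(f_1,\dots,f_n)\in\mathcal B^n$ let $$\mathcal Y=\mathcal Y(f)=\{y\in\mathcal A_\circ^m : f(t,y(t))=0\},$$ and assume $\mathcal Y\neq\emptyset$. Sets of this form are called arquile closed. Let $I_{\mathcal Y}\subset\mathcal B$ be the ideal of all series vanishing at all points of $\mathcal Y$, and for $y\in\mathcal Y$ let $\mathcal P_y=\{h\in\mathcal B: h(t,y(t))=0\}$, a prime ideal. The point $y$ is arq.regular if $\mathcal B_{\mathcal P_y}/I_{\mathcal Y}\mathcal B_{\mathcal P_y}$ is a regular local ring; $\mathrm{Arq.Reg}(\mathcal Y)$ is the set of arq.regular points and $\mathrm{Arq.Sing}(\mathcal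 Y)=\mathcal Y\setminus\mathrm{Arq.Reg}(\mathcal Y)$. A map between subsets of $\mathcal A_\circ^m$ and $\mathcal A_\circ^s$ is textile if every coefficient of the image is given by a polynomial in finitely many coefficients of the argument; a textile isomorphism is a bijective textile map whose inverse is textile. Textile closed sets are the common zero sets in $\mathcal A_\circ^m$ of (possibly infinitely many) polynomials in the coefficients; textile locally closed sets are differences of two textile closed sets. (a) $\mathrm{Arq.Sing}(\mathcal Y)$ is an arquile closed, proper subset of $\mathcal Y$. After appending to $f$ finitely many further series one obtains a vector $\tilde f=(f_1,\dots,f_n,h_1,\dots,h_l)$ which generates $I_{\mathcal Y}$ and for which there are finitely many minors $g_1,\dots,g_q\in\mathcal B$ (of possibly different sizes $r\ge 0$, the minor of size $0$ being $1$) of the relative Jacobian matrix $\partial_y\tilde f$ such that $$\mathrm{Arq.Sing}(\mathcal Y)=\{y\in\mathcal Y : g_1(t,y(t))=\dots=g_q(t,y(t))=0\}.$$ If $f_1,\dots,f_n$ already generate $I_{\mathcal Y}$ and all minimal primes of $I_{\mathcal Y}$ have the same height (for instance if $I_{\mathcal Y}$ is prime), then the $g_j$ can be chosen among the minors of $\partial_y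 f$ itself. (b) Every arq.regular point $y$ of $\mathcal Y$ has a neighbourhood $\mathcal W\subset\mathcal Y$ which is open in $\mathcal Y$ for the $t$-adic topology, textile locally closed, and textile isomorphic to a free module $\mathcal A_\circ^s$ for some $s\ge 0$. -/

import Mathlib

namespace Arquile

open scoped PowerSeries

/-- The three kinds of power series over a field `k`: formal, convergent (with respect to an
absolute value on `k`), and algebraic (Nash) series. -/
inductive Quality (k : Type*) [Field k]
  | formal
  | convergent (v : AbsoluteValue k ℝ)
  | algebraic

section Series

variable {k : Type*} [Field k]

/-- A power series in the variables `σ` converges if `∑ |cₙ| s ^ |n|` is finite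
for some radius `s > 0`. -/
def IsConvergent (v : AbsoluteValue k ℝ) {σ : Type*} (f : MvPowerSeries σ k) : Prop :=
  ∃ s : ℝ, 0 < s ∧ Summable fun n : σ →₀ ℕ => v (MvPowerSeries.coeff n f) * s ^ n.degree

theorem summable_radius_mono (v : AbsoluteValue k ℝ) {σ : Type*} {f : MvPowerSeries σ k}
    {s r : ℝ} (hr : 0 < r) (hrs : r ≤ s)
    (h : Summable fun n : σ →₀ ℕ => v (MvPowerSeries.coeff n f) * s ^ n.degree) :
    Summable fun n : σ →₀ ℕ => v (MvPowerSeries.coeff n f) * r ^ n.degree := by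
  refine Summable.of_nonneg_of_le (fun n => ?_) (fun n => ?_) h
  · exact mul_nonneg (v.nonneg _) (pow_nonneg hr.le _)
  · exact mul_le_mul_of_nonneg_left (pow_le_pow_left₀ hr.le hrs _) (v.nonneg _)

theorem IsConvergent.add {v : AbsoluteValue k ℝ} {σ : Type*} {f g : MvPowerSeries σ k}
    (hf : IsConvergent v f) (hg : IsConvergent v g) : IsConvergent v (f + g) := by
  obtain ⟨s, hs, hf⟩ := hf
  obtain ⟨r, hr, hg⟩ := hg
  have hm : 0 < min s r := lt_min hs hr
  refine ⟨min s r, hm, Summable.of_nonneg_of_le (fun n => ?_) (fun n => ?_)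
    ((summable_radius_mono v hm (min_le_left s r) hf).add
      (summable_radius_mono v hm (min_le_right s r) hg))⟩
  · exact mul_nonneg (v.nonneg _) (pow_nonneg hm.le _)
  · rw [map_add, ← add_mul]
    exact mul_le_mul_of_nonneg_right (v.add_le _ _) (pow_nonneg hm.le _)

theorem IsConvergent.mul {v : AbsoluteValue k ℝ} {σ : Type*} {f g : MvPowerSeries σ k}
    (hf : IsConvergent v f) (hg : IsConvergent v g) : IsConvergent v (f * g) := by
  classical
  obtain ⟨s, hs, hf⟩ := hf
  obtain ⟨r, hr, hg⟩ := hg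
  have hm : 0 < min s r := lt_min hs hr
  have hf' := summable_radius_mono v hm (min_le_left s r) hf
  have hg' := summable_radius_mono v hm (min_le_right s r) hg
  set F : (σ →₀ ℕ) → ℝ := fun n => v (MvPowerSeries.coeff n f) * min s r ^ n.degree with hF
  set G : (σ →₀ ℕ) → ℝ := fun n => v (MvPowerSeries.coeff n g) * min s r ^ n.degree with hG
  have hF0 : 0 ≤ F := fun n => mul_nonneg (v.nonneg _) (pow_nonneg hm.le _)
  have hG0 : 0 ≤ G := fun n => mul_nonneg (v.nonneg _) (pow_nonneg hm.le _)
  have h := summable_sum_mul_antidiagonal_of_summable_mul (hf'.mul_of_nonneg hg' hF0 hG0)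
  refine ⟨min s r, hm, Summable.of_nonneg_of_le (fun n => ?_) (fun n => ?_) h⟩
  · exact mul_nonneg (v.nonneg _) (pow_nonneg hm.le _)
  · rw [MvPowerSeries.coeff_mul]
    refine (mul_le_mul_of_nonneg_right (v.sum_le _ _) (pow_nonneg hm.le _)).trans_eq ?_
    rw [Finset.sum_mul]
    refine Finset.sum_congr rfl fun p hp => ?_
    have hd : n.degree = p.1.degree + p.2.degree := by
      rw [← Finset.HasAntidiagonal.mem_antidiagonal.mp hp, map_add]
    rw [hd, pow_add, map_mul, hF, hG]
    ring

theorem isConvergent_C (v : AbsoluteValue k ℝ) {σ : Type*} (c : k) :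
    IsConvergent v (MvPowerSeries.C c : MvPowerSeries σ k) := by
  classical
  refine ⟨1, one_pos, summable_of_ne_finset_zero (s := {0}) fun n hn => ?_⟩
  rw [MvPowerSeries.coeff_C, if_neg (by simpa using hn)]
  simp

/-- The ring of convergent power series in the variables `σ`. -/
def convergentSeries (v : AbsoluteValue k ℝ) (σ : Type*) : Subalgebra k (MvPowerSeries σ k) where
  carrier := {f | IsConvergent v f}
  mul_mem' := IsConvergent.mul
  add_mem' := IsConvergent.add
  algebraMap_mem' c := isConvergent_C v c

/-- The ring of formal, convergent or algebraic power series in the variables `σ`; the algebraic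
series are those power series that are algebraic over the polynomial ring in `σ`. -/
noncomputable def Quality.series (Q : Quality k) (σ : Type*) : Subalgebra k (MvPowerSeries σ k) :=
  match Q with
  | .formal => ⊤
  | .convergent v => convergentSeries v σ
  | .algebraic =>
      (Subalgebra.algebraicClosure (MvPolynomial σ k) (MvPowerSeries σ k)).restrictScalars k

end Series

/-- The ring `R_P / I R_P` is a regular local ring. -/
def IsRegularQuotientAt {R : Type*} [CommRing R] (I P : Ideal R) [P.IsPrime] : Prop :=
  IsRegularLocalRing
    (Localization.AtPrime P ⧸ I.map (algebraMap R (Localization.AtPrime P)))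

variable {k : Type*} [Field k] (Q : Quality k)

/-- `A_∘`: the series in one variable `t` of the given quality without constant term. -/
abbrev Centered : Type _ :=
  {y : k⟦X⟧ // y ∈ Q.series Unit ∧ PowerSeries.constantCoeff y = 0}

/-- The affine space `A_∘ ^ m` of `m`-fold arcs centered at `0`. -/
abbrev Arcs (m : ℕ) : Type _ := Fin m → Centered Q

/-- `B`: the series of the given quality in the `1 + m` variables `t, y₁, …, y_m`; the variable
`t` is indexed by `none`, and `yᵢ` by `some i`. -/
abbrev BSeries (m : ℕ) : Type _ := Q.series (Option (Fin m))

section Evaluation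

variable {Q} {m : ℕ}

/-- The values substituted for the variables: `t ↦ t` and `yᵢ ↦ yᵢ(t)`. -/
noncomputable def substPoint (y : Arcs Q m) : Option (Fin m) → MvPowerSeries Unit k
  | none => (PowerSeries.X : k⟦X⟧)
  | some i => (y i : k⟦X⟧)

theorem hasSubst_substPoint (y : Arcs Q m) : MvPowerSeries.HasSubst (substPoint y) := by
  refine MvPowerSeries.hasSubst_of_constantCoeff_zero fun o => ?_
  cases o with
  | none => exact PowerSeries.constantCoeff_X
  | some i => exact (y i).2.2

/-- The evaluation `f ↦ f(t, y(t))`. -/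
noncomputable def evalAt (y : Arcs Q m) : BSeries Q m →ₐ[k] k⟦X⟧ :=
  (MvPowerSeries.substAlgHom (hasSubst_substPoint y)).comp (Q.series (Option (Fin m))).val

/-- The prime ideal `P_y` of the series vanishing at `y`. -/
noncomputable def relationIdeal (y : Arcs Q m) : Ideal (BSeries Q m) :=
  RingHom.ker (evalAt y)

instance (y : Arcs Q m) : (relationIdeal y).IsPrime :=
  RingHom.ker_isPrime (evalAt y)

/-- The ideal `I_Y` of the series vanishing on `Y`. -/
noncomputable def vanishingIdeal (Y : Set (Arcs Q m)) : Ideal (BSeries Q m) :=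
  ⨅ y ∈ Y, relationIdeal y

/-- The arquile variety `Y(f)` of a power series vector `f`. -/
def zeroLocus {n : ℕ} (f : Fin n → BSeries Q m) : Set (Arcs Q m) :=
  {y | ∀ j, evalAt y (f j) = 0}

/-- Arquile closed sets are the zero sets of arquile maps. -/
def IsArquileClosed (S : Set (Arcs Q m)) : Prop :=
  ∃ (n : ℕ) (f : Fin n → BSeries Q m), S = zeroLocus f

/-- `Y` is arquile regular at `y` if `B_{P_y} / I_Y B_{P_y}` is a regular local ring. -/
def IsArqRegularAt (Y : Set (Arcs Q m)) (y : Arcs Q m) : Prop :=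
  IsRegularQuotientAt (vanishingIdeal Y) (relationIdeal y)

def arqReg (Y : Set (Arcs Q m)) : Set (Arcs Q m) := {y | y ∈ Y ∧ IsArqRegularAt Y y}

def arqSing (Y : Set (Arcs Q m)) : Set (Arcs Q m) := Y \ arqReg Y

/-- The relative Jacobian matrix `∂_y f`. -/
noncomputable def relJacobian {n : ℕ} (f : Fin n → BSeries Q m) :
    Matrix (Fin n) (Fin m) (MvPowerSeries (Option (Fin m)) k) :=
  Matrix.of fun j i => MvPowerSeries.pderiv k (some i) (f j : MvPowerSeries (Option (Fin m)) k)

/-- `g` is a minor, of some size `r ≥ 0`, of the relative Jacobian matrix `∂_y f`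
(the minor of size `0` is `1`). -/
def IsRelJacobianMinor {n : ℕ} (f : Fin n → BSeries Q m) (g : BSeries Q m) : Prop :=
  ∃ (r : ℕ) (rows : Fin r ↪o Fin n) (cols : Fin r ↪o Fin m),
    (g : MvPowerSeries (Option (Fin m)) k) = ((relJacobian f).submatrix rows cols).det

/-- The subset `S` of `Y` is defined in `Y` by the vanishing of finitely many minors of the
relative Jacobian matrix `∂_y f`. -/
def IsCutOutByMinors {n : ℕ} (f : Fin n → BSeries Q m) (Y S : Set (Arcs Q m)) : Prop :=
  ∃ (q : ℕ) (g : Fin q → BSeries Q m), (∀ j, IsRelJacobianMinor f (g j)) ∧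
    S = {y | y ∈ Y ∧ ∀ j, evalAt y (g j) = 0}

/-- `W` is open in `Y` for the `t`-adic topology. -/
def IsTAdicOpenIn (Y W : Set (Arcs Q m)) : Prop :=
  W ⊆ Y ∧ ∀ y ∈ W, ∃ d : ℕ, ∀ y' ∈ Y,
    (∀ i, (PowerSeries.X : k⟦X⟧) ^ d ∣ (y' i : k⟦X⟧) - (y i : k⟦X⟧)) → y' ∈ W

/-- The coefficients `y_{ij}` of a vector `y` of series (with `y_{i0} = 0`). -/
noncomputable def coeffs (y : Arcs Q m) : Fin m × ℕ → k :=
  fun p => PowerSeries.coeff p.2 (y p.1 : k⟦X⟧)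

/-- Textile closed sets are the zero sets of (possibly infinitely many) polynomials in the
coefficients. -/
def IsTextileClosed (S : Set (Arcs Q m)) : Prop :=
  ∃ E : Set (MvPolynomial (Fin m × ℕ) k), S = {y | ∀ F ∈ E, MvPolynomial.eval (coeffs y) F = 0}

/-- Textile locally closed sets are differences of two textile closed sets. -/
def IsTextileLocallyClosed (S : Set (Arcs Q m)) : Prop :=
  ∃ S₁ S₂ : Set (Arcs Q m), IsTextileClosed S₁ ∧ IsTextileClosed S₂ ∧ S = S₁ \ S₂

/-- A map is textile if each coefficient of the image is a polynomial in the coefficients of the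
argument. -/
def IsTextile {s : ℕ} {U : Set (Arcs Q m)} {V : Set (Arcs Q s)} (τ : U → V) : Prop :=
  ∃ F : Fin s × ℕ → MvPolynomial (Fin m × ℕ) k,
    ∀ (y : U) (p : Fin s × ℕ), coeffs (τ y : Arcs Q s) p = MvPolynomial.eval (coeffs y.1) (F p)

/-- Two sets are textile isomorphic if there is a bijective textile map between them whose inverse
is again textile. -/
def TextileIsomorphic {s : ℕ} (U : Set (Arcs Q m)) (V : Set (Arcs Q s)) : Prop :=
  ∃ Φ : U ≃ V, IsTextile Φ ∧ IsTextile Φ.symm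

end Evaluation

end Arquile

/-!
All three kinds of power series satisfy Weierstrass division (`exists_weierstrass`). For formal and
convergent series the division is a contraction for a suitable weighted norm. For algebraic series
the formal remainder has to be shown to be algebraic: after a perturbation of the divisor by two
new variables, the variable of the division generates a separable extension, and the coefficients
of the remainder are recovered from conjugates by Lagrange interpolation
(`isAlg_remainder_perturbed`). Division gives closure under composition (`series_subst`) and
differentiation (`series_pderiv`) and the Noetherian property (`isNoetherianRing_series`), so that
the rest of the argument does not distinguish the three kinds.

The prime ideal of an arc `y` is generated by the `m` elements `y_i - y_i(t)` and has height at
least `m` (`le_height_relationIdeal`), hence the local ring `L` of `B` at `y` is regular with these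
elements as parameters. Singularities are measured by *adapted systems* for `I = I_Y`: systems
obtained from the variables `t, y_1, …, y_m` by replacing some of the `y_i` by elements of `I`. The
Jacobian determinant of an adapted system is a relative Jacobian minor. Where it does not vanish,
the translated system is a regular system of parameters of `L` (`span_range_germParam`). If its
elements in `I` moreover generate `I L`, then `L / I L` is regular
(`IsAdapted.isRegularQuotientAt`). Conversely, if `L / I L` is regular and the number of elements
of `I` is maximal among the systems whose determinant does not vanish at `y`, then these elements
generate `I L` (`IsMaxAdapted.map_eq_span_germParam`): by maximality they generate `I L` to first
order, and both quotients are regular of the same dimension, hence domains.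

Regular points exist (`exists_isArqRegularAt`). Take a maximal adapted system with determinant `g`
not in `I`, and a point `y` of `Y` where `g` does not vanish. By maximality, `g` times the
derivations dual to the remaining `y_i` preserve `I`, and so does the derivation dual to `t`,
because the equations `f(t, y(t)) = 0` can be differentiated with respect to `t`. It follows that
the system generates `I L`. In characteristic zero one argues modulo powers of the maximal ideal,
using that the Euler derivation multiplies elements of order `N` by `N g`, up to higher order
(`IsTransversal.map_le_sup_pow_succ`). In characteristic `p` the derivations, rescaled by `g ^ p`,
commute and are nilpotent of order `p`, which reduces the claim to elements of `I` killed by all of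
them. As `k` is perfect, these are `p`-th powers (`exists_pow_eq`) of elements of the radical ideal
`I`, and Nakayama's lemma applies (`IsTransversal.algebraMap_mem_of_charP`).

At a regular point the generation of `I L` by an adapted system persists where one further element
of `B` does not vanish. Multiplying the system by this element shows that the regular points near
`y` are those where one Jacobian minor does not vanish, and by the Noetherian property finitely
many such minors define the singular locus (`exists_arqSing_eq`). If all minimal primes of `I` have
the same height `r`, all the maximal adapted systems at regular points have `r` elements, some
`r`-minor of the Jacobian matrix of any generators of `I` does not vanish there
(`IsAdapted.exists_minor_ne_zero`), and conversely the nonvanishing of an `r`-minor implies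
regularity by comparison of heights (`IsAdapted.map_le_of_height_le`).

Finally, let `y` be a regular point and let `e` be the order in `t` of a multiple of the Jacobian
determinant of a maximal adapted system at `y`. After the dilation `y + t ^ ε v`, with exponents
`e` and `2 e`, the equations of `Y` become `t ^ (2 e)` times equations whose linear part in the
variables replaced is the identity (`exists_normal_form`), as in the proof of Tougeron's implicit
function theorem. The implicit function theorem for arcs (`exists_implicit_system`) then exhibits
the points of `Y` close to `y` as a graph over a free module (`exists_chart`), and the coefficients
of the parametrization and of its inverse are polynomials (`exists_textile_neighbourhood`).
-/

namespace Arquile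

open MvPowerSeries

/-! ### Weierstrass division of formal and convergent power series -/

section Weierstrass

variable {k : Type*} [Field k] {σ : Type*}

/-- The series `f` is regular of order `d` in the variable `x_i`: its restriction to the `x_i`-axis
has order `d`. -/
def IsRegularIn (i : σ) (d : ℕ) (f : MvPowerSeries σ k) : Prop :=
  (∀ j < d, coeff (Finsupp.single i j) f = 0) ∧ coeff (Finsupp.single i d) f ≠ 0

/-- The series `r` is a polynomial of degree less than `d` in the variable `x_i`. -/
def DegreeInLT (i : σ) (d : ℕ) (r : MvPowerSeries σ k) : Prop :=
  ∀ n : σ →₀ ℕ, d ≤ n i → coeff n r = 0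

theorem DegreeInLT.sub {i : σ} {d : ℕ} {r s : MvPowerSeries σ k} (hr : DegreeInLT i d r)
    (hs : DegreeInLT i d s) : DegreeInLT i d (r - s) := fun n hn => by
  rw [map_sub, hr n hn, hs n hn, sub_zero]

open Classical in
/-- The weight giving `x_i` degree `1` and all other variables degree `d + 1`. With respect to it
the leading form of a series that is regular of order `d` in `x_i` is a multiple of `x_i ^ d`. -/
noncomputable def divWeight (i : σ) (d : ℕ) : (σ →₀ ℕ) →+ ℕ :=
  Finsupp.weight fun j => if j = i then 1 else d + 1

theorem divWeight_single (i : σ) (d j : ℕ) : divWeight i d (Finsupp.single i j) = j := by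
  simp [divWeight, Finsupp.weight_single]

theorem degree_le_divWeight (i : σ) (d : ℕ) (n : σ →₀ ℕ) : n.degree ≤ divWeight i d n := by
  classical
  rw [divWeight, Finsupp.weight_apply, Finsupp.degree_apply]
  refine Finset.sum_le_sum fun j _ => ?_
  simp only [smul_eq_mul]
  split_ifs <;> nlinarith [Nat.zero_le (n j), Nat.zero_le d, Nat.zero_le (n j * d)]

theorem divWeight_le_degree (i : σ) (d : ℕ) (n : σ →₀ ℕ) :
    divWeight i d n ≤ (d + 1) * n.degree := by
  classical
  rw [divWeight, Finsupp.weight_apply, Finsupp.degree_apply, Finset.mul_sum]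
  refine Finset.sum_le_sum fun j _ => ?_
  simp only [smul_eq_mul]
  split_ifs <;> nlinarith [Nat.zero_le (n j), Nat.zero_le d, Nat.zero_le (n j * d)]

/-- The part of a series `f` regular of order `d` in `x_i` other than the monomial `x_i ^ d`. -/
noncomputable def divTail (i : σ) (d : ℕ) (f : MvPowerSeries σ k) : MvPowerSeries σ k :=
  f - monomial (Finsupp.single i d) (coeff (Finsupp.single i d) f)

open Classical in
theorem coeff_divTail (i : σ) (d : ℕ) (f : MvPowerSeries σ k) (n : σ →₀ ℕ) :
    coeff n (divTail i d f) = if n = Finsupp.single i d then 0 else coeff n f := by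
  classical
  rw [divTail, map_sub, coeff_monomial]
  split_ifs with h
  · rw [h, sub_self]
  · rw [sub_zero]

theorem lt_divWeight_of_coeff_divTail_ne_zero {i : σ} {d : ℕ} {f : MvPowerSeries σ k}
    (hf : IsRegularIn i d f) {n : σ →₀ ℕ} (hn : coeff n (divTail i d f) ≠ 0) :
    d < divWeight i d n := by
  classical
  rw [coeff_divTail] at hn
  split_ifs at hn with h
  · exact absurd rfl hn
  by_cases hj : ∃ j, j ≠ i ∧ n j ≠ 0
  · obtain ⟨j, hji, hj⟩ := hj
    have := Finsupp.le_weight_of_ne_zero' (fun j => if j = i then 1 else d + 1) hj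
    rw [if_neg hji] at this
    exact this
  · push Not at hj
    have hn' : n = Finsupp.single i (n i) := by
      ext j
      by_cases hji : j = i
      · rw [hji]; simp
      · rw [hj j hji, Finsupp.single_eq_of_ne hji]
    rw [hn', divWeight_single]
    refine lt_of_not_ge fun hle => ?_
    rcases hle.lt_or_eq with hlt | heq
    · exact hn (by rw [hn']; exact hf.1 _ hlt)
    · exact h (by rw [hn', heq])

theorem coeff_mul_eq_divTail (i : σ) (d : ℕ) (q f : MvPowerSeries σ k) (n : σ →₀ ℕ) :
    coeff (n + Finsupp.single i d) (q * f) =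
      coeff n q * coeff (Finsupp.single i d) f +
        coeff (n + Finsupp.single i d) (q * divTail i d f) := by
  have : f = monomial (Finsupp.single i d) (coeff (Finsupp.single i d) f) + divTail i d f := by
    rw [divTail]; ring
  conv_lhs => rw [this, mul_add, map_add, coeff_add_mul_monomial]

/-- The coefficient at `n` shifted by `d` of `q * divTail i d f` only involves coefficients
of `q` of weight less than that of `n`. -/
theorem coeff_mul_divTail_congr {i : σ} {d : ℕ} {f : MvPowerSeries σ k}
    (hf : IsRegularIn i d f) {q q' : MvPowerSeries σ k} {n : σ →₀ ℕ}
    (h : ∀ m, divWeight i d m < divWeight i d n → coeff m q = coeff m q') :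
    coeff (n + Finsupp.single i d) (q * divTail i d f) =
      coeff (n + Finsupp.single i d) (q' * divTail i d f) := by
  classical
  rw [coeff_mul, coeff_mul]
  refine Finset.sum_congr rfl fun p hp => ?_
  by_cases h0 : coeff p.2 (divTail i d f) = 0
  · rw [h0, mul_zero, mul_zero]
  · rw [h p.1]
    have h1 := lt_divWeight_of_coeff_divTail_ne_zero hf h0
    have h2 := congrArg (divWeight i d) (Finset.HasAntidiagonal.mem_antidiagonal.mp hp)
    rw [map_add, map_add, divWeight_single] at h2
    omega

theorem weierstrass_unique_zero {i : σ} {d : ℕ} {f q r : MvPowerSeries σ k}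
    (hf : IsRegularIn i d f) (hr : DegreeInLT i d r) (h : q * f + r = 0) : q = 0 ∧ r = 0 := by
  have key : ∀ N, ∀ n, divWeight i d n < N → coeff n q = 0 := by
    intro N
    induction N with
    | zero => intro n hn; omega
    | succ N ih =>
      intro n hn
      have h1 := congrArg (coeff (n + Finsupp.single i d)) h
      rw [map_add, coeff_mul_eq_divTail, hr _ (by simp),
        coeff_mul_divTail_congr hf (q' := 0) fun m hm => by
          rw [ih m (by omega), map_zero]] at h1
      simpa [hf.2] using h1
  have hq : q = 0 := by ext n; exact key _ n (Nat.lt_succ_self _)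
  exact ⟨hq, by simpa [hq] using h⟩

theorem weierstrass_unique {i : σ} {d : ℕ} {f q r q' r' : MvPowerSeries σ k}
    (hf : IsRegularIn i d f) (hr : DegreeInLT i d r) (hr' : DegreeInLT i d r')
    (h : q * f + r = q' * f + r') : q = q' ∧ r = r' := by
  obtain ⟨h1, h2⟩ := weierstrass_unique_zero (q := q - q') hf (hr.sub hr')
    (by linear_combination h)
  exact ⟨sub_eq_zero.mp h1, sub_eq_zero.mp h2⟩

/-- The successive approximations of the Weierstrass quotient of `g` by `f`. -/
noncomputable def quotApprox (i : σ) (d : ℕ) (f g : MvPowerSeries σ k) :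
    ℕ → MvPowerSeries σ k
  | 0 => 0
  | N + 1 => fun n => (coeff (Finsupp.single i d) f)⁻¹ * (coeff (n + Finsupp.single i d) g -
      coeff (n + Finsupp.single i d) (quotApprox i d f g N * divTail i d f))

theorem coeff_quotApprox_succ (i : σ) (d : ℕ) (f g : MvPowerSeries σ k) (N : ℕ) (n : σ →₀ ℕ) :
    coeff n (quotApprox i d f g (N + 1)) = (coeff (Finsupp.single i d) f)⁻¹ *
      (coeff (n + Finsupp.single i d) g -
        coeff (n + Finsupp.single i d) (quotApprox i d f g N * divTail i d f)) := rfl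

theorem coeff_quotApprox_succ_eq {i : σ} {d : ℕ} {f : MvPowerSeries σ k} (hf : IsRegularIn i d f)
    (g : MvPowerSeries σ k) (N : ℕ) : ∀ n, divWeight i d n < N →
      coeff n (quotApprox i d f g (N + 1)) = coeff n (quotApprox i d f g N) := by
  induction N with
  | zero => intro n hn; omega
  | succ N ih =>
    intro n hn
    rw [coeff_quotApprox_succ, coeff_quotApprox_succ,
      coeff_mul_divTail_congr hf fun m hm => ih m (by omega)]

theorem coeff_quotApprox_eq {i : σ} {d : ℕ} {f : MvPowerSeries σ k} (hf : IsRegularIn i d f)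
    (g : MvPowerSeries σ k) {n : σ →₀ ℕ} {N : ℕ} (h : divWeight i d n < N) :
    coeff n (quotApprox i d f g N) = coeff n (quotApprox i d f g (divWeight i d n + 1)) := by
  induction N, (show divWeight i d n + 1 ≤ N from h) using Nat.le_induction with
  | base => rfl
  | succ N hN ih => rw [coeff_quotApprox_succ_eq hf g N n hN, ih hN]

/-- The Weierstrass quotient of `g` by a series `f` regular of order `d` in `x_i`. -/
noncomputable def weierstrassQuot (i : σ) (d : ℕ) (f g : MvPowerSeries σ k) :
    MvPowerSeries σ k :=
  fun n => coeff n (quotApprox i d f g (divWeight i d n + 1))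

theorem coeff_weierstrassQuot {i : σ} {d : ℕ} {f : MvPowerSeries σ k} (hf : IsRegularIn i d f)
    (g : MvPowerSeries σ k) {n : σ →₀ ℕ} {N : ℕ} (h : divWeight i d n < N) :
    coeff n (weierstrassQuot i d f g) = coeff n (quotApprox i d f g N) :=
  (coeff_quotApprox_eq hf g h).symm

theorem degreeInLT_sub_weierstrassQuot {i : σ} {d : ℕ} {f : MvPowerSeries σ k}
    (hf : IsRegularIn i d f) (g : MvPowerSeries σ k) :
    DegreeInLT i d (g - weierstrassQuot i d f g * f) := by
  intro n hn
  obtain ⟨n, rfl⟩ : ∃ n', n = n' + Finsupp.single i d :=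
    ⟨n - Finsupp.single i d, by
      rw [tsub_add_cancel_of_le]; exact Finsupp.single_le_iff.mpr hn⟩
  rw [map_sub, coeff_mul_eq_divTail, coeff_weierstrassQuot hf g (Nat.lt_succ_self _),
    coeff_quotApprox_succ, coeff_mul_divTail_congr hf (q' := quotApprox i d f g (divWeight i d n))
      fun m hm => coeff_weierstrassQuot hf g hm]
  field_simp [hf.2]
  ring

end Weierstrass

section Norm

open ENNReal

variable {k : Type*} [Field k] {σ : Type*} (v : AbsoluteValue k ℝ) (ω : (σ →₀ ℕ) →+ ℕ)

/-- The weighted `ℓ¹`-norm `∑ |cₙ| s ^ ω(n)` of a power series. -/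
noncomputable def wnorm (s : ℝ≥0∞) (f : MvPowerSeries σ k) : ℝ≥0∞ :=
  ∑' n, ENNReal.ofReal (v (coeff n f)) * s ^ ω n

variable {v ω}

theorem wnorm_mono {s : ℝ≥0∞} {f g : MvPowerSeries σ k}
    (h : ∀ n, v (coeff n f) ≤ v (coeff n g)) : wnorm v ω s f ≤ wnorm v ω s g :=
  ENNReal.tsum_le_tsum fun n => mul_le_mul_left (ENNReal.ofReal_le_ofReal (h n)) _

theorem wnorm_mul_le (s : ℝ≥0∞) (f g : MvPowerSeries σ k) :
    wnorm v ω s (f * g) ≤ wnorm v ω s f * wnorm v ω s g := by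
  classical
  set F : (σ →₀ ℕ) → ℝ≥0∞ := fun n => ENNReal.ofReal (v (coeff n f)) * s ^ ω n with hF
  set G : (σ →₀ ℕ) → ℝ≥0∞ := fun n => ENNReal.ofReal (v (coeff n g)) * s ^ ω n with hG
  have h1 : wnorm v ω s f * wnorm v ω s g =
      ∑' n, ∑ p ∈ Finset.HasAntidiagonal.antidiagonal n, F p.1 * G p.2 := by
    have : ∑' p : (σ →₀ ℕ) × (σ →₀ ℕ), F p.1 * G p.2 = wnorm v ω s f * wnorm v ω s g := by
      rw [ENNReal.tsum_prod (f := fun a b => F a * G b)]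
      simp only [ENNReal.tsum_mul_left, ENNReal.tsum_mul_right]
      rfl
    rw [← this, ← (Finset.HasAntidiagonal.sigmaAntidiagonalEquivProd (A := σ →₀ ℕ)).tsum_eq,
      ENNReal.tsum_sigma']
    refine tsum_congr fun n => ?_
    rw [tsum_fintype]
    exact Finset.sum_coe_sort (Finset.HasAntidiagonal.antidiagonal n) (fun p => F p.1 * G p.2)
  rw [h1, wnorm]
  refine ENNReal.tsum_le_tsum fun n => ?_
  rw [coeff_mul]
  calc ENNReal.ofReal (v (∑ p ∈ Finset.HasAntidiagonal.antidiagonal n,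
        coeff p.1 f * coeff p.2 g)) * s ^ ω n
      ≤ (∑ p ∈ Finset.HasAntidiagonal.antidiagonal n,
          ENNReal.ofReal (v (coeff p.1 f * coeff p.2 g))) * s ^ ω n := by
        gcongr
        rw [← ENNReal.ofReal_sum_of_nonneg fun p _ => v.nonneg _]
        exact ENNReal.ofReal_le_ofReal (v.sum_le _ _)
    _ = _ := by
        rw [Finset.sum_mul]
        refine Finset.sum_congr rfl fun p hp => ?_
        rw [← Finset.HasAntidiagonal.mem_antidiagonal.mp hp, map_add, pow_add, map_mul,
          ENNReal.ofReal_mul (v.nonneg _), hF, hG]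
        ring

theorem isConvergent_of_wnorm_ne_top {i : σ} {d : ℕ} {s : ℝ} (hs : 0 < s) (hs1 : s ≤ 1)
    {f : MvPowerSeries σ k} (h : wnorm v (divWeight i d) (ENNReal.ofReal s) f ≠ ∞) :
    IsConvergent v f := by
  refine ⟨s ^ (d + 1), by positivity, ?_⟩
  have h2 : Summable fun n => v (coeff n f) * s ^ divWeight i d n := by
    refine (ENNReal.summable_toReal h).congr fun n => ?_
    rw [ENNReal.toReal_mul, ENNReal.toReal_pow, ENNReal.toReal_ofReal (v.nonneg _),
      ENNReal.toReal_ofReal hs.le]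
  refine Summable.of_nonneg_of_le (fun n => mul_nonneg (v.nonneg _) (by positivity))
    (fun n => ?_) h2
  refine mul_le_mul_of_nonneg_left ?_ (v.nonneg _)
  rw [← pow_mul]
  exact pow_le_pow_of_le_one hs.le hs1 (divWeight_le_degree i d n)

theorem IsConvergent.wnorm_ne_top {f : MvPowerSeries σ k} (hf : IsConvergent v f) (i : σ) (d : ℕ) :
    ∃ s₀ : ℝ, 0 < s₀ ∧ s₀ ≤ 1 ∧ ∀ s : ℝ, 0 < s → s ≤ s₀ →
      wnorm v (divWeight i d) (ENNReal.ofReal s) f ≠ ∞ := by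
  obtain ⟨s₁, hs₁, h⟩ := hf
  refine ⟨min s₁ 1, lt_min hs₁ one_pos, min_le_right _ _, fun s hs hle => ?_⟩
  have h1 : s ≤ 1 := hle.trans (min_le_right _ _)
  have h2 : Summable fun n => v (coeff n f) * s ^ divWeight i d n := by
    refine Summable.of_nonneg_of_le (fun n => mul_nonneg (v.nonneg _) (by positivity))
      (fun n => ?_) h
    refine mul_le_mul_of_nonneg_left ?_ (v.nonneg _)
    exact (pow_le_pow_of_le_one hs.le h1 (degree_le_divWeight i d n)).trans
      (pow_le_pow_left₀ hs.le (hle.trans (min_le_left _ _)) _)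
  have h3 := h2.tsum_ofReal_ne_top
  rw [wnorm]
  convert h3 using 3 with n
  rw [ENNReal.ofReal_mul (v.nonneg _), ENNReal.ofReal_pow hs.le]

theorem isConvergent_weierstrassQuot {i : σ} {d : ℕ} {f g : MvPowerSeries σ k}
    (hreg : IsRegularIn i d f) (hf : IsConvergent v f) (hg : IsConvergent v g) :
    IsConvergent v (weierstrassQuot i d f g) := by
  classical
  obtain ⟨s₁, hs₁, hs₁1, hf⟩ := hf.wnorm_ne_top i d
  obtain ⟨s₂, hs₂, hs₂1, hg⟩ := hg.wnorm_ne_top i d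
  set c := coeff (Finsupp.single i d) f with hc
  set f' := divTail i d f with hf'
  have hvc : 0 < v c := v.pos hreg.2
  have hM : wnorm v (divWeight i d) (ENNReal.ofReal s₁) f' ≠ ∞ := by
    refine ne_top_of_le_ne_top (hf s₁ hs₁ le_rfl) (wnorm_mono fun n => ?_)
    rw [hf', coeff_divTail]
    split_ifs
    · simp
    · exact le_rfl
  set M := (wnorm v (divWeight i d) (ENNReal.ofReal s₁) f').toReal with hMdef
  have hM0 : 0 ≤ M := ENNReal.toReal_nonneg
  -- for a small radius, the tail of `f` has at most half the norm of its leading form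
  set s : ℝ := min (min s₁ s₂) (v c * s₁ ^ (d + 1) / (2 * (M + 1))) with hs
  have hs0 : 0 < s := lt_min (lt_min hs₁ hs₂) (by positivity)
  have hss₁ : s ≤ s₁ := (min_le_left _ _).trans (min_le_left _ _)
  have hss₂ : s ≤ s₂ := (min_le_left _ _).trans (min_le_right _ _)
  have hs1 : s ≤ 1 := hss₁.trans hs₁1
  set S := ENNReal.ofReal s with hS
  set a : ℝ≥0∞ := ENNReal.ofReal (v c) * S ^ d with ha
  have ha0 : a ≠ 0 := mul_ne_zero (by simpa using hreg.2) (pow_ne_zero _ (by simpa [hS] using hs0))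
  have hat : a ≠ ∞ := ENNReal.mul_ne_top ENNReal.ofReal_ne_top (ENNReal.pow_ne_top
    ENNReal.ofReal_ne_top)
  have htail : wnorm v (divWeight i d) S f' ≤ a / 2 := by
    have h1 : wnorm v (divWeight i d) S f' ≤
        ENNReal.ofReal ((s / s₁) ^ (d + 1)) *
          wnorm v (divWeight i d) (ENNReal.ofReal s₁) f' := by
      rw [wnorm, wnorm, ← ENNReal.tsum_mul_left]
      refine ENNReal.tsum_le_tsum fun n => ?_
      by_cases h0 : coeff n f' = 0
      · simp [h0]
      have hw := lt_divWeight_of_coeff_divTail_ne_zero hreg h0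
      rw [mul_left_comm]
      gcongr
      rw [hS, ← ENNReal.ofReal_pow hs0.le, ← ENNReal.ofReal_pow hs₁.le,
        ← ENNReal.ofReal_mul (by positivity)]
      refine ENNReal.ofReal_le_ofReal ?_
      have : s ^ divWeight i d n = (s / s₁) ^ divWeight i d n * s₁ ^ divWeight i d n := by
        rw [← mul_pow, div_mul_cancel₀ _ hs₁.ne']
      rw [this]
      refine mul_le_mul_of_nonneg_right ?_ (by positivity)
      exact pow_le_pow_of_le_one (by positivity) ((div_le_one hs₁).mpr hss₁) hw
    refine h1.trans ?_
    rw [← ENNReal.ofReal_toReal hM, ← hMdef, ← ENNReal.ofReal_mul (by positivity), ha, hS,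
      ← ENNReal.ofReal_pow hs0.le, ← ENNReal.ofReal_mul hvc.le,
      show (2 : ℝ≥0∞) = ENNReal.ofReal 2 by simp, ← ENNReal.ofReal_div_of_pos two_pos]
    refine ENNReal.ofReal_le_ofReal ?_
    have h2 : s ≤ v c * s₁ ^ (d + 1) / (2 * (M + 1)) := min_le_right _ _
    rw [le_div_iff₀ (by positivity)] at h2
    rw [div_pow, div_mul_eq_mul_div, div_le_div_iff₀ (by positivity) two_pos, pow_succ s]
    have h3 : s * (2 * M) ≤ v c * s₁ ^ (d + 1) := by nlinarith
    nlinarith [mul_le_mul_of_nonneg_left h3 (pow_nonneg hs0.le d)]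
  set G := wnorm v (divWeight i d) S g with hGdef
  have hG : G ≠ ∞ := hg s hs0 hss₂
  have hstep : ∀ N, wnorm v (divWeight i d) S (quotApprox i d f g (N + 1)) * a ≤
      G + wnorm v (divWeight i d) S (quotApprox i d f g N) * wnorm v (divWeight i d) S f' := by
    intro N
    refine le_trans ?_ (add_le_add_right (wnorm_mul_le S _ _) _)
    rw [wnorm, ← ENNReal.tsum_mul_right, hGdef, wnorm, wnorm, ← ENNReal.tsum_add]
    refine le_trans (ENNReal.tsum_le_tsum fun n => ?_) (ENNReal.tsum_comp_le_tsum_of_injective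
      (f := fun n : σ →₀ ℕ => n + Finsupp.single i d) (add_left_injective _) _)
    rw [coeff_quotApprox_succ, map_add, divWeight_single, pow_add, ← add_mul, map_mul, map_inv₀,
      ENNReal.ofReal_mul (by positivity), ← hc, ← hf', ha]
    calc _ = (ENNReal.ofReal (v c)⁻¹ * ENNReal.ofReal (v c)) *
          ENNReal.ofReal (v (coeff (n + Finsupp.single i d) g -
            coeff (n + Finsupp.single i d) (quotApprox i d f g N * f'))) *
              (S ^ divWeight i d n * S ^ d) := by ring
      _ ≤ _ := by
        rw [← ENNReal.ofReal_mul (by positivity), inv_mul_cancel₀ hvc.ne', ENNReal.ofReal_one,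
          one_mul]
        gcongr
        rw [← ENNReal.ofReal_add (v.nonneg _) (v.nonneg _)]
        exact ENNReal.ofReal_le_ofReal (v.sub_le_add _ _)
  have hbound : ∀ N, wnorm v (divWeight i d) S (quotApprox i d f g N) ≤ 2 * G / a := by
    intro N
    induction N with
    | zero => simp [quotApprox, wnorm]
    | succ N ih =>
      rw [ENNReal.le_div_iff_mul_le (.inl ha0) (.inl hat)]
      refine (hstep N).trans ((add_le_add_right (mul_le_mul' ih htail) _).trans (le_of_eq ?_))
      rw [div_eq_mul_inv, div_eq_mul_inv]
      calc G + 2 * G * a⁻¹ * (a * 2⁻¹) = G + G * (a⁻¹ * a) * (2 * 2⁻¹) := by ring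
        _ = 2 * G := by
          rw [ENNReal.inv_mul_cancel ha0 hat, ENNReal.mul_inv_cancel two_ne_zero (by simp)]; ring
  refine isConvergent_of_wnorm_ne_top (i := i) (d := d) hs0 hs1
    (ne_top_of_le_ne_top (b := 2 * G / a) ?_ ?_)
  · exact ENNReal.div_ne_top (ENNReal.mul_ne_top (by simp) hG) ha0
  rw [wnorm, ENNReal.tsum_eq_iSup_sum]
  refine iSup_le fun T => ?_
  refine le_trans ?_ (hbound (T.sup (divWeight i d) + 1))
  refine le_trans (le_of_eq ?_) (ENNReal.sum_le_tsum T)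
  refine Finset.sum_congr rfl fun n hn => ?_
  rw [coeff_weierstrassQuot hreg g (Nat.lt_succ_of_le (Finset.le_sup hn))]

end Norm

end Arquile

namespace Arquile

/-! ### Algebraic coordinates in separable extensions -/

section Fields

open Polynomial

/-- In a separable simple extension `F(x)` the coordinates, with respect to the powers of `x`, of an
element that is algebraic over `R` are algebraic over `R` as soon as `x` is: they are recovered by
Lagrange interpolation from the conjugates of `x` and of the given element. -/
theorem isAlgebraic_coeff_of_aeval {R F E : Type*} [CommRing R] [IsDomain R] [Field F] [Field E]
    [Algebra R F] [Algebra F E] [Algebra R E] [IsScalarTower R F E] {x : E}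
    (hint : IsIntegral F x) (hsep : (minpoly F x).Separable) (hx : IsAlgebraic R x) {c : F[X]}
    (hdeg : c.degree < (minpoly F x).degree) (hc : IsAlgebraic R (aeval x c)) (j : ℕ) :
    IsAlgebraic R (c.coeff j) := by
  classical
  let Ω := AlgebraicClosure F
  let A : Subalgebra R Ω := Subalgebra.algebraicClosure R Ω
  set s : Finset Ω := ((minpoly F x).rootSet Ω).toFinset with hs
  have hcard : s.card = (minpoly F x).natDegree := by
    rw [hs, Set.toFinset_card]
    exact card_rootSet_eq_natDegree hsep (IsAlgClosed.splits _)
  -- polynomial relations over `R` transfer from `x` to its conjugates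
  have htransfer : ∀ p : F[X], IsAlgebraic R (aeval x p) → ∀ ρ ∈ s, IsAlgebraic R (aeval ρ p) := by
    rintro p ⟨Q, hQ0, hQ⟩ ρ hρ
    refine ⟨Q, hQ0, ?_⟩
    have hroot : aeval ρ (minpoly F x) = 0 := by
      rw [hs, Set.mem_toFinset, mem_rootSet] at hρ
      exact hρ.2
    have h1 : aeval x ((Q.map (algebraMap R F)).comp p) = 0 := by
      rw [aeval_comp, aeval_map_algebraMap, hQ]
    obtain ⟨q, hq⟩ := minpoly.dvd F x h1
    have h2 := congrArg (aeval ρ) hq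
    rwa [aeval_comp, aeval_map_algebraMap, map_mul, hroot, zero_mul] at h2
  have hρ : ∀ ρ ∈ s, ρ ∈ A := fun ρ h => by
    have h1 := htransfer X (by simpa using hx) ρ h
    rwa [aeval_X] at h1
  have hinterp : c.map (algebraMap F Ω) = Lagrange.interpolate s id fun ρ => aeval ρ c := by
    refine eq_of_degrees_lt_of_eval_finset_eq s ?_ ?_ ?_
    · rw [degree_map, hcard, ← degree_eq_natDegree (minpoly.ne_zero hint)]
      exact hdeg
    · exact Lagrange.degree_interpolate_lt _ (Set.injOn_id _)
    · intro ρ hρ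
      have := Lagrange.eval_interpolate_at_node (v := id) (fun ρ : Ω => aeval ρ c)
        (Set.injOn_id _) hρ
      rw [id] at this
      rw [this, eval_map_algebraMap]
  have hmem : Lagrange.interpolate s id (fun ρ => aeval ρ c) ∈ lifts (algebraMap A Ω) := by
    rw [Lagrange.interpolate_apply]
    refine Subsemiring.sum_mem _ fun ρ h => Subsemiring.mul_mem _
      (C'_mem_lifts ⟨⟨_, htransfer c hc ρ h⟩, rfl⟩) ?_
    refine Subsemiring.prod_mem _ fun ρ' h' => Subsemiring.mul_mem _ ?_ ?_
    · refine C'_mem_lifts (f := algebraMap A Ω) (s := (ρ - ρ')⁻¹) ⟨⟨(ρ - ρ')⁻¹, ?_⟩, rfl⟩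
      exact IsAlgebraic.inv (A.sub_mem (hρ _ h) (hρ _ (Finset.mem_of_mem_erase h')))
    · have : (X - C ρ' : Polynomial Ω) = ((X - C (⟨ρ', hρ _ (Finset.mem_of_mem_erase h')⟩ : A)).map
          (algebraMap A Ω)) := by simp
      rw [id, this]
      exact ⟨_, rfl⟩
  rw [← hinterp] at hmem
  obtain ⟨a, ha⟩ := (lifts_iff_coeff_lifts _).mp hmem j
  rw [coeff_map] at ha
  rw [← isAlgebraic_algebraMap_iff (algebraMap F Ω).injective, ← ha]
  exact a.2

end Fields

/-! ### Algebraic power series -/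

section Algebraic

open MvPowerSeries

variable {k : Type*} [Field k] {σ τ : Type*}

/-- A power series is algebraic if it is algebraic over the polynomials in its variables. -/
abbrev IsAlg (f : MvPowerSeries σ k) : Prop := IsAlgebraic (MvPolynomial σ k) f

theorem isAlg_rename (e : σ ↪ τ) {f : MvPowerSeries σ k} (hf : IsAlg f) : IsAlg (rename e f) := by
  refine IsAlgebraic.ringHom_of_comp_eq (f := (MvPolynomial.rename e).toRingHom)
    (g := (rename (R := k) e).toRingHom) hf (MvPolynomial.rename_injective _ e.injective) ?_
  refine RingHom.ext fun p => ?_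
  exact (MvPowerSeries.rename_coe (f := e) p).symm

theorem killCompl_coe (e : σ ↪ τ) (p : MvPolynomial τ k) :
    killCompl e (p : MvPowerSeries τ k) = (MvPolynomial.killCompl e.injective p : MvPolynomial σ k)
    := by
  ext n
  rw [coeff_killCompl, MvPolynomial.coeff_coe, MvPolynomial.coeff_coe,
    MvPolynomial.coeff_killCompl, Finsupp.embDomain_eq_mapDomain]

theorem X_dvd_of_killCompl_eq_zero {e : σ ↪ τ} {i : τ} (hi : ∀ j, j ≠ i → j ∈ Set.range e)
    {p : MvPolynomial τ k} (hp : MvPolynomial.killCompl e.injective p = 0) :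
    MvPolynomial.X i ∣ p := by
  classical
  rw [MvPolynomial.X_dvd_iff_modMonomial_eq_zero]
  ext n
  rw [MvPolynomial.coeff_zero]
  by_cases hn : Finsupp.single i 1 ≤ n
  · exact MvPolynomial.coeff_modMonomial_of_le _ hn
  · rw [MvPolynomial.coeff_modMonomial_of_not_le _ hn]
    have h0 : n i = 0 := by
      by_contra h; exact hn (Finsupp.single_le_iff.mpr (Nat.one_le_iff_ne_zero.mpr h))
    have hsub : (n.support : Set τ) ⊆ Set.range e := fun j hj =>
      hi j fun h => by rw [h] at hj; simp [h0] at hj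
    have := congrArg (MvPolynomial.coeff (n.comapDomain e e.injective.injOn)) hp
    rwa [MvPolynomial.coeff_killCompl, MvPolynomial.coeff_zero,
      Finsupp.mapDomain_comapDomain _ e.injective _ hsub] at this

/-- Setting a single variable to zero in an algebraic series gives an algebraic series: an equation
for the series can be divided by the variable until it does not vanish identically there. -/
theorem isAlg_killCompl_single [Finite τ] (e : σ ↪ τ) {i : τ}
    (hi : ∀ j, j ≠ i → j ∈ Set.range e) {f : MvPowerSeries τ k} (hf : IsAlg f) :
    IsAlg (killCompl e f) := by
  obtain ⟨P, hP0, hP⟩ := hf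
  have hirr : Irreducible (Polynomial.C (MvPolynomial.X i : MvPolynomial τ k)) :=
    (Polynomial.prime_C_iff.mpr (MvPolynomial.X_prime (i := i))).irreducible
  obtain ⟨n, P', hP', rfl⟩ := WfDvdMonoid.max_power_factor hP0 hirr
  have hX : (X i : MvPowerSeries τ k) ≠ 0 := by
    intro h
    have := congrArg (coeff (Finsupp.single i 1)) h
    simp at this
  have hroot : Polynomial.aeval f P' = 0 := by
    rw [map_mul, map_pow, Polynomial.aeval_C] at hP
    refine (mul_eq_zero.mp hP).resolve_left (pow_ne_zero _ ?_)
    have : algebraMap (MvPolynomial τ k) (MvPowerSeries τ k) (MvPolynomial.X i) = X i :=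
      MvPolynomial.coe_X i
    rwa [this]
  refine ⟨P'.map (MvPolynomial.killCompl (R := k) e.injective).toRingHom, fun h0 => hP' ?_, ?_⟩
  · rw [Polynomial.C_dvd_iff_dvd_coeff]
    intro j
    refine X_dvd_of_killCompl_eq_zero (e := e) hi ?_
    have := congrArg (Polynomial.coeff · j) h0
    simpa using this
  · have h1 := congrArg (killCompl (R := k) e) hroot
    rw [map_zero, Polynomial.aeval_def, ← AlgHom.coe_toRingHom, Polynomial.hom_eval₂] at h1
    rw [Polynomial.aeval_def, Polynomial.eval₂_map]
    rw [← h1]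
    congr 1
    refine RingHom.ext fun p => ?_
    exact (killCompl_coe e p).symm

theorem isAlg_killCompl [Finite τ] (e : σ ↪ τ) {f : MvPowerSeries τ k} (hf : IsAlg f) :
    IsAlg (killCompl e f) := by
  classical
  have : Fintype τ := Fintype.ofFinite τ
  have : Finite σ := Finite.of_injective e e.injective
  have : Fintype σ := Fintype.ofFinite σ
  obtain ⟨n, hn⟩ : ∃ n, Fintype.card τ = Fintype.card σ + n :=
    Nat.exists_eq_add_of_le (Fintype.card_le_of_injective e e.injective)
  induction n generalizing τ with
  | zero =>
    have hb : Function.Bijective e :=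
      (Fintype.bijective_iff_injective_and_card e).mpr ⟨e.injective, hn.symm⟩
    let E : σ ≃ τ := Equiv.ofBijective e hb
    have h1 : killCompl e f = rename E.symm.toEmbedding f := by
      have h2 : f = rename e (rename E.symm.toEmbedding f) := by
        rw [rename_rename]
        have : (e : σ → τ) ∘ E.symm.toEmbedding = id := by
          ext x; exact E.apply_symm_apply x
        simp only [this, rename_id_apply]
      conv_lhs => rw [h2, killCompl_rename_app]
    rw [h1]
    exact isAlg_rename _ hf
  | succ n ih =>
    obtain ⟨i, hi⟩ : ∃ i, i ∉ Set.range e := by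
      by_contra! h
      have := Fintype.card_le_of_surjective e h
      omega
    let s : {j : τ // j ≠ i} ↪ τ := Function.Embedding.subtype _
    let e' : σ ↪ {j : τ // j ≠ i} :=
      ⟨fun x => ⟨e x, fun h => hi ⟨x, h⟩⟩, fun x y h => e.injective (congrArg Subtype.val h)⟩
    have hee : e = e'.trans s := rfl
    have h1 : IsAlg (killCompl s f) :=
      isAlg_killCompl_single s (i := i) (fun j hj => ⟨⟨j, hj⟩, rfl⟩) hf
    have h2 : killCompl e f = killCompl e' (killCompl s f) := by
      ext n
      rw [coeff_killCompl, coeff_killCompl, coeff_killCompl, hee, Finsupp.embDomain_trans_apply]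
    rw [h2]
    refine ih e' h1 inferInstance ?_
    have := Set.card_ne_eq i
    simp only [Set.coe_ofPred] at this
    rw [this]
    omega

end Algebraic

section CoordsDomain

open Polynomial

/-- A version of `isAlgebraic_coeff_of_aeval` for domains: `x` is a root of a monic polynomial `W`
over `A` whose degree is minimal and whose derivative does not vanish at `x`. -/
theorem isAlgebraic_coeff_of_monic {R A B : Type*} [CommRing R] [IsDomain R] [CommRing A]
    [IsDomain A] [CommRing B] [IsDomain B] [Algebra R A] [Algebra A B] [Algebra R B]
    [IsScalarTower R A B] {x : B} {W : A[X]} (hmonic : W.Monic) (hroot : aeval x W = 0)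
    (hmin : ∀ p : A[X], p.degree < W.degree → aeval x p = 0 → p = 0)
    (hder : aeval x (derivative W) ≠ 0) (hx : IsAlgebraic R x) {c : A[X]}
    (hdeg : c.degree < W.degree) (hc : IsAlgebraic R (aeval x c)) (j : ℕ) :
    IsAlgebraic R (c.coeff j) := by
  have hinj : Function.Injective (algebraMap A B) := by
    rw [injective_iff_map_eq_zero]
    intro a ha
    by_cases hW : W.degree ≤ 0
    · have : W = 1 := hmonic.natDegree_eq_zero.mp (natDegree_eq_zero_iff_degree_le_zero.mpr hW)
      rw [this] at hroot
      simp at hroot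
    · exact C_eq_zero.mp (hmin (C a) (degree_C_le.trans_lt (not_le.mp hW)) (by
        rw [aeval_C, ha]))
  let F := FractionRing A
  let E := FractionRing B
  have : FaithfulSMul A B := (faithfulSMul_iff_algebraMap_injective A B).mpr hinj
  have : FaithfulSMul A E := by
    rw [faithfulSMul_iff_algebraMap_injective, IsScalarTower.algebraMap_eq A B E]
    exact (IsFractionRing.injective B E).comp hinj
  let : Algebra F E := FractionRing.liftAlgebra A E
  have : IsScalarTower A F E := FractionRing.isScalarTower_liftAlgebra A E
  have : IsScalarTower R F E := by
    refine IsScalarTower.of_algebraMap_eq fun r => ?_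
    rw [IsScalarTower.algebraMap_apply R A F, ← IsScalarTower.algebraMap_apply A F E,
      IsScalarTower.algebraMap_apply R B E, IsScalarTower.algebraMap_apply R A B,
      ← IsScalarTower.algebraMap_apply A B E]
  set y : E := algebraMap B E x with hy
  have haeval : ∀ p : A[X], aeval y (p.map (algebraMap A F)) = algebraMap B E (aeval x p) := by
    intro p
    rw [aeval_map_algebraMap, hy, aeval_algebraMap_apply]
  have hWm : (W.map (algebraMap A F)).Monic := hmonic.map _
  have hdegmap : ∀ p : A[X], (p.map (algebraMap A F)).degree = p.degree :=
    degree_map_eq_of_injective (IsFractionRing.injective A F)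
  have hmin' : W.map (algebraMap A F) = minpoly F y := by
    refine minpoly.unique' F y hWm (by rw [haeval, hroot, map_zero]) fun q hq => ?_
    by_contra! hcon
    obtain ⟨hq0, hq1⟩ := hcon
    set q' := IsLocalization.integerNormalization (nonZeroDivisors A) q with hq'
    have hq'0 : q' ≠ 0 := fun h => hq0 (IsFractionRing.integerNormalization_eq_zero_iff.mp h)
    refine hq'0 (hmin q' ?_ ?_)
    · refine lt_of_le_of_lt ?_ (hdegmap W ▸ hq)
      exact degree_mono (IsLocalization.integerNormalization_support (nonZeroDivisors A) q)
    · have := IsLocalization.integerNormalization_aeval_eq_zero (nonZeroDivisors A) q hq1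
      rw [hy, aeval_algebraMap_apply] at this
      exact (map_eq_zero_iff _ (IsFractionRing.injective B E)).mp this
  have hint : IsIntegral F y := ⟨_, hWm, by rw [← aeval_def, haeval, hroot, map_zero]⟩
  have hsep : (minpoly F y).Separable := by
    rw [separable_iff_derivative_ne_zero (minpoly.irreducible hint), ← hmin', derivative_map]
    intro h
    have h1 := haeval (derivative W)
    rw [h, map_zero, eq_comm, map_eq_zero_iff _ (IsFractionRing.injective B E)] at h1
    exact hder h1
  have halg : ∀ b : B, IsAlgebraic R b → IsAlgebraic R (algebraMap B E b) := fun b hb =>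
    (isAlgebraic_algebraMap_iff (IsFractionRing.injective B E)).mpr hb
  have h := isAlgebraic_coeff_of_aeval (R := R) hint hsep (halg x hx)
    (c := c.map (algebraMap A F)) (by rwa [← hmin', hdegmap, hdegmap])
    (by rw [haeval]; exact halg _ hc) j
  rw [coeff_map] at h
  exact (isAlgebraic_algebraMap_iff (IsFractionRing.injective A F)).mp h

end CoordsDomain

end Arquile

namespace Arquile

open MvPowerSeries

/-! ### Series in which some of the variables do not occur -/

section FreeOf

variable {k : Type*} [Field k] {σ τ : Type*}

/-- The variables in `S` do not occur in the series `f`. -/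
def FreeOf (S : Set σ) (f : MvPowerSeries σ k) : Prop :=
  ∀ n : σ →₀ ℕ, coeff n f ≠ 0 → ∀ i ∈ S, n i = 0

theorem degreeInLT_one_iff {i : σ} {f : MvPowerSeries σ k} : DegreeInLT i 1 f ↔ FreeOf {i} f := by
  constructor
  · rintro h n hn j rfl
    by_contra h0
    exact hn (h n (Nat.one_le_iff_ne_zero.mpr h0))
  · intro h n hn
    by_contra h0
    have := h n h0 i rfl
    omega

theorem FreeOf.mono {S T : Set σ} (hST : S ⊆ T) {f : MvPowerSeries σ k} (hf : FreeOf T f) :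
    FreeOf S f := fun n hn i hi => hf n hn i (hST hi)

/-- The embedding of the variables outside `S`. -/
def complEmb (S : Set σ) : {j : σ // j ∉ S} ↪ σ := Function.Embedding.subtype _

theorem range_complEmb (S : Set σ) : Set.range (complEmb S) = Sᶜ := Subtype.range_coe

theorem freeOf_rename {S : Set τ} (e : σ ↪ τ) (he : ∀ i, e i ∉ S) (f : MvPowerSeries σ k) :
    FreeOf S (rename e f) := by
  intro n hn i hi
  by_contra h0
  refine hn (coeff_rename_eq_zero _ _ ?_)
  rintro ⟨m, rfl⟩
  rw [← Finsupp.embDomain_eq_mapDomain] at h0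
  by_cases h : i ∈ Set.range e
  · obtain ⟨j, rfl⟩ := h; exact he j hi
  · exact h0 (Finsupp.embDomain_of_notMem_range _ _ _ h)

theorem rename_killCompl {S : Set τ} (e : σ ↪ τ) (he : ∀ i, i ∉ S → i ∈ Set.range e)
    {f : MvPowerSeries τ k} (hf : FreeOf S f) : rename e (killCompl e f) = f := by
  ext n
  by_cases hn : n ∈ Set.range (Finsupp.embDomain e)
  · obtain ⟨m, rfl⟩ := hn
    rw [coeff_embDomain_rename, coeff_killCompl]
  · rw [coeff_rename_eq_zero]
    · by_contra h0
      refine hn (Finsupp.mem_range_embDomain_iff e n |>.mpr fun i hi => he i fun hiS => ?_)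
      exact (Finsupp.mem_support_iff.mp hi) (hf n (Ne.symm h0) i hiS)
    · rintro ⟨m, rfl⟩
      exact hn ⟨m, Finsupp.embDomain_eq_mapDomain _ _⟩

theorem freeOf_iff {S : Set σ} {f : MvPowerSeries σ k} :
    FreeOf S f ↔ rename (complEmb S) (killCompl (complEmb S) f) = f :=
  ⟨rename_killCompl _ fun i hi => ⟨⟨i, hi⟩, rfl⟩, fun h => h ▸ freeOf_rename _ (fun i => i.2) _⟩

/-- The homomorphism setting the variables in `S` to zero. -/
noncomputable def setZero (S : Set σ) : MvPowerSeries σ k →ₐ[k] MvPowerSeries σ k :=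
  (rename (complEmb S)).comp (killCompl (complEmb S))

theorem setZero_eq_self {S : Set σ} {f : MvPowerSeries σ k} : setZero S f = f ↔ FreeOf S f :=
  freeOf_iff.symm

theorem freeOf_setZero (S : Set σ) (f : MvPowerSeries σ k) : FreeOf S (setZero S f) :=
  freeOf_rename _ (fun i => i.2) _

theorem coeff_setZero_of_forall {S : Set σ} (f : MvPowerSeries σ k) {n : σ →₀ ℕ}
    (h : ∀ i ∈ S, n i = 0) : coeff n (setZero S f) = coeff n f := by
  obtain ⟨m, rfl⟩ : n ∈ Set.range (Finsupp.embDomain (complEmb S)) := by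
    rw [Finsupp.mem_range_embDomain_iff, range_complEmb]
    exact fun i hi hiS => (Finsupp.mem_support_iff.mp hi) (h i hiS)
  rw [setZero, AlgHom.comp_apply, coeff_embDomain_rename, coeff_killCompl]

theorem coeff_setZero_ne_zero {S : Set σ} {f : MvPowerSeries σ k} {n : σ →₀ ℕ}
    (h : coeff n (setZero S f) ≠ 0) : coeff n f ≠ 0 := by
  rwa [coeff_setZero_of_forall f (freeOf_setZero S f n h)] at h

theorem FreeOf.add {S : Set σ} {f g : MvPowerSeries σ k} (hf : FreeOf S f) (hg : FreeOf S g) :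
    FreeOf S (f + g) := by
  rw [← setZero_eq_self] at *; rw [map_add, hf, hg]

theorem FreeOf.neg {S : Set σ} {f : MvPowerSeries σ k} (hf : FreeOf S f) : FreeOf S (-f) := by
  rw [← setZero_eq_self] at *; rw [map_neg, hf]

theorem FreeOf.mul {S : Set σ} {f g : MvPowerSeries σ k} (hf : FreeOf S f) (hg : FreeOf S g) :
    FreeOf S (f * g) := by
  rw [← setZero_eq_self] at *; rw [map_mul, hf, hg]

theorem freeOf_X {S : Set σ} {j : σ} (hj : j ∉ S) : FreeOf S (X j : MvPowerSeries σ k) := by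
  classical
  intro n hn i hi
  rw [coeff_X] at hn
  split_ifs at hn with h
  · rw [h, Finsupp.single_eq_of_ne]
    rintro rfl; exact hj hi
  · exact absurd rfl hn

theorem freeOf_C {S : Set σ} (c : k) : FreeOf S (C c : MvPowerSeries σ k) := by
  classical
  intro n hn i hi
  rw [coeff_C] at hn
  split_ifs at hn with h
  · rw [h]; rfl
  · exact absurd rfl hn

theorem freeOf_pderiv {S : Set σ} {f : MvPowerSeries σ k} (hf : FreeOf S f) (i : σ) :
    FreeOf S (pderiv k i f) := by
  intro n hn j hj
  rw [coeff_pderiv] at hn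
  have := hf _ (left_ne_zero_of_mul hn) j hj
  rw [Finsupp.add_apply] at this
  omega

theorem setZero_X_of_mem {S : Set σ} {i : σ} (hi : i ∈ S) :
    setZero S (X i : MvPowerSeries σ k) = 0 := by
  rw [setZero, AlgHom.comp_apply, killCompl_X_eq_zero, map_zero]
  rw [range_complEmb]
  exact fun h => h hi

theorem setZero_X_of_notMem {S : Set σ} {i : σ} (hi : i ∉ S) :
    setZero S (X i : MvPowerSeries σ k) = X i :=
  setZero_eq_self.mpr (freeOf_X hi)

theorem DegreeInLT.setZero {S : Set σ} {i : σ} {d : ℕ} {f : MvPowerSeries σ k}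
    (hf : DegreeInLT i d f) : DegreeInLT i d (setZero S f) := by
  intro n hn
  by_contra h
  exact coeff_setZero_ne_zero h (hf n hn)

/-- A substitution that fixes the variables outside `S` fixes the series free of `S`. -/
theorem subst_eq_self {S : Set σ} {φ : σ → MvPowerSeries σ k} (hφ : HasSubst φ)
    (h : ∀ i, i ∉ S → φ i = X i) {f : MvPowerSeries σ k} (hf : FreeOf S f) : subst φ f = f := by
  have h1 := freeOf_iff.mp hf
  have h2 : (fun i => subst φ ((X ∘ complEmb S : _ → MvPowerSeries σ k) i)) =
      (X ∘ complEmb S : _ → MvPowerSeries σ k) := by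
    ext1 i
    simp only [Function.comp_apply]
    rw [subst_X hφ]
    exact h _ i.2
  conv_lhs => rw [← h1, rename_eq_subst]
  rw [subst_comp_subst_apply (HasSubst.X_comp _) hφ, h2, ← rename_eq_subst, h1]

theorem DegreeInLT.mul_X_pow {i : σ} {f : MvPowerSeries σ k} (hf : FreeOf {i} f) {j d : ℕ}
    (hj : j < d) : DegreeInLT i d (f * X i ^ j) := by
  intro n hn
  rw [X_pow_eq, coeff_mul_monomial]
  split_ifs with h
  · rw [mul_one]
    by_contra h0
    have := hf _ h0 i rfl
    simp only [Finsupp.coe_tsub, Pi.sub_apply, Finsupp.single_eq_same] at this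
    omega
  · rfl

/-- A series of degree less than `d` in `x_i` is a polynomial in `x_i` whose coefficients do not
involve `x_i`, and the coefficients are obtained by successive division by `x_i`. -/
theorem exists_sum_of_degreeInLT {i : σ} (M : Subalgebra k (MvPowerSeries σ k))
    (hM : ∀ f ∈ M, ∃ q ∈ M, ∃ r ∈ M, f = q * X i + r ∧ DegreeInLT i 1 r) (d : ℕ)
    {r : MvPowerSeries σ k} (hrM : r ∈ M) (hr : DegreeInLT i d r) :
    ∃ c : ℕ → MvPowerSeries σ k, (∀ j, c j ∈ M ∧ FreeOf {i} (c j)) ∧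
      r = ∑ j ∈ Finset.range d, c j * X i ^ j := by
  induction d generalizing r with
  | zero =>
    refine ⟨0, fun j => ⟨M.zero_mem, fun n hn => absurd (map_zero _) hn⟩, ?_⟩
    rw [Finset.range_zero, Finset.sum_empty]
    ext n
    rw [hr n (Nat.zero_le _), map_zero]
  | succ d ih =>
    obtain ⟨q, hq, r₀, hr₀, hfr, hdeg⟩ := hM r hrM
    have hqd : DegreeInLT i d q := by
      intro n hn
      have h1 := congrArg (coeff (n + Finsupp.single i 1)) hfr
      rw [map_add, X, coeff_add_mul_monomial, mul_one, hr _ (by simpa using hn),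
        hdeg _ (by simp), add_zero] at h1
      exact h1.symm
    obtain ⟨c, hc, hqc⟩ := ih hq hqd
    refine ⟨fun j => Nat.casesOn j r₀ c, fun j => ?_, ?_⟩
    · cases j with
      | zero => exact ⟨hr₀, degreeInLT_one_iff.mp hdeg⟩
      | succ j => exact hc j
    · rw [Finset.sum_range_succ', hfr, hqc, Finset.sum_mul]
      simp only [pow_zero, mul_one, pow_succ, mul_assoc]
      rfl

theorem isRegularIn_X_sub {i : σ} {φ : MvPowerSeries σ k} (hφ : FreeOf {i} φ)
    (h0 : constantCoeff φ = 0) : IsRegularIn i 1 (X i - φ) := by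
  classical
  constructor
  · intro j hj
    obtain rfl : j = 0 := by omega
    rw [Finsupp.single_zero, coeff_zero_eq_constantCoeff_apply, map_sub, h0, constantCoeff_X,
      sub_zero]
  · rw [map_sub, coeff_X, if_pos rfl]
    have : coeff (Finsupp.single i 1) φ = 0 := by
      by_contra h
      simpa using hφ _ h i rfl
    rw [this, sub_zero]
    exact one_ne_zero

theorem isRegularIn_X (i : σ) : IsRegularIn i 1 (X i : MvPowerSeries σ k) := by
  have := isRegularIn_X_sub (k := k) (i := i) (φ := 0) (fun n hn => absurd (map_zero _) hn)
    (map_zero _)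
  rwa [sub_zero] at this

theorem weierstrass_eq (i : σ) (d : ℕ) (f g : MvPowerSeries σ k) :
    g = weierstrassQuot i d f g * f + (g - weierstrassQuot i d f g * f) := by ring

/-- Formal series have formal coefficients. -/
theorem exists_formal_sum {i : σ} {d : ℕ} {r : MvPowerSeries σ k} (hr : DegreeInLT i d r) :
    ∃ c : ℕ → MvPowerSeries σ k, (∀ j, FreeOf {i} (c j)) ∧
      r = ∑ j ∈ Finset.range d, c j * X i ^ j := by
  obtain ⟨c, hc, h⟩ := exists_sum_of_degreeInLT (k := k) (i := i) ⊤ (fun f _ =>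
    ⟨_, trivial, _, trivial, weierstrass_eq i 1 (X i) f,
      degreeInLT_sub_weierstrassQuot (isRegularIn_X i) f⟩) d (r := r) trivial hr
  exact ⟨c, fun j => (hc j).2, h⟩

/-- A Weierstrass quotient of `x_i ^ d` by a series of order `d` is a unit. -/
theorem coeff_zero_ne_zero_of_X_pow {i : σ} {d : ℕ} {f q r : MvPowerSeries σ k}
    (hf : IsRegularIn i d f) (hr : DegreeInLT i d r) (h : X i ^ d = q * f + r) :
    constantCoeff q ≠ 0 := by
  classical
  intro h0
  have h1 := congrArg (coeff (0 + Finsupp.single i d)) h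
  rw [map_add, coeff_mul_eq_divTail, hr _ (by simp), coeff_zero_eq_constantCoeff_apply, h0,
    coeff_mul_divTail_congr hf (q' := 0) (fun m hm => by
      rw [map_zero] at hm; omega), zero_mul, coeff_X_pow, zero_add, if_pos rfl, zero_mul,
      map_zero, add_zero] at h1
  simp at h1

end FreeOf

end Arquile

namespace Arquile

/-! ### Weierstrass division of algebraic power series -/

section CoordPolynomial

open MvPowerSeries

variable {k : Type*} [Field k] {τ : Type*} (i : τ)

/-- The embedding of the variables other than `x_i`. -/
abbrev neEmb : {v : τ // v ≠ i} ↪ τ := Function.Embedding.subtype _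

variable {i}

/-- Evaluation at `x_i` of a polynomial whose coefficients are series in the other variables. -/
noncomputable def evalX (i : τ) : Polynomial (MvPowerSeries {v : τ // v ≠ i} k) →+*
    MvPowerSeries τ k :=
  Polynomial.eval₂RingHom (rename (R := k) (neEmb i)).toRingHom (X i)

theorem freeOf_rename_neEmb (a : MvPowerSeries {v : τ // v ≠ i} k) :
    FreeOf {i} (rename (neEmb i) a) :=
  freeOf_rename _ (fun v => v.2) _

theorem evalX_eq_sum (p : Polynomial (MvPowerSeries {v : τ // v ≠ i} k)) {d : ℕ}
    (hp : p.degree < d) :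
    evalX i p = ∑ j ∈ Finset.range d, rename (neEmb i) (p.coeff j) * X i ^ j := by
  by_cases h0 : p = 0
  · rw [h0]; simp
  · exact Polynomial.eval₂_eq_sum_range' _ ((Polynomial.natDegree_lt_iff_degree_lt h0).mpr hp) _

theorem degreeInLT_evalX (p : Polynomial (MvPowerSeries {v : τ // v ≠ i} k)) {d : ℕ}
    (hp : p.degree < d) : DegreeInLT i d (evalX i p) := by
  rw [evalX_eq_sum p hp]
  intro n hn
  rw [map_sum]
  exact Finset.sum_eq_zero fun j hj => DegreeInLT.mul_X_pow (freeOf_rename_neEmb _)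
    (Finset.mem_range.mp hj) n hn

theorem coeff_evalX (p : Polynomial (MvPowerSeries {v : τ // v ≠ i} k)) (j : ℕ)
    (n : {v : τ // v ≠ i} →₀ ℕ) :
    coeff (Finsupp.embDomain (neEmb i) n + Finsupp.single i j) (evalX i p) =
      coeff n (p.coeff j) := by
  classical
  have hni : Finsupp.embDomain (neEmb i) n i = 0 :=
    Finsupp.embDomain_of_notMem_range _ _ _ (by rintro ⟨v, hv⟩; exact v.2 hv)
  obtain ⟨d, hd⟩ : ∃ d : ℕ, p.degree < d ∧ j < d := ⟨max (p.natDegree + 1) (j + 1), by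
    refine ⟨lt_of_le_of_lt Polynomial.degree_le_natDegree ?_, by simp⟩
    exact_mod_cast lt_of_lt_of_le (Nat.lt_succ_self _) (le_max_left _ _)⟩
  rw [evalX_eq_sum p hd.1, map_sum, Finset.sum_eq_single j]
  · rw [X_pow_eq, coeff_add_mul_monomial, mul_one, coeff_embDomain_rename]
  · intro l _ hl
    rw [X_pow_eq, coeff_mul_monomial]
    split_ifs with hle
    · by_contra h
      have h1 := freeOf_rename_neEmb _ _ (left_ne_zero_of_mul h) i rfl
      simp only [Finsupp.coe_tsub, Finsupp.coe_add, Pi.sub_apply, Pi.add_apply, hni,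
        Finsupp.single_eq_same] at h1
      have h2 := hle i
      simp only [Finsupp.coe_add, Pi.add_apply, hni, Finsupp.single_eq_same] at h2
      omega
    · rfl
  · intro h; exact absurd (Finset.mem_range.mpr hd.2) h

theorem evalX_injective : Function.Injective (evalX (k := k) i) := by
  rw [injective_iff_map_eq_zero]
  intro p hp
  ext j n
  rw [← coeff_evalX, hp]
  simp

theorem exists_evalX_eq {d : ℕ} {r : MvPowerSeries τ k} (hr : DegreeInLT i d r) :
    ∃ p : Polynomial (MvPowerSeries {v : τ // v ≠ i} k), p.degree < d ∧ evalX i p = r := by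
  obtain ⟨c, hc, rfl⟩ := exists_formal_sum hr
  refine ⟨∑ j ∈ Finset.range d, Polynomial.C (killCompl (neEmb i) (c j)) * Polynomial.X ^ j,
    ?_, ?_⟩
  · refine (Polynomial.degree_sum_le _ _).trans_lt ?_
    rw [Finset.sup_lt_iff (by exact WithBot.bot_lt_coe d)]
    intro j hj
    exact (Polynomial.degree_C_mul_X_pow_le _ _).trans_lt (by
      exact_mod_cast Finset.mem_range.mp hj)
  · rw [map_sum]
    refine Finset.sum_congr rfl fun j _ => ?_
    rw [map_mul, map_pow, evalX, Polynomial.coe_eval₂RingHom, Polynomial.eval₂_C,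
      Polynomial.eval₂_X]
    congr 1
    exact rename_killCompl (S := {i}) _ (fun v hv => ⟨⟨v, hv⟩, rfl⟩) (hc j)

theorem pderiv_evalX (p : Polynomial (MvPowerSeries {v : τ // v ≠ i} k)) :
    pderiv k i (evalX i p) = evalX i (Polynomial.derivative p) := by
  have hfree : ∀ a : MvPowerSeries {v : τ // v ≠ i} k, pderiv k i (rename (neEmb i) a) = 0 := by
    intro a
    ext n
    rw [coeff_pderiv, map_zero]
    by_contra h
    have := freeOf_rename_neEmb a _ (left_ne_zero_of_mul h) i rfl
    simp at this
  induction p using Polynomial.induction_on' with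
  | add p q hp hq => rw [map_add, map_add, hp, hq, Polynomial.derivative_add, map_add]
  | monomial n a =>
    rw [Polynomial.derivative_monomial]
    simp only [evalX, Polynomial.coe_eval₂RingHom, Polynomial.eval₂_monomial,
      Derivation.leibniz, pderiv_pow, pderiv_X_self, mul_one, smul_eq_mul]
    have := hfree a
    simp only [AlgHom.toRingHom_eq_coe, RingHom.coe_coe, map_mul, map_natCast]
    rw [this]
    ring

end CoordPolynomial

section ExchangeVariables

variable {k : Type*} [Field k] {τ : Type*}

/-- Polynomials in `τ` are polynomials in one variable `a ∈ τ` over those in the others. -/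
noncomputable def splitVar (a : τ) [DecidableEq τ] :
    Polynomial (MvPolynomial {v : τ // v ≠ a} k) ≃ₐ[k] MvPolynomial τ k :=
  (MvPolynomial.optionEquivLeft k _).symm.trans
    (MvPolynomial.renameEquiv k (Equiv.optionSubtypeNe a))

theorem aeval_splitVar {B : Type*} [CommRing B] [Algebra k B] (a : τ) [DecidableEq τ] (φ : τ → B)
    (p : Polynomial (MvPolynomial {v : τ // v ≠ a} k)) :
    MvPolynomial.aeval φ (splitVar a p) = Polynomial.eval₂
      (MvPolynomial.aeval (fun v : {v : τ // v ≠ a} => φ v) :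
        MvPolynomial {v : τ // v ≠ a} k →ₐ[k] B).toRingHom (φ a) p := by
  have : ((MvPolynomial.aeval φ : MvPolynomial τ k →ₐ[k] B).toRingHom.comp
      (splitVar (k := k) a).toRingEquiv.toRingHom) = Polynomial.eval₂RingHom
      (MvPolynomial.aeval (fun v : {v : τ // v ≠ a} => φ v) :
        MvPolynomial {v : τ // v ≠ a} k →ₐ[k] B).toRingHom (φ a) := by
    refine Polynomial.ringHom_ext' ?_ ?_
    · refine MvPolynomial.ringHom_ext (fun c => ?_) fun v => ?_
      · simp [splitVar]
      · simp [splitVar]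
    · simp [splitVar]
  exact RingHom.congr_fun this p

end ExchangeVariables

end Arquile

namespace Arquile

section AlgebraicDivision

open MvPowerSeries

variable {k : Type*} [Field k] {τ : Type*}

theorem isAlg_X (i : τ) : IsAlg (X i : MvPowerSeries τ k) := by
  have := isAlgebraic_algebraMap (R := MvPolynomial τ k) (A := MvPowerSeries τ k)
    (MvPolynomial.X i)
  rwa [show algebraMap (MvPolynomial τ k) (MvPowerSeries τ k) (MvPolynomial.X i) = X i from
    MvPolynomial.coe_X i] at this

/-- The inclusion into the power series of the polynomials in the variables other than `x_a`. -/
noncomputable def aevalNe (k : Type*) [Field k] (a : τ) :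
    MvPolynomial {v : τ // v ≠ a} k →ₐ[k] MvPowerSeries τ k :=
  MvPolynomial.aeval fun v => X v.1

theorem aevalNe_apply {a : τ} (p : MvPolynomial {v : τ // v ≠ a} k) :
    aevalNe k a p = rename (neEmb a) (p : MvPowerSeries {v : τ // v ≠ a} k) := by
  rw [rename_coe, aevalNe]
  induction p using MvPolynomial.induction_on with
  | C c => simp [MvPowerSeries.algebraMap_apply]
  | add p q hp hq => rw [map_add, map_add, hp, hq, MvPolynomial.coe_add]
  | mul_X p v hp =>
    rw [map_mul, map_mul, hp, MvPolynomial.aeval_X, MvPolynomial.rename_X, MvPolynomial.coe_mul,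
      MvPolynomial.coe_X]
    rfl

theorem aevalNe_injective {a : τ} : Function.Injective (aevalNe k a) := fun p q h => by
  rw [aevalNe_apply, aevalNe_apply] at h
  exact MvPolynomial.coe_injective _ _ (rename_injective (neEmb a) h)

/-- An algebraic series not involving `x_a` is algebraic over the polynomials not involving
`x_a`. -/
theorem exists_eval₂_eq_zero [Finite τ] {a : τ} {h : MvPowerSeries τ k} (hfree : FreeOf {a} h)
    (hh : IsAlg h) : ∃ p : Polynomial (MvPolynomial {v : τ // v ≠ a} k), p ≠ 0 ∧
      Polynomial.eval₂ (aevalNe k a).toRingHom h p = 0 := by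
  obtain ⟨p, hp0, hp⟩ := isAlg_killCompl (neEmb a) hh
  refine ⟨p, hp0, ?_⟩
  have h1 := congrArg (rename (R := k) (neEmb a)).toRingHom hp
  rw [Polynomial.aeval_def, Polynomial.hom_eval₂, map_zero,
    show (rename (R := k) (neEmb a)).toRingHom (killCompl (neEmb a) h) = h from
    rename_killCompl (S := {a}) _ (fun v hv => ⟨⟨v, hv⟩, rfl⟩) hfree] at h1
  rw [← h1]
  congr 1
  exact RingHom.ext fun q => aevalNe_apply q

theorem isRegularIn_perturbed {i a b : τ} (hai : a ≠ i) (hbi : b ≠ i) {d : ℕ}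
    {f : MvPowerSeries τ k} (hreg : IsRegularIn i d f) :
    IsRegularIn i d (f + X b * X i + X a) := by
  classical
  have hcoeffP : ∀ j, coeff (Finsupp.single i j) (f + X b * X i + X a) =
      coeff (Finsupp.single i j) f := by
    intro j
    have h1 : coeff (Finsupp.single i j) (X b * X i : MvPowerSeries τ k) = 0 := by
      rw [← coeff_setZero_of_forall (S := {b}), map_mul, setZero_X_of_mem (Set.mem_singleton b),
        zero_mul, map_zero]
      rintro v rfl
      exact Finsupp.single_eq_of_ne hbi
    have h2 : coeff (Finsupp.single i j) (X a : MvPowerSeries τ k) = 0 := by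
      rw [coeff_X, if_neg]
      intro h
      have := DFunLike.congr_fun h a
      rw [Finsupp.single_eq_same, Finsupp.single_eq_of_ne hai] at this
      omega
    rw [map_add, map_add, h1, h2, add_zero, add_zero]
  exact ⟨fun j hj => (hcoeffP j).trans (hreg.1 j hj), by rw [hcoeffP]; exact hreg.2⟩

set_option maxHeartbeats 1000000 in
/-- The coefficients of the remainder under division of an algebraic series `g` by the perturbation
`f + x_b x_i + x_a` of an algebraic series `f` are algebraic. Substituting `x_a = -(f + x_b x_i)`
exhibits `g` as a polynomial in `x_i` over the series not involving `x_i`; the perturbation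
ensures that `x_i` generates a separable extension, so that `isAlgebraic_coeff_of_monic` applies. -/
theorem isAlg_remainder_perturbed [Finite τ] {i a b : τ} (hai : a ≠ i) (hbi : b ≠ i) (hab : a ≠ b)
    {d : ℕ} (hd : 0 < d) {f g q r : MvPowerSeries τ k} (hf : IsAlg f) (hg : IsAlg g)
    (hfree : FreeOf {a, b} f) (hgfree : FreeOf {a, b} g) (hreg : IsRegularIn i d f)
    (hr : DegreeInLT i d r) (hgr : g = q * (f + X b * X i + X a) + r) : IsAlg r := by
  classical
  set P := f + X b * X i + X a with hP
  set ℓ := -(f + X b * X i) with hℓ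
  have hfa : FreeOf {a} f := hfree.mono (by simp)
  have hℓa : FreeOf {a} ℓ :=
    (hfa.add ((freeOf_X (by simpa using hab.symm)).mul (freeOf_X (by simpa using hai.symm)))).neg
  have hPℓ : P = X a - ℓ := by rw [hP, hℓ]; ring
  have hf0 : constantCoeff f = 0 := by
    have := hreg.1 0 hd
    rwa [Finsupp.single_zero] at this
  have hℓ0 : constantCoeff ℓ = 0 := by
    rw [hℓ, map_neg, map_add, map_mul, constantCoeff_X, zero_mul, add_zero, hf0, neg_zero]
  have hP0 : constantCoeff P = 0 := by rw [hPℓ, map_sub, constantCoeff_X, hℓ0, sub_zero]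
  have hPa : IsRegularIn a 1 P := hPℓ ▸ isRegularIn_X_sub hℓa hℓ0
  have hPi : IsRegularIn i d P := isRegularIn_perturbed hai hbi hreg
  -- the substitution `x_a = ℓ`, whose kernel is generated by `P`
  have hsub : HasSubst (Function.update (X : τ → MvPowerSeries τ k) a ℓ) := by
    refine hasSubst_of_constantCoeff_zero fun v => ?_
    by_cases hv : v = a
    · rw [hv, Function.update_self, hℓ0]
    · rw [Function.update_of_ne hv, constantCoeff_X]
  set θ : MvPowerSeries τ k →ₐ[k] MvPowerSeries τ k := substAlgHom hsub with hθ
  have hθfree : ∀ h, FreeOf {a} h → θ h = h := fun h hh => by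
    rw [hθ, substAlgHom_apply]
    exact subst_eq_self hsub (fun v hv => Function.update_of_ne (by simpa using hv) _ _) hh
  have hθX : ∀ v, v ≠ a → θ (X v) = X v := fun v hv => hθfree _ (freeOf_X (by simpa using hv))
  have hθa : θ (X a) = ℓ := by rw [hθ, substAlgHom_X, Function.update_self]
  have hθP : θ P = 0 := by rw [hPℓ, map_sub, hθa, hθfree ℓ hℓa, sub_self]
  have hθker : ∀ h, θ h = 0 → ∃ Q, h = Q * P := by
    intro h hh
    have h1 := weierstrass_eq a 1 P h
    set h' := h - weierstrassQuot a 1 P h * P with hh'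
    have h2 : DegreeInLT a 1 h' := degreeInLT_sub_weierstrassQuot hPa h
    have h3 := congrArg θ h1
    rw [map_add, map_mul, hθP, mul_zero, zero_add, hh,
      hθfree h' (degreeInLT_one_iff.mp h2)] at h3
    exact ⟨_, by rw [← h3, add_zero] at h1; exact h1⟩
  have hθinj : ∀ h, DegreeInLT i d h → θ h = 0 → h = 0 := by
    intro h hh h0
    obtain ⟨Q, hQ⟩ := hθker h h0
    exact (weierstrass_unique hPi hh (fun n _ => map_zero _) (q := 0) (q' := Q)
      (by rw [← hQ]; ring)).2
  -- the rings and algebra structures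
  let Λ := MvPowerSeries {v : τ // v ≠ i} k
  let R := MvPolynomial {v : τ // v ≠ i} k
  let B := MvPowerSeries τ k
  let ψ : Λ →+* B := (θ : B →+* B).comp (rename (R := k) (neEmb i)).toRingHom
  let : Algebra Λ B := ψ.toAlgebra
  let : Algebra R B := (ψ.comp (algebraMap R Λ)).toAlgebra
  have : IsScalarTower R Λ B := IsScalarTower.of_algebraMap_eq fun _ => rfl
  have haeval : ∀ p : Polynomial Λ, Polynomial.aeval (X i : B) p = θ (evalX i p) := by
    intro p
    have h1 := Polynomial.hom_eval₂ p (rename (R := k) (neEmb i)).toRingHom (θ : B →+* B) (X i)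
    rw [show (θ : B →+* B) (X i) = X i from hθX i hai.symm] at h1
    exact h1.symm
  -- the equation of `x_i`
  obtain ⟨w, hw, hw'⟩ := exists_evalX_eq (k := k) (i := i) (d := d)
    (degreeInLT_sub_weierstrassQuot hPi (X i ^ d))
  set Q := weierstrassQuot i d P (X i ^ d) with hQ
  let W : Polynomial Λ := Polynomial.X ^ d - w
  have hWdeg : W.degree = d := by
    rw [Polynomial.degree_sub_eq_left_of_degree_lt] <;> rw [Polynomial.degree_X_pow]
    exact hw
  have hWeval : evalX i W = Q * P := by
    rw [map_sub, hw', map_pow]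
    simp [evalX]
  have hmonic : W.Monic := Polynomial.monic_X_pow_sub (by
    exact Polynomial.degree_lt_iff_coeff_zero _ _ |>.mpr fun m hm =>
      Polynomial.coeff_eq_zero_of_degree_lt (hw.trans_le (by exact_mod_cast hm)))
  have hroot : Polynomial.aeval (X i : B) W = 0 := by
    rw [haeval, hWeval, map_mul, hθP, mul_zero]
  have hmin : ∀ p : Polynomial Λ, p.degree < W.degree → Polynomial.aeval (X i : B) p = 0 →
      p = 0 := by
    intro p hp h0
    rw [haeval] at h0
    exact (map_eq_zero_iff _ evalX_injective).mp (hθinj _ (degreeInLT_evalX p (hWdeg ▸ hp)) h0)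
  have hder : Polynomial.aeval (X i : B) (Polynomial.derivative W) ≠ 0 := by
    rw [haeval, ← pderiv_evalX, hWeval, Derivation.leibniz, smul_eq_mul, smul_eq_mul, map_add,
      map_mul, map_mul, hθP, zero_mul, add_zero]
    refine mul_ne_zero (fun h0 => ?_) ?_
    · obtain ⟨Q', hQ'⟩ := hθker Q h0
      refine coeff_zero_ne_zero_of_X_pow hPi (degreeInLT_sub_weierstrassQuot hPi (X i ^ d))
        (weierstrass_eq i d P (X i ^ d)) ?_
      rw [← hQ, hQ', map_mul, hP0, mul_zero]
    · have h1 : pderiv k i P = pderiv k i f + X b := by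
        rw [hP, map_add, map_add, Derivation.leibniz, pderiv_X_self, pderiv_X_of_ne hbi,
          pderiv_X_of_ne hai]
        simp
      rw [h1, hθfree _ ((freeOf_pderiv hfa i).add (freeOf_X (by simpa using hab.symm)))]
      intro h0
      have h2 := congrArg (coeff (Finsupp.single b 1)) h0
      have h3 : coeff (Finsupp.single b 1) (pderiv k i f) = 0 := by
        by_contra h
        simpa using freeOf_pderiv hfree i _ h b (by simp)
      rw [map_add, h3, coeff_X, if_pos rfl, zero_add, map_zero] at h2
      exact one_ne_zero h2
  -- `x_i` is algebraic over the polynomials in the other variables, by exchange with `ℓ`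
  have hRB : ∀ v : {v : τ // v ≠ i}, algebraMap R B (MvPolynomial.X v) = θ (X v.1) := by
    intro v
    change θ (rename (neEmb i) ((MvPolynomial.X v : R) : Λ)) = _
    rw [MvPolynomial.coe_X, rename_X]
    rfl
  have hRaeval : (algebraMap R B : R →+* B) = (MvPolynomial.aeval
      (fun v : {v : τ // v ≠ i} => Function.update (X : τ → B) a ℓ v) : R →ₐ[k] B).toRingHom := by
    refine MvPolynomial.ringHom_ext (fun c => ?_) fun v => ?_
    · change θ (rename (neEmb i) ((MvPolynomial.C c : R) : Λ)) = _
      rw [MvPolynomial.coe_C, rename_C, ← hθfree (C c) (freeOf_C c)]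
      simp only [hθfree (C c) (freeOf_C c), AlgHom.toRingHom_eq_coe, RingHom.coe_coe]
      exact (MvPolynomial.aeval_C _ _).symm
    · rw [hRB, hθ, substAlgHom_X]
      simp
  have hℓalg : IsAlg ℓ := (hf.add ((isAlg_X b).mul (isAlg_X i))).neg
  have hx : IsAlgebraic R (X i : B) := by
    obtain ⟨p, hp0, hp⟩ := exists_eval₂_eq_zero hℓa hℓalg
    refine ⟨(splitVar i).symm (splitVar a p), by simpa using hp0, ?_⟩
    have h1 := aeval_splitVar i (Function.update (X : τ → B) a ℓ)
      ((splitVar i).symm (splitVar a p))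
    rw [AlgEquiv.apply_symm_apply, aeval_splitVar, Function.update_self, ← hRaeval,
      Function.update_of_ne hai.symm] at h1
    rw [Polynomial.aeval_def, ← h1]
    rw [show (fun v : {v : τ // v ≠ a} => Function.update (X : τ → B) a ℓ v) = fun v => X v.1 from
      funext fun v => Function.update_of_ne v.2 _ _]
    exact hp
  have hgalg : IsAlgebraic R g := by
    obtain ⟨p, hp0, hp⟩ := exists_eval₂_eq_zero (a := a) (hgfree.mono (by simp)) hg
    let A := Subalgebra.algebraicClosure R B
    have hXA : ∀ v : {v : τ // v ≠ a}, (X v.1 : B) ∈ A := by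
      intro v
      by_cases hv : v.1 = i
      · rw [hv]; exact hx
      · rw [← hθX v.1 v.2, ← hRB ⟨v.1, hv⟩]
        exact isAlgebraic_algebraMap _
    have hCA : ∀ c : k, algebraMap k B c ∈ A := by
      intro c
      have h1 : algebraMap R B (MvPolynomial.C c) = algebraMap k B c := by
        rw [hRaeval]; exact (MvPolynomial.aeval_C _ _)
      rw [← h1]
      exact isAlgebraic_algebraMap _
    have hmem : ∀ z : MvPolynomial {v : τ // v ≠ a} k,
        aevalNe k a z ∈ A := by
      intro z
      induction z using MvPolynomial.induction_on with
      | C c => rw [aevalNe, MvPolynomial.aeval_C]; exact hCA c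
      | add p q hp hq => rw [map_add]; exact A.add_mem hp hq
      | mul_X p v hp => rw [map_mul, aevalNe, MvPolynomial.aeval_X]; exact A.mul_mem hp (hXA v)
    let χ : MvPolynomial {v : τ // v ≠ a} k →+* A := RingHom.codRestrict
      (aevalNe k a : MvPolynomial {v : τ // v ≠ a} k →+* B) A.toSubring hmem
    have hχinj : Function.Injective χ := fun x y hxy =>
      aevalNe_injective (congrArg Subtype.val hxy)
    have hA : IsAlgebraic A g := by
      refine ⟨p.map χ, (Polynomial.map_ne_zero_iff hχinj).mpr hp0, ?_⟩
      rw [Polynomial.aeval_def, Polynomial.eval₂_map]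
      exact hp
    exact IsAlgebraic.restrictScalars R hA
  obtain ⟨c, hc, hcr⟩ := exists_evalX_eq (k := k) hr
  have hcg : Polynomial.aeval (X i : B) c = g := by
    have h1 := congrArg θ hgr
    rw [map_add, map_mul, hθP, mul_zero, zero_add, hθfree g (hgfree.mono (by simp))] at h1
    rw [haeval, hcr, h1]
  have : IsDomain Λ := NoZeroDivisors.to_isDomain (MvPowerSeries _ k)
  have : IsDomain B := NoZeroDivisors.to_isDomain (MvPowerSeries _ k)
  have hcoeff : ∀ j, IsAlgebraic R (c.coeff j) :=
    isAlgebraic_coeff_of_monic hmonic hroot hmin hder hx (hWdeg ▸ hc) (hcg ▸ hgalg)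
  rw [← hcr, evalX_eq_sum c hc]
  exact Subalgebra.sum_mem (Subalgebra.algebraicClosure (MvPolynomial τ k) (MvPowerSeries τ k))
    fun j _ => (isAlg_rename _ (hcoeff j)).mul ((isAlg_X i).pow j)

end AlgebraicDivision

end Arquile

namespace Arquile

/-! ### Weierstrass division for the three kinds of series -/

section Quality

open MvPowerSeries

variable {k : Type*} [Field k] {σ τ : Type*}

theorem killCompl_rename_self (e : σ ↪ τ) (f : MvPowerSeries σ k) :
    killCompl e (rename e f) = f := by
  ext n
  rw [coeff_killCompl, coeff_embDomain_rename]

theorem DegreeInLT.killCompl {e : σ ↪ τ} {i : σ} {d : ℕ} {r : MvPowerSeries τ k}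
    (hr : DegreeInLT (e i) d r) : DegreeInLT i d (killCompl e r) := by
  intro n hn
  rw [coeff_killCompl]
  exact hr _ (by rwa [Finsupp.embDomain_apply_self])

theorem IsRegularIn.rename {e : σ ↪ τ} {i : σ} {d : ℕ} {f : MvPowerSeries σ k}
    (hf : IsRegularIn i d f) : IsRegularIn (e i) d (rename e f) := by
  have h : ∀ j, coeff (Finsupp.single (e i) j) (MvPowerSeries.rename e f) =
      coeff (Finsupp.single i j) f := fun j => by
    rw [← Finsupp.embDomain_single, coeff_embDomain_rename]
  exact ⟨fun j hj => (h j).trans (hf.1 j hj), by rw [h]; exact hf.2⟩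

theorem IsRegularIn.ne_zero {i : σ} {d : ℕ} {f : MvPowerSeries σ k} (hf : IsRegularIn i d f) :
    f ≠ 0 := by
  rintro rfl
  exact hf.2 (map_zero _)

theorem isAlg_weierstrass_remainder [Finite σ] {i : σ} {d : ℕ} {f g : MvPowerSeries σ k}
    (hreg : IsRegularIn i d f) (hf : IsAlg f) (hg : IsAlg g) :
    IsAlg (g - weierstrassQuot i d f g * f) := by
  have hr := degreeInLT_sub_weierstrassQuot hreg g
  rcases Nat.eq_zero_or_pos d with rfl | hd
  · have h0 : g - weierstrassQuot i 0 f g * f = 0 := by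
      ext n
      exact hr n (Nat.zero_le _)
    rw [h0]
    exact isAlgebraic_zero
  -- two new variables make room for the perturbation
  let s : σ ↪ Option (Option σ) := Function.Embedding.some.trans Function.Embedding.some
  let a : Option (Option σ) := none
  let b : Option (Option σ) := some none
  have hsa : ∀ j, s j ≠ a := fun j => nofun
  have hsb : ∀ j, s j ≠ b := fun j h => by simp [s, b] at h
  have hfree : ∀ h : MvPowerSeries σ k, FreeOf {a, b} (rename s h) := fun h =>
    freeOf_rename s (fun j => by
      rintro (h | h)
      · exact hsa j h
      · exact hsb j h) h
  have hP := isRegularIn_perturbed (hsa i).symm (hsb i).symm (hreg.rename (e := s))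
  set P := rename s f + X b * X (s i) + X a with hPdef
  have hr' := degreeInLT_sub_weierstrassQuot hP (rename s g)
  have halg := isAlg_remainder_perturbed (hsa i).symm (hsb i).symm (by simp [a, b]) hd
    (isAlg_rename s hf) (isAlg_rename s hg) (hfree f) (hfree g) hreg.rename hr'
    (weierstrass_eq (s i) d P (rename s g))
  have hkP : killCompl s P = f := by
    rw [hPdef, map_add, map_add, map_mul, killCompl_rename_self,
      killCompl_X_eq_zero (t := a) (by rintro ⟨j, hj⟩; exact hsa j hj),
      killCompl_X_eq_zero (t := b) (by rintro ⟨j, hj⟩; exact hsb j hj), zero_mul, add_zero,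
      add_zero]
  have h1 := congrArg (killCompl s) (weierstrass_eq (s i) d P (rename s g))
  rw [map_add, map_mul, hkP, killCompl_rename_self] at h1
  rw [(weierstrass_unique hreg hr hr'.killCompl
    ((weierstrass_eq i d f g).symm.trans h1)).2]
  exact isAlg_killCompl s halg

theorem isAlg_weierstrassQuot [Finite σ] {i : σ} {d : ℕ} {f g : MvPowerSeries σ k}
    (hreg : IsRegularIn i d f) (hf : IsAlg f) (hg : IsAlg g) :
    IsAlg (weierstrassQuot i d f g) := by
  refine IsAlgebraic.of_mul (mem_nonZeroDivisors_of_ne_zero hreg.ne_zero) hf ?_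
  have := hg.sub (isAlg_weierstrass_remainder hreg hf hg)
  rwa [sub_sub_cancel, mul_comm] at this

theorem IsConvergent.rename {v : AbsoluteValue k ℝ} (e : σ ↪ τ) {f : MvPowerSeries σ k}
    (hf : IsConvergent v f) : IsConvergent v (rename e f) := by
  obtain ⟨s, hs, h⟩ := hf
  refine ⟨s, hs, ?_⟩
  rw [← Function.Injective.summable_iff (Finsupp.embDomain_injective e)]
  · convert h using 1
    ext n
    simp only [Function.comp_apply, coeff_embDomain_rename]
    congr 2
    simp [Finsupp.embDomain_eq_mapDomain]
  · intro n hn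
    rw [coeff_rename_eq_zero _ _ (by
      rintro ⟨m, rfl⟩; exact hn ⟨m, Finsupp.embDomain_eq_mapDomain _ _⟩), map_zero,
      zero_mul]

theorem IsConvergent.killCompl {v : AbsoluteValue k ℝ} (e : σ ↪ τ) {f : MvPowerSeries τ k}
    (hf : IsConvergent v f) : IsConvergent v (killCompl e f) := by
  obtain ⟨s, hs, h⟩ := hf
  refine ⟨s, hs, ?_⟩
  refine (h.comp_injective (Finsupp.embDomain_injective e)).congr fun n => ?_
  rw [Function.comp_apply, coeff_killCompl]
  congr 2
  simp [Finsupp.embDomain_eq_mapDomain]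

theorem isConvergent_X (v : AbsoluteValue k ℝ) (i : σ) :
    IsConvergent v (X i : MvPowerSeries σ k) := by
  classical
  refine ⟨1, one_pos, summable_of_ne_finset_zero (s := {Finsupp.single i 1}) fun n hn => ?_⟩
  rw [coeff_X, if_neg (by simpa using hn)]
  simp

variable (Q : Quality k)

theorem series_X (i : σ) : (X i : MvPowerSeries σ k) ∈ Q.series σ :=
  match Q with
  | .formal => trivial
  | .convergent v => isConvergent_X v i
  | .algebraic => isAlg_X i

theorem series_C (c : k) : (C c : MvPowerSeries σ k) ∈ Q.series σ :=
  Subalgebra.algebraMap_mem _ c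

variable {Q}

theorem series_rename (e : σ ↪ τ) {f : MvPowerSeries σ k} (hf : f ∈ Q.series σ) :
    rename e f ∈ Q.series τ :=
  match Q, hf with
  | .formal, _ => trivial
  | .convergent _, hf => IsConvergent.rename e hf
  | .algebraic, hf => isAlg_rename e hf

theorem series_killCompl [Finite τ] (e : σ ↪ τ) {f : MvPowerSeries τ k} (hf : f ∈ Q.series τ) :
    killCompl e f ∈ Q.series σ :=
  match Q, hf with
  | .formal, _ => trivial
  | .convergent _, hf => IsConvergent.killCompl e hf
  | .algebraic, hf => isAlg_killCompl e hf

theorem series_setZero [Finite σ] (S : Set σ) {f : MvPowerSeries σ k} (hf : f ∈ Q.series σ) :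
    setZero S f ∈ Q.series σ :=
  series_rename _ (series_killCompl _ hf)

theorem series_weierstrassQuot [Finite σ] {i : σ} {d : ℕ} {f g : MvPowerSeries σ k}
    (hreg : IsRegularIn i d f) (hf : f ∈ Q.series σ) (hg : g ∈ Q.series σ) :
    weierstrassQuot i d f g ∈ Q.series σ :=
  match Q, hf, hg with
  | .formal, _, _ => trivial
  | .convergent _, hf, hg => isConvergent_weierstrassQuot hreg hf hg
  | .algebraic, hf, hg => isAlg_weierstrassQuot hreg hf hg

/-- Weierstrass division inside each of the three kinds of power series. -/
theorem exists_weierstrass [Finite σ] {i : σ} {d : ℕ} {f g : MvPowerSeries σ k}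
    (hreg : IsRegularIn i d f) (hf : f ∈ Q.series σ) (hg : g ∈ Q.series σ) :
    ∃ q ∈ Q.series σ, ∃ r ∈ Q.series σ, g = q * f + r ∧ DegreeInLT i d r :=
  have hq := series_weierstrassQuot hreg hf hg
  ⟨_, hq, _, sub_mem hg (mul_mem hq hf), weierstrass_eq i d f g,
    degreeInLT_sub_weierstrassQuot hreg g⟩

theorem exists_sum_of_degreeInLT_series [Finite σ] {i : σ} {d : ℕ} {r : MvPowerSeries σ k}
    (hrM : r ∈ Q.series σ) (hr : DegreeInLT i d r) :
    ∃ c : ℕ → MvPowerSeries σ k, (∀ j, c j ∈ Q.series σ ∧ FreeOf {i} (c j)) ∧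
      r = ∑ j ∈ Finset.range d, c j * X i ^ j :=
  exists_sum_of_degreeInLT _ (fun _ hf => exists_weierstrass (isRegularIn_X i) (series_X Q i) hf)
    d hrM hr

/-- A series of the given kind with nonzero constant term is invertible in its ring. -/
theorem exists_series_mul_eq_one [Finite σ] {f : MvPowerSeries σ k} (hf : f ∈ Q.series σ)
    (h0 : constantCoeff f ≠ 0) : ∃ g ∈ Q.series σ, g * f = 1 := by
  rcases isEmpty_or_nonempty σ with hσ | ⟨⟨i⟩⟩
  · have : f = C (constantCoeff f) := by
      ext n
      rw [Subsingleton.elim n 0]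
      simp
    refine ⟨C (constantCoeff f)⁻¹, series_C Q _, ?_⟩
    rw [this, ← map_mul]
    simp [h0]
  · have hreg : IsRegularIn i 0 f := ⟨fun j hj => by omega, by simpa using h0⟩
    obtain ⟨q, hq, r, -, h, hr⟩ := exists_weierstrass hreg hf (one_mem _)
    refine ⟨q, hq, ?_⟩
    rw [h, left_eq_add]
    ext n
    exact hr n (Nat.zero_le _)

end Quality

end Arquile

namespace Arquile

/-! ### Elimination, composition and differentiation -/

section Elimination

open MvPowerSeries

variable {k : Type*} [Field k] {σ τ ρ : Type*} {Q : Quality k}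

/-- Division by the series `x_i - φ_i`, for `i ∈ S`, where the `φ_i` do not involve the variables
in `S`: the remainder does not involve these variables either. -/
theorem exists_elim [Finite σ] (S : Finset σ) {φ : σ → MvPowerSeries σ k}
    (hφ : ∀ i ∈ S, φ i ∈ Q.series σ) (hfree : ∀ i ∈ S, FreeOf (S : Set σ) (φ i))
    (h0 : ∀ i ∈ S, constantCoeff (φ i) = 0) {f : MvPowerSeries σ k} (hf : f ∈ Q.series σ) :
    ∃ r ∈ Q.series σ, FreeOf (S : Set σ) r ∧ ∃ c : σ → MvPowerSeries σ k,
      (∀ i, c i ∈ Q.series σ) ∧ f = r + ∑ i ∈ S, c i * (X i - φ i) := by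
  classical
  suffices h : ∀ T ⊆ S, ∃ r ∈ Q.series σ, FreeOf (T : Set σ) r ∧ ∃ c : σ → MvPowerSeries σ k,
      (∀ i, c i ∈ Q.series σ) ∧ f = r + ∑ i ∈ T, c i * (X i - φ i) from h S subset_rfl
  intro T
  induction T using Finset.induction_on with
  | empty => exact fun _ => ⟨f, hf, fun _ _ i hi => absurd hi (by simp), 0, fun _ => zero_mem _,
      by simp⟩
  | insert i T hi ih =>
    intro hT
    rw [Finset.insert_subset_iff] at hT
    obtain ⟨r, hr, hrfree, c, hc, hfr⟩ := ih hT.2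
    have hTS : (T : Set σ) ⊆ S := by exact_mod_cast hT.2
    have hiS : ({i} : Set σ) ⊆ S := by simpa using hT.1
    have hreg : IsRegularIn i 1 (X i - φ i) :=
      isRegularIn_X_sub ((hfree i hT.1).mono hiS) (h0 i hT.1)
    have hdiv : X i - φ i ∈ Q.series σ := sub_mem (series_X Q i) (hφ i hT.1)
    obtain ⟨q, hq, r', hr', hqr, hdeg⟩ := exists_weierstrass hreg hdiv hr
    -- setting the variables in `T` to zero keeps the remainder free of them
    have h1 := congrArg (setZero (T : Set σ)) hqr
    rw [setZero_eq_self.mpr hrfree, map_add, map_mul, map_sub,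
      setZero_X_of_notMem (by simpa using hi),
      setZero_eq_self.mpr ((hfree i hT.1).mono hTS)] at h1
    have hqT : setZero (T : Set σ) q ∈ Q.series σ := series_setZero _ hq
    have hrT : setZero (T : Set σ) r' ∈ Q.series σ := series_setZero _ hr'
    refine ⟨_, hrT, ?_, Function.update c i (setZero (T : Set σ) q), ?_, ?_⟩
    · intro n hn j hj
      rw [Finset.coe_insert, Set.mem_insert_iff] at hj
      rcases hj with rfl | hj
      · have h2 : FreeOf {j} (setZero (T : Set σ) r') := degreeInLT_one_iff.mp hdeg.setZero
        exact h2 n hn j rfl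
      · exact freeOf_setZero _ _ n hn j hj
    · intro j
      by_cases hj : j = i
      · rw [hj, Function.update_self]; exact hqT
      · rw [Function.update_of_ne hj]; exact hc j
    · rw [Finset.sum_insert hi, Function.update_self, hfr]
      have h2 : ∑ j ∈ T, Function.update c i (setZero (T : Set σ) q) j * (X j - φ j) =
          ∑ j ∈ T, c j * (X j - φ j) := Finset.sum_congr rfl fun j hj => by
        rw [Function.update_of_ne (by rintro rfl; exact hi hj)]
      rw [h2]
      nth_rw 1 [h1]
      ring

theorem subst_rename (e : σ ↪ τ) {a : τ → MvPowerSeries ρ k} (ha : HasSubst a)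
    (f : MvPowerSeries σ k) : subst a (rename e f) = subst (fun i => a (e i)) f := by
  rw [rename_eq_subst, subst_comp_subst_apply (HasSubst.X_comp _) ha]
  congr 1
  ext1 i
  exact subst_X ha _

/-- Composition does not lead out of the three kinds of power series. -/
theorem series_subst [Finite σ] [Finite τ] {a : σ → MvPowerSeries τ k}
    (ha : ∀ i, a i ∈ Q.series τ) (h0 : ∀ i, constantCoeff (a i) = 0) {f : MvPowerSeries σ k}
    (hf : f ∈ Q.series σ) : subst a f ∈ Q.series τ := by
  classical
  have : Fintype σ := Fintype.ofFinite σ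
  let inl : σ ↪ σ ⊕ τ := Function.Embedding.inl
  let inr : τ ↪ σ ⊕ τ := Function.Embedding.inr
  let S : Finset (σ ⊕ τ) := Finset.univ.map inl
  let φ : σ ⊕ τ → MvPowerSeries (σ ⊕ τ) k := Sum.elim (fun i => rename inr (a i)) 0
  have hS : ∀ j, inr j ∉ (S : Set (σ ⊕ τ)) := fun j h => by simp [S, inl, inr] at h
  have hmem : ∀ i ∈ S, ∃ j, i = inl j := fun i hi => by
    obtain ⟨j, -, rfl⟩ := Finset.mem_map.mp hi
    exact ⟨j, rfl⟩
  obtain ⟨r, hr, hrfree, c, hc, h⟩ := exists_elim (Q := Q) S (φ := φ) (f := rename inl f)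
    (by intro i hi; obtain ⟨j, rfl⟩ := hmem i hi; exact series_rename inr (ha j))
    (by intro i hi; obtain ⟨j, rfl⟩ := hmem i hi; exact freeOf_rename inr hS _)
    (by intro i hi; obtain ⟨j, rfl⟩ := hmem i hi; exact (constantCoeff_rename _ _).trans (h0 j))
    (series_rename inl hf)
  have hb : HasSubst (Sum.elim a X : σ ⊕ τ → MvPowerSeries τ k) := by
    refine hasSubst_of_constantCoeff_zero fun i => ?_
    rcases i with i | i
    · exact h0 i
    · exact constantCoeff_X i
  have hr0 : rename inr (killCompl inr r) = r := by
    refine rename_killCompl (S := (S : Set (σ ⊕ τ))) _ (fun i hi => ?_) hrfree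
    rcases i with i | i
    · exact absurd (Finset.mem_coe.mpr (Finset.mem_map_of_mem inl (Finset.mem_univ i))) hi
    · exact ⟨i, rfl⟩
  have h1 := congrArg (substAlgHom hb) h
  rw [map_add, map_sum, Finset.sum_eq_zero, add_zero, substAlgHom_apply, substAlgHom_apply,
    subst_rename inl hb, ← hr0, subst_rename inr hb] at h1
  · have h2 : subst (fun i : τ => (Sum.elim a X : σ ⊕ τ → MvPowerSeries τ k) (inr i))
        (killCompl inr r) = killCompl inr r := congrFun subst_self _
    rw [h2] at h1
    exact h1 ▸ series_killCompl inr hr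
  · intro i hi
    obtain ⟨j, rfl⟩ := hmem i hi
    have h2 : subst (Sum.elim a X : σ ⊕ τ → MvPowerSeries τ k) (rename inr (a j)) = a j := by
      rw [subst_rename inr hb]
      exact congrFun subst_self _
    have h3 : substAlgHom hb (φ (inl j)) = a j := (substAlgHom_apply hb _).trans h2
    rw [map_mul, map_sub, substAlgHom_X, h3, show (Sum.elim a X : σ ⊕ τ → MvPowerSeries τ k)
      (inl j) = a j from rfl, sub_self, mul_zero]

theorem freeOf_univ_iff {f : MvPowerSeries σ k} :
    FreeOf Set.univ f ↔ f = C (constantCoeff f) := by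
  classical
  refine ⟨fun h => ?_, fun h => h ▸ freeOf_C _⟩
  ext n
  rw [coeff_C]
  split_ifs with hn
  · rw [hn]; rfl
  · by_contra h0
    exact hn (Finsupp.ext fun i => h n h0 i trivial)

/-- The maximal ideal is generated by the variables. -/
theorem exists_eq_C_add_sum [Fintype σ] {f : MvPowerSeries σ k} (hf : f ∈ Q.series σ) :
    ∃ c : σ → MvPowerSeries σ k, (∀ i, c i ∈ Q.series σ) ∧
      f = C (constantCoeff f) + ∑ i, c i * X i := by
  obtain ⟨r, -, hr, c, hc, h⟩ := exists_elim (Q := Q) Finset.univ (φ := 0)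
    (fun _ _ => zero_mem _) (fun _ _ n hn => absurd (map_zero _) hn) (fun _ _ => map_zero _) hf
  rw [Finset.coe_univ, freeOf_univ_iff] at hr
  have h0 : constantCoeff f = constantCoeff r := by
    rw [h, map_add, map_sum, Finset.sum_eq_zero, add_zero]
    intro i _
    simp
  refine ⟨c, hc, ?_⟩
  rw [h0, ← hr]
  simpa using h

/-- A derivation along a substitution is determined by its values on the variables. -/
theorem eq_zero_of_twisted_derivation [Finite σ] (s : Q.series σ → MvPowerSeries τ k)
    (hs : ∀ i, constantCoeff (s ⟨X i, series_X Q i⟩) = 0) (d : Q.series σ →+ MvPowerSeries τ k)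
    (hmul : ∀ f g, d (f * g) = s f * d g + s g * d f)
    (hC : ∀ c, d ⟨C c, series_C Q c⟩ = 0) (hX : ∀ i, d ⟨X i, series_X Q i⟩ = 0)
    (f : Q.series σ) : d f = 0 := by
  classical
  have : Fintype σ := Fintype.ofFinite σ
  suffices h : ∀ N : ℕ, ∀ f : Q.series σ, ∀ n : τ →₀ ℕ, n.degree < N → coeff n (d f) = 0 by
    ext n
    exact h _ f n (Nat.lt_succ_self _)
  intro N
  induction N with
  | zero => intro f n hn; omega
  | succ N ih =>
    intro f n hn
    obtain ⟨c, hc, h⟩ := exists_eq_C_add_sum f.2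
    have h1 : f = ⟨C (constantCoeff f.1), series_C Q _⟩ +
        ∑ i, (⟨c i, hc i⟩ : Q.series σ) * ⟨X i, series_X Q i⟩ := by
      apply Subtype.ext
      rw [h]
      simp
    rw [h1, map_add, hC, zero_add, map_sum, map_sum]
    refine Finset.sum_eq_zero fun i _ => ?_
    rw [hmul, hX, mul_zero, zero_add, coeff_mul]
    refine Finset.sum_eq_zero fun p hp => ?_
    by_cases hp0 : p.1 = 0
    · rw [hp0]
      exact mul_eq_zero_of_left (hs i) _
    · rw [ih _ p.2, mul_zero]
      have h2 := Finset.HasAntidiagonal.mem_antidiagonal.mp hp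
      have h3 : p.1.degree ≠ 0 := by rwa [Ne, Finsupp.degree_eq_zero_iff]
      rw [← h2, map_add] at hn
      omega

/-- The chain rule. -/
theorem pderiv_subst [Fintype σ] {a : σ → MvPowerSeries τ k}
    (h0 : ∀ i, constantCoeff (a i) = 0) (j : τ) (f : MvPowerSeries σ k) :
    pderiv k j (subst a f) = ∑ i, subst a (pderiv k i f) * pderiv k j (a i) := by
  classical
  have ha := hasSubst_of_constantCoeff_zero h0
  set s := substAlgHom (R := k) ha with hs
  have hsf : ∀ g, subst a g = s g := fun g => (substAlgHom_apply ha g).symm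
  have hsX : ∀ i, s (X i) = a i := fun i => substAlgHom_X ha i
  simp only [hsf]
  clear_value s
  let d : (Quality.formal : Quality k).series σ →+ MvPowerSeries τ k :=
    { toFun := fun f => pderiv k j (s f.1) - ∑ i, s (pderiv k i f.1) * pderiv k j (a i)
      map_zero' := by simp
      map_add' := fun f g => by
        simp only [AddMemClass.coe_add, map_add, add_mul, Finset.sum_add_distrib]
        ring }
  have := eq_zero_of_twisted_derivation (fun f => s f.1)
    (fun i => by rw [hsX, h0]) d (fun f g => ?_) (fun c => ?_) (fun i => ?_) ⟨f, trivial⟩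
  · exact sub_eq_zero.mp this
  · change pderiv k j (s (f.1 * g.1)) - _ = _
    have h1 : ∀ i, s (pderiv k i (f * g).1) * pderiv k j (a i) =
        s f.1 * (s (pderiv k i g.1) * pderiv k j (a i)) +
        s g.1 * (s (pderiv k i f.1) * pderiv k j (a i)) := by
      intro i
      rw [MulMemClass.coe_mul, Derivation.leibniz]
      simp only [map_add, map_mul, smul_eq_mul]
      ring
    rw [Finset.sum_congr rfl fun i _ => h1 i, Finset.sum_add_distrib, ← Finset.mul_sum,
      ← Finset.mul_sum, map_mul, Derivation.leibniz, smul_eq_mul, smul_eq_mul]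
    change _ = s f.1 * (_ - _) + s g.1 * (_ - _)
    ring
  · change pderiv k j (s (C c)) - ∑ i, s (pderiv k i (C c)) * pderiv k j (a i) = 0
    have hsC : s (C c) = C c := s.commutes c
    simp [hsC]
  · change pderiv k j (s (X i)) - ∑ l, s (pderiv k l (X i)) * pderiv k j (a l) = 0
    rw [hsX, Finset.sum_eq_single i, pderiv_X_self, map_one, one_mul, sub_self]
    · intro l _ hl
      rw [pderiv_X_of_ne hl.symm, map_zero, zero_mul]
    · simp

/-- Partial derivatives do not lead out of the three kinds of power series. -/
theorem series_pderiv [Finite σ] (i : σ) {f : MvPowerSeries σ k} (hf : f ∈ Q.series σ) :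
    pderiv k i f ∈ Q.series σ := by
  classical
  have : Fintype σ := Fintype.ofFinite σ
  -- the derivative is the linear coefficient in `z` of `f (x + z e_i)`
  let a : σ → MvPowerSeries (Option σ) k := fun j => X (some j) + if j = i then X none else 0
  let b : Option σ → MvPowerSeries σ k := fun o => o.elim 0 X
  have ha0 : ∀ j, constantCoeff (a j) = 0 := fun j => by
    simp only [a]; split_ifs <;> simp
  have hb0 : ∀ o, constantCoeff (b o) = 0 := fun o => by cases o <;> simp [b]
  have ha := hasSubst_of_constantCoeff_zero ha0
  have hb := hasSubst_of_constantCoeff_zero hb0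
  have haQ : ∀ j, a j ∈ Q.series (Option σ) := fun j => by
    simp only [a]
    split_ifs
    · exact add_mem (series_X _ _) (series_X _ _)
    · exact add_mem (series_X _ _) (zero_mem _)
  have hbQ : ∀ o, b o ∈ Q.series σ := fun o => by
    cases o
    · exact zero_mem _
    · exact series_X _ _
  have hba : ∀ g : MvPowerSeries σ k, subst b (subst a g) = g := by
    intro g
    rw [subst_comp_subst_apply ha hb]
    have : (fun j => subst b (a j)) = (X : σ → MvPowerSeries σ k) := by
      ext1 j
      simp only [a]
      split_ifs
      · rw [subst_add hb, subst_X hb, subst_X hb]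
        exact add_zero _
      · rw [add_zero, subst_X hb]
        rfl
    rw [this]
    exact congrFun subst_self g
  obtain ⟨q, hq, r, -, h, hr⟩ := exists_weierstrass (isRegularIn_X (none : Option σ))
    (series_X Q none) (series_subst haQ ha0 hf)
  have h1 := pderiv_subst ha0 none f
  have h2 : ∀ j, pderiv k none (a j) = if j = i then 1 else 0 := by
    intro j
    simp only [a]
    split_ifs <;> simp [pderiv_X_of_ne]
  have h3 : pderiv k none r = 0 := by
    ext n
    rw [coeff_pderiv, hr _ (by simp), zero_mul, map_zero]
  rw [Finset.sum_eq_single i (fun j _ hj => by rw [h2, if_neg hj, mul_zero]) (by simp), h2,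
    if_pos rfl, mul_one, h, map_add, h3, add_zero, Derivation.leibniz, pderiv_X_self] at h1
  have h4 := congrArg (substAlgHom hb) h1
  rw [substAlgHom_apply, substAlgHom_apply, hba, subst_add hb, smul_eq_mul, smul_eq_mul, mul_one,
    subst_mul hb, subst_X hb] at h4
  rw [← h4, show b none = 0 from rfl, zero_mul, add_zero]
  exact series_subst hbQ hb0 hq

end Elimination

/-! ### Roots of series with vanishing derivatives -/

section PthRoot

open MvPowerSeries

variable {k : Type*} [Field k] {σ : Type*} {Q : Quality k}

theorem summable_pow_degree [Finite σ] {r : ℝ} (hr0 : 0 ≤ r) (hr1 : r < 1) :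
    Summable fun n : σ →₀ ℕ => r ^ n.degree := by
  induction σ using Finite.induction_empty_option with
  | of_equiv e ih =>
    rw [← (Finsupp.domCongr (M := ℕ) e).toEquiv.summable_iff]
    refine ih.congr fun n => ?_
    simp [Finsupp.equivMapDomain_eq_mapDomain]
  | h_empty => exact (hasSum_fintype _).summable
  | @h_option σ _ ih =>
    rw [← (Finsupp.optionEquiv (M := ℕ)).symm.summable_iff]
    refine ((summable_geometric_of_lt_one hr0 hr1).mul_of_nonneg ih (fun n => pow_nonneg hr0 n)
      (fun n => pow_nonneg hr0 _)).congr fun n => ?_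
    rw [← pow_add]
    congr 1
    simp [Finsupp.degree_eq_sum, Finsupp.update, Finsupp.embDomain_eq_mapDomain,
      Finsupp.mapDomain_apply (Option.some_injective σ)]

/-- Over a perfect field of characteristic `p`, a series all of whose partial derivatives vanish
is a `p`-th power. -/
theorem exists_pow_eq [Finite σ] (p : ℕ) [Fact p.Prime] [CharP k p] [PerfectRing k p]
    {f : MvPowerSeries σ k} (hf : f ∈ Q.series σ) (hder : ∀ i, pderiv k i f = 0) :
    ∃ c ∈ Q.series σ, c ^ p = f := by
  have hp0 : p ≠ 0 := (Fact.out : p.Prime).ne_zero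
  let c : MvPowerSeries σ k := fun n => (frobeniusEquiv k p).symm (coeff (p • n) f)
  have hcn : ∀ n, coeff n c ^ p = coeff (p • n) f := fun n =>
    frobenius_apply_frobeniusEquiv_symm k p _
  have hc : c ^ p = f := by
    rw [← map_frobenius_expand p hp0]
    ext m
    rw [coeff_map]
    by_cases h : ∀ i, p ∣ m i
    · obtain ⟨n, rfl⟩ : ∃ n : σ →₀ ℕ, m = p • n := by
        choose n hn using h
        refine ⟨Finsupp.equivFunOnFinite.symm n, ?_⟩
        ext i
        simp [hn i]
      rw [coeff_expand_smul]
      exact hcn n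
    · push Not at h
      obtain ⟨i, hi⟩ := h
      rw [coeff_expand_of_not_dvd p hp0 _ hi, map_zero]
      obtain ⟨n, rfl⟩ : ∃ n, m = n + Finsupp.single i 1 := ⟨m - Finsupp.single i 1, by
        rw [tsub_add_cancel_of_le]
        rw [Finsupp.single_le_iff]
        exact Nat.one_le_iff_ne_zero.mpr fun h => hi (h ▸ dvd_zero _)⟩
      have h1 := congrArg (coeff n) (hder i)
      rw [coeff_pderiv, map_zero] at h1
      refine ((mul_eq_zero.mp h1).resolve_right fun h2 => hi ?_).symm
      rw [← CharP.cast_eq_zero_iff k p]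
      simpa using h2
  refine ⟨c, ?_, hc⟩
  match Q, hf with
  | .formal, _ => exact trivial
  | .algebraic, hf =>
    exact IsAlgebraic.of_pow (Nat.pos_of_ne_zero hp0) (hc ▸ hf)
  | .convergent v, hf =>
    obtain ⟨s, hs, h⟩ := hf
    obtain ⟨M, hM⟩ := h.tendsto_cofinite_zero.bddAbove_range_of_cofinite
    refine ⟨s / 2, by positivity, Summable.of_nonneg_of_le (fun n => by positivity) (fun n => ?_)
      ((summable_pow_degree (σ := σ) (r := 1 / 2) (by norm_num) (by norm_num)).mul_left (max M 1))⟩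
    rw [div_eq_mul_one_div s, mul_pow, ← mul_assoc]
    refine mul_le_mul_of_nonneg_right ?_ (by positivity)
    refine le_of_pow_le_pow_left₀ hp0 (by positivity) ?_
    calc (v (coeff n c) * s ^ n.degree) ^ p = v (coeff (p • n) f) * s ^ (p • n).degree := by
          rw [mul_pow, ← map_pow, hcn, ← pow_mul, map_nsmul, smul_eq_mul, mul_comm p]
      _ ≤ M := hM ⟨p • n, rfl⟩
      _ ≤ max M 1 := le_max_left _ _
      _ ≤ max M 1 ^ p := le_self_pow₀ (le_max_right _ _) hp0

end PthRoot

end Arquile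

namespace Arquile

/-! ### Noetherianity -/

section Noetherian

open MvPowerSeries

variable {k : Type*} [Field k] {σ τ : Type*}

/-- A weight, with the last variable of weight one, for which the minimum over a given set of
exponents is attained only once. -/
theorem exists_weight {r : ℕ} {A : Set (Fin (r + 1) → ℕ)} (hA : A.Nonempty) :
    ∃ N : Fin (r + 1) → ℕ, N (Fin.last r) = 1 ∧ (∀ i, 0 < N i) ∧ ∃ a ∈ A, ∀ b ∈ A, b ≠ a →
      ∑ i, N i * a i < ∑ i, N i * b i := by
  classical
  induction r with
  | zero =>
    obtain ⟨a, ha, hmin⟩ := WellFounded.has_min (measure fun a : Fin 1 → ℕ => a 0).wf A hA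
    refine ⟨fun _ => 1, rfl, fun _ => one_pos, a, ha, fun b hb hba => ?_⟩
    have h1 : ¬ b 0 < a 0 := hmin b hb
    have h2 : b 0 ≠ a 0 := fun h => hba (by
      ext i; rw [show i = 0 from Subsingleton.elim (α := Fin 1) i 0]; exact h)
    simp only [Fin.sum_univ_succ, Finset.univ_eq_empty, Finset.sum_empty]
    omega
  | succ r ih =>
    obtain ⟨a₀, ha₀, hmin⟩ := WellFounded.has_min (measure fun a : Fin (r + 2) → ℕ => a 0).wf A hA
    obtain ⟨N, hN1, hN0, a, ha, h⟩ := ih (A := {a | Fin.cons (α := fun _ => ℕ) (a₀ 0) a ∈ A})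
      ⟨Fin.tail a₀, by simpa using ha₀⟩
    refine ⟨Fin.cons (α := fun _ => ℕ) (1 + ∑ i, N i * a i) N, ?_, ?_, _, ha, ?_⟩
    · rw [← Fin.succ_last, Fin.cons_succ, hN1]
    · intro i
      refine Fin.cases ?_ (fun i => ?_) i
      · rw [Fin.cons_zero]; omega
      · rw [Fin.cons_succ]; exact hN0 i
    · intro b hb hba
      have h1 : ¬ b 0 < a₀ 0 := hmin b hb
      simp only [Fin.sum_univ_succ (n := r + 1), Fin.cons_zero, Fin.cons_succ]
      rcases eq_or_lt_of_le (not_lt.mp h1) with h2 | h2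
      · have h3 : Fin.cons (α := fun _ => ℕ) (a₀ 0) (Fin.tail b) = b := by
          rw [h2, Fin.cons_self_tail]
        have h4 := h (Fin.tail b) (by rw [Set.mem_ofPred_eq, h3]; exact hb) (by
          rintro rfl; exact hba h3.symm)
        rw [h2]
        exact Nat.add_lt_add_left h4 _
      · obtain ⟨c, hc⟩ := Nat.exists_eq_add_of_lt h2
        rw [hc]
        have : (1 + ∑ i, N i * a i) * (a₀ 0 + c + 1) = (1 + ∑ i, N i * a i) * a₀ 0 +
          (1 + ∑ i, N i * a i) * c + (1 + ∑ i, N i * a i) := by ring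
        rw [this]
        omega

/-- The change of variables `x_j ↦ x_j + ε x_r ^ N_j` fixing `x_r`. -/
noncomputable def shear {r : ℕ} (ε : k) (N : Fin (r + 1) → ℕ) (j : Fin (r + 1)) :
    MvPowerSeries (Fin (r + 1)) k :=
  X j + if j = Fin.last r then 0 else C ε * X (Fin.last r) ^ N j

theorem constantCoeff_shear {r : ℕ} (ε : k) {N : Fin (r + 1) → ℕ} (hN : ∀ i, 0 < N i)
    (j : Fin (r + 1)) : constantCoeff (shear ε N j) = 0 := by
  rw [shear]
  split_ifs
  · simp
  · simp [(hN j).ne']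

theorem subst_shear_subst_shear {r : ℕ} {N : Fin (r + 1) → ℕ} (hN : ∀ i, 0 < N i)
    (f : MvPowerSeries (Fin (r + 1)) k) :
    subst (shear (-1 : k) N) (subst (shear (1 : k) N) f) = f := by
  have h1 := hasSubst_of_constantCoeff_zero (constantCoeff_shear (1 : k) hN)
  have h2 := hasSubst_of_constantCoeff_zero (constantCoeff_shear (-1 : k) hN)
  rw [subst_comp_subst_apply h1 h2]
  have hlast : subst (shear (-1 : k) N) (X (Fin.last r) : MvPowerSeries _ k) = X (Fin.last r) := by
    rw [subst_X h2, shear, if_pos rfl, add_zero]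
  have : (fun j => subst (shear (-1 : k) N) (shear (1 : k) N j)) =
      (X : Fin (r + 1) → MvPowerSeries (Fin (r + 1)) k) := by
    ext1 j
    by_cases hj : j = Fin.last r
    · rw [hj, shear, if_pos rfl, add_zero, hlast]
    · rw [shear, if_neg hj, map_one, one_mul, subst_add h2, subst_pow h2, hlast, subst_X h2, shear,
        if_neg hj, map_neg, map_one]
      ring
  rw [this]
  exact congrFun subst_self f

/-- After a suitable change of variables every nonzero series is regular in the last variable. -/
theorem exists_isRegularIn {r : ℕ} {f : MvPowerSeries (Fin (r + 1)) k} (hf : f ≠ 0) :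
    ∃ N : Fin (r + 1) → ℕ, (∀ i, 0 < N i) ∧ ∃ d, IsRegularIn (Fin.last r) d
      (subst (shear (1 : k) N) f) := by
  classical
  obtain ⟨m, hm⟩ : ∃ m, coeff m f ≠ 0 := by
    by_contra! h
    exact hf (MvPowerSeries.ext h)
  obtain ⟨N, hN1, hN0, a, ⟨n, hn, rfl⟩, h⟩ := exists_weight
    (A := {a | ∃ n : Fin (r + 1) →₀ ℕ, coeff n f ≠ 0 ∧ ⇑n = a}) ⟨_, m, hm, rfl⟩
  have hs := hasSubst_of_constantCoeff_zero (constantCoeff_shear (1 : k) hN0)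
  set i := Fin.last r with hi
  have hterm : ∀ (b : Fin (r + 1) →₀ ℕ) (j : ℕ), coeff (Finsupp.single i j)
      (b.prod fun s e => shear (1 : k) N s ^ e) = if ∑ s, N s * b s = j then 1 else 0 := by
    intro b j
    rw [← coeff_setZero_of_forall (S := {v | v ≠ i}), Finsupp.prod_fintype _ _ (by simp), map_prod]
    · have h1 : ∀ s, setZero {v | v ≠ i} (shear (1 : k) N s ^ b s) = X i ^ (N s * b s) := by
        intro s
        have hXi : setZero {v | v ≠ i} (X i : MvPowerSeries (Fin (r + 1)) k) = X i :=
          setZero_X_of_notMem (by simp)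
        rw [map_pow, pow_mul, shear]
        congr 1
        by_cases hsi : s = i
        · rw [if_pos hsi, add_zero, hsi, hXi, hN1, pow_one]
        · rw [if_neg hsi, map_add, setZero_X_of_mem (by simpa using hsi), map_one, one_mul, map_pow,
            hXi, zero_add]
      rw [Finset.prod_congr rfl fun s _ => h1 s, Finset.prod_pow_eq_pow_sum, coeff_X_pow]
      simp only [(Finsupp.single_injective i).eq_iff, eq_comm]
    · intro v hv
      exact Finsupp.single_eq_of_ne hv
  refine ⟨N, hN0, ∑ s, N s * n s, fun j hj => ?_, ?_⟩
  · rw [coeff_subst hs, finsum_eq_zero_of_forall_eq_zero]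
    intro b
    rw [hterm]
    by_cases hb : coeff b f = 0
    · rw [hb, zero_smul]
    · rw [if_neg, smul_zero]
      rintro rfl
      by_cases hbn : b = n
      · rw [hbn] at hj; omega
      · have := h b ⟨b, hb, rfl⟩ (fun h => hbn (DFunLike.coe_injective h))
        omega
  · rw [coeff_subst hs, finsum_eq_single _ n, hterm, if_pos rfl]
    · simpa using hn
    · intro b hbn
      rw [hterm]
      by_cases hb : coeff b f = 0
      · rw [hb, zero_smul]
      · rw [if_neg, smul_zero]
        exact (h b ⟨b, hb, rfl⟩ (fun h => hbn (DFunLike.coe_injective h))).ne'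

variable {Q : Quality k}

/-- Renaming of variables, on the series of a given kind. -/
noncomputable def renameSeries (Q : Quality k) (e : σ ↪ τ) : Q.series σ →+* Q.series τ :=
  ((rename (R := k) e).comp (Q.series σ).val).toRingHom.codRestrict (Q.series τ)
    fun f => series_rename e f.2

/-- Substitution, on the series of a given kind. -/
noncomputable def substSeries [Finite σ] [Finite τ] (a : σ → MvPowerSeries τ k)
    (ha : ∀ i, a i ∈ Q.series τ) (h0 : ∀ i, constantCoeff (a i) = 0) :
    Q.series σ →+* Q.series τ :=
  ((substAlgHom (R := k) (hasSubst_of_constantCoeff_zero h0)).comp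
    (Q.series σ).val).toRingHom.codRestrict (Q.series τ) fun f => by
      change substAlgHom (hasSubst_of_constantCoeff_zero h0) f.1 ∈ _
      rw [substAlgHom_apply]
      exact series_subst ha h0 f.2

/-- An ideal is finitely generated if it contains an element division by which leaves
remainders that are polynomials of bounded degree over a Noetherian ring. -/
theorem fg_of_forall_exists_div {R₀ R : Type*} [CommRing R₀] [CommRing R] [IsNoetherianRing R₀]
    (ι : R₀ →+* R) {J : Ideal R} {f : R} (hf : f ∈ J) (x : R) (d : ℕ)
    (h : ∀ g, ∃ (q : R) (c : ℕ → R₀), g = q * f + ∑ j ∈ Finset.range d, ι (c j) * x ^ j) :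
    J.FG := by
  classical
  let : Algebra R₀ R := ι.toAlgebra
  have hfin : Module.Finite R₀ (R ⧸ Ideal.span {f}) := by
    refine ⟨(Finset.range d).image fun j => Ideal.Quotient.mk _ (x ^ j), eq_top_iff.mpr ?_⟩
    rintro g -
    obtain ⟨g, rfl⟩ := Ideal.Quotient.mk_surjective g
    obtain ⟨q, c, hg⟩ := h g
    rw [hg, map_add, map_mul, Ideal.Quotient.eq_zero_iff_mem.mpr (Ideal.mem_span_singleton_self f),
      mul_zero, zero_add, map_sum]
    refine Submodule.sum_mem _ fun j hj => ?_
    rw [map_mul]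
    exact Submodule.smul_mem _ (c j) (Submodule.subset_span
      (Finset.mem_coe.mpr (Finset.mem_image_of_mem _ hj)))
  have hN : IsNoetherian R₀ (R ⧸ Ideal.span {f}) := isNoetherian_of_isNoetherianRing_of_finite _ _
  have hN' : IsNoetherian R (R ⧸ Ideal.span {f}) := isNoetherian_of_tower R₀ hN
  refine Submodule.fg_of_fg_map_of_fg_inf_ker (Submodule.mkQ (Ideal.span {f}))
    (IsNoetherian.noetherian _) ?_
  rw [Submodule.ker_mkQ, inf_eq_right.mpr ((Ideal.span_singleton_le_iff_mem J).mpr hf)]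
  exact ⟨{f}, by simp⟩

theorem fg_of_isRegularIn {r d : ℕ} [IsNoetherianRing (Q.series (Fin r))]
    {J : Ideal (Q.series (Fin (r + 1)))} {f : Q.series (Fin (r + 1))} (hfJ : f ∈ J)
    (hf : IsRegularIn (Fin.last r) d (f : MvPowerSeries (Fin (r + 1)) k)) : J.FG := by
  let e : Fin r ↪ Fin (r + 1) := Fin.castSuccEmb
  refine fg_of_forall_exists_div (renameSeries Q e) hfJ ⟨X (Fin.last r), series_X Q _⟩ d fun g => ?_
  obtain ⟨q, hq, s, hs, h, hdeg⟩ := exists_weierstrass hf f.2 g.2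
  obtain ⟨c, hc, hsum⟩ := exists_sum_of_degreeInLT_series hs hdeg
  have hren : ∀ j, rename e (killCompl e (c j)) = c j := fun j => by
    refine rename_killCompl (S := {Fin.last r}) _ (fun v hv => ?_) (hc j).2
    exact ⟨v.castPred hv, Fin.castSucc_castPred v hv⟩
  refine ⟨⟨q, hq⟩, fun j => ⟨_, series_killCompl e (hc j).1⟩, Subtype.ext ?_⟩
  rw [h, hsum]
  simp only [AddMemClass.coe_add, MulMemClass.coe_mul, AddSubmonoidClass.coe_finsetSum,
    SubmonoidClass.coe_pow]
  congr 1
  refine Finset.sum_congr rfl fun j _ => ?_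
  congr 1
  exact (hren j).symm

theorem isNoetherianRing_series_fin (r : ℕ) : IsNoetherianRing (Q.series (Fin r)) := by
  classical
  induction r with
  | zero =>
    refine isNoetherianRing_of_surjective k _ (algebraMap k (Q.series (Fin 0))) fun f => ?_
    refine ⟨constantCoeff f.1, Subtype.ext ?_⟩
    exact (freeOf_univ_iff.mp fun n _ i => i.elim0).symm
  | succ r ih =>
    refine ⟨fun I => ?_⟩
    by_cases hI : I = ⊥
    · rw [hI]; exact Submodule.fg_bot
    obtain ⟨f, hfI, hf0⟩ := Submodule.exists_mem_ne_zero_of_ne_bot hI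
    obtain ⟨N, hN, d, hd⟩ := exists_isRegularIn (f := f.1) (fun h => hf0 (Subtype.ext h))
    have hQ : ∀ (ε : k) j, shear ε N j ∈ Q.series (Fin (r + 1)) := fun ε j => by
      rw [shear]
      refine add_mem (series_X _ _) ?_
      split_ifs
      · exact zero_mem _
      · exact mul_mem (series_C _ _) (pow_mem (series_X _ _) _)
    let α := substSeries (Q := Q) (shear 1 N) (hQ 1) (constantCoeff_shear 1 hN)
    let β := substSeries (Q := Q) (shear (-1) N) (hQ (-1)) (constantCoeff_shear (-1) hN)
    have hα : ∀ g, (α g).1 = subst (shear (1 : k) N) g.1 := fun g =>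
      substAlgHom_apply (hasSubst_of_constantCoeff_zero (constantCoeff_shear _ hN)) _
    have hβ : ∀ g, (β g).1 = subst (shear (-1 : k) N) g.1 := fun g =>
      substAlgHom_apply (hasSubst_of_constantCoeff_zero (constantCoeff_shear _ hN)) _
    have hβα : ∀ g, β (α g) = g := fun g => Subtype.ext (by
      rw [hβ, hα, subst_shear_subst_shear hN])
    have hJ : (Ideal.comap β I).FG := fg_of_isRegularIn (f := α f) (d := d)
      (by rw [Ideal.mem_comap, hβα]; exact hfI) (by rw [hα]; exact hd)
    rw [← Ideal.map_comap_of_surjective β (fun g => ⟨α g, hβα g⟩) I]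
    exact hJ.map β

instance isNoetherianRing_series [Finite σ] : IsNoetherianRing (Q.series σ) := by
  obtain ⟨r, ⟨e⟩⟩ := Finite.exists_equiv_fin σ
  have := isNoetherianRing_series_fin (Q := Q) r
  refine isNoetherianRing_of_surjective _ _ (renameSeries Q e.symm.toEmbedding) fun f => ?_
  exact ⟨⟨_, series_killCompl e.symm.toEmbedding f.2⟩, Subtype.ext
    (rename_killCompl (S := ∅) _ (fun i _ => ⟨e i, by simp⟩) fun _ _ _ hi => hi.elim)⟩

end Noetherian

end Arquile

namespace Arquile

/-! ### Evaluation at arcs -/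

section Arcs

open MvPowerSeries

variable {k : Type*} [Field k] {Q : Quality k} {m : ℕ}

instance isDomain_series (σ : Type*) : IsDomain (Q.series σ) :=
  have : IsDomain (MvPowerSeries σ k) := NoZeroDivisors.to_isDomain _
  inferInstance

variable (Q) in
/-- The variables `t` and `y_i` as elements of `B`. -/
noncomputable def var {σ : Type*} (o : σ) : Q.series σ := ⟨X o, series_X Q o⟩

theorem constantCoeff_substPoint (y : Arcs Q m) (o : Option (Fin m)) :
    constantCoeff (substPoint y o) = 0 := by
  cases o with
  | none => exact PowerSeries.constantCoeff_X
  | some i => exact (y i).2.2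

theorem substPoint_mem (y : Arcs Q m) (o : Option (Fin m)) : substPoint y o ∈ Q.series Unit := by
  cases o with
  | none => exact series_X Q ()
  | some i => exact (y i).2.1

theorem evalAt_apply (y : Arcs Q m) (f : BSeries Q m) : evalAt y f = subst (substPoint y) f.1 :=
  substAlgHom_apply (hasSubst_substPoint y) _

theorem evalAt_mem (y : Arcs Q m) (f : BSeries Q m) : evalAt y f ∈ Q.series Unit := by
  rw [evalAt_apply]
  exact series_subst (substPoint_mem y) (constantCoeff_substPoint y) f.2

theorem evalAt_var (y : Arcs Q m) (o : Option (Fin m)) : evalAt y (var Q o) = substPoint y o := by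
  rw [evalAt_apply]
  exact subst_X (hasSubst_substPoint y) o

theorem mem_relationIdeal {y : Arcs Q m} {f : BSeries Q m} :
    f ∈ relationIdeal y ↔ evalAt y f = 0 := RingHom.mem_ker

theorem mem_vanishingIdeal {Y : Set (Arcs Q m)} {f : BSeries Q m} :
    f ∈ vanishingIdeal Y ↔ ∀ y ∈ Y, evalAt y f = 0 := by
  simp only [vanishingIdeal, Submodule.mem_iInf, mem_relationIdeal]

/-- The variable `t` among the variables of `B`. -/
def tEmb (m : ℕ) : Unit ↪ Option (Fin m) := ⟨fun _ => none, fun _ _ _ => rfl⟩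

/-- A series in `t`, considered as an element of `B`. -/
noncomputable def ofT (m : ℕ) : Q.series Unit →+* BSeries Q m := renameSeries Q (tEmb m)

theorem evalAt_ofT (y : Arcs Q m) (g : Q.series Unit) : evalAt y (ofT m g) = g.1 := by
  rw [evalAt_apply]
  change subst (substPoint y) (rename (tEmb m) g.1) = g.1
  rw [subst_rename (tEmb m) (hasSubst_substPoint y)]
  exact congrFun subst_self g.1

/-- The evaluation at `y` of an element of `B`, as an element of `B`. -/
noncomputable def evalT (y : Arcs Q m) (f : BSeries Q m) : BSeries Q m :=
  ofT m ⟨evalAt y f, evalAt_mem y f⟩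

theorem evalAt_evalT (y y' : Arcs Q m) (f : BSeries Q m) :
    evalAt y' (evalT y f) = evalAt y f := evalAt_ofT _ _

/-- The generators `y_i - y_i(t)` of the prime ideal of the point `y`. -/
noncomputable def centered (y : Arcs Q m) (i : Fin m) : BSeries Q m :=
  var Q (some i) - ofT m ⟨y i, (y i).2.1⟩

theorem evalAt_centered (y : Arcs Q m) (i : Fin m) (y' : Arcs Q m) :
    evalAt y' (centered y i) = (y' i : PowerSeries k) - y i := by
  rw [centered, map_sub, evalAt_var, evalAt_ofT]
  rfl

theorem centered_mem (y : Arcs Q m) (i : Fin m) : centered y i ∈ relationIdeal y := by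
  rw [mem_relationIdeal, evalAt_centered, sub_self]

/-- First-order expansion at the point `y`. -/
theorem exists_eq_evalT_add (y : Arcs Q m) (f : BSeries Q m) :
    ∃ c : Fin m → BSeries Q m, f = evalT y f + ∑ i, c i * centered y i := by
  classical
  let e : Fin m ↪ Option (Fin m) := Function.Embedding.some
  let φ : Option (Fin m) → MvPowerSeries (Option (Fin m)) k :=
    fun o => o.elim 0 fun i => rename (tEmb m) (y i : PowerSeries k)
  have hnone : ∀ u : Unit, tEmb m u ∉ ((Finset.univ.map e : Finset _) : Set (Option (Fin m))) := by
    intro u h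
    simp [tEmb, e] at h
  have hmem : ∀ o ∈ Finset.univ.map e, ∃ i, o = some i := fun o ho => by
    obtain ⟨i, -, rfl⟩ := Finset.mem_map.mp ho
    exact ⟨i, rfl⟩
  obtain ⟨r, hr, hfree, c, hc, h⟩ := exists_elim (Q := Q) (Finset.univ.map e) (φ := φ)
    (by intro o ho; obtain ⟨i, rfl⟩ := hmem o ho; exact series_rename (tEmb m) (y i).2.1)
    (by intro o ho; obtain ⟨i, rfl⟩ := hmem o ho; exact freeOf_rename (tEmb m) hnone _)
    (by
      intro o ho
      obtain ⟨i, rfl⟩ := hmem o ho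
      exact (constantCoeff_rename (tEmb m) _).trans (y i).2.2) f.2
  have hr0 : rename (tEmb m) (killCompl (tEmb m) r) = r := by
    refine rename_killCompl _ (fun o ho => ?_) hfree
    cases o with
    | none => exact ⟨(), rfl⟩
    | some i => exact absurd (Finset.mem_coe.mpr (Finset.mem_map_of_mem e (Finset.mem_univ i))) ho
  let r' : Q.series Unit := ⟨_, series_killCompl (tEmb m) hr⟩
  have hf : f = ofT m r' + ∑ i, (⟨c (some i), hc _⟩ : BSeries Q m) * centered y i := by
    apply Subtype.ext
    rw [h, Finset.sum_map]
    simp only [AddMemClass.coe_add, MulMemClass.coe_mul, AddSubmonoidClass.coe_finsetSum]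
    congr 1
    exact hr0.symm
  have hev : evalAt y f = r'.1 := by
    rw [hf, map_add, evalAt_ofT, map_sum, Finset.sum_eq_zero, add_zero]
    intro i _
    rw [map_mul, evalAt_centered, sub_self, mul_zero]
  refine ⟨fun i => ⟨c (some i), hc _⟩, ?_⟩
  rw [evalT, show (⟨evalAt y f, evalAt_mem y f⟩ : Q.series Unit) = r' from Subtype.ext hev]
  exact hf

theorem exists_eq_sum_centered {y : Arcs Q m} {f : BSeries Q m} (hf : f ∈ relationIdeal y) :
    ∃ c : Fin m → BSeries Q m, f = ∑ i, c i * centered y i := by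
  obtain ⟨c, hc⟩ := exists_eq_evalT_add y f
  refine ⟨c, ?_⟩
  have : (⟨evalAt y f, evalAt_mem y f⟩ : Q.series Unit) = 0 :=
    Subtype.ext (mem_relationIdeal.mp hf)
  rwa [evalT, this, map_zero, zero_add] at hc

variable (Q) in
/-- The partial derivatives on the series of a given kind. -/
noncomputable def partialD {σ : Type*} [Finite σ] (o : σ) :
    Derivation k (Q.series σ) (Q.series σ) where
  toFun f := ⟨pderiv k o f.1, series_pderiv o f.2⟩
  map_add' _ _ := Subtype.ext (map_add _ _ _)
  map_smul' _ _ := Subtype.ext (Derivation.map_smul _ _ _)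
  map_one_eq_zero' := Subtype.ext (Derivation.map_one_eq_zero _)
  leibniz' _ _ := Subtype.ext (Derivation.leibniz _ _ _)

theorem partialD_var {σ : Type*} [Finite σ] [DecidableEq σ] (o o' : σ) :
    partialD Q o (var Q o') = if o' = o then 1 else 0 := by
  apply Subtype.ext
  change pderiv k o (X o') = _
  split_ifs with h
  · rw [h, pderiv_X_self]; rfl
  · rw [pderiv_X_of_ne h]; rfl

theorem partialD_ofT (i : Fin m) (g : Q.series Unit) : partialD Q (some i) (ofT m g) = 0 := by
  apply Subtype.ext
  ext n
  change coeff n (pderiv k (some i) (rename (tEmb m) g.1)) = 0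
  rw [coeff_pderiv]
  by_contra h
  have := freeOf_rename (S := {some i}) (tEmb m) (by simp [tEmb]) g.1 _ (left_ne_zero_of_mul h)
    (some i) rfl
  simp at this

theorem partialD_centered (y : Arcs Q m) (i b : Fin m) :
    partialD Q (some b) (centered y i) = if i = b then 1 else 0 := by
  rw [centered, map_sub, partialD_ofT, sub_zero, partialD_var]
  simp

/-- A derivation vanishing on the variables is zero. -/
theorem derivation_eq_zero {σ : Type*} [Finite σ] {D : Derivation k (Q.series σ) (Q.series σ)}
    (h : ∀ o, D (var Q o) = 0) : D = 0 := by
  ext1 f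
  apply Subtype.ext
  refine eq_zero_of_twisted_derivation (fun f => f.1) (fun i => constantCoeff_X i)
    ((Q.series σ).val.toAddMonoidHom.comp D.toLinearMap.toAddMonoidHom) (fun f g => ?_)
    (fun c => ?_) (fun o => ?_) f
  · change (D (f * g)).1 = f.1 * (D g).1 + g.1 * (D f).1
    rw [D.leibniz]
    rfl
  · change (D (algebraMap k (Q.series σ) c)).1 = 0
    rw [D.map_algebraMap]
    rfl
  · exact congrArg Subtype.val (h o)

/-- The derivative of `f(t, y(t))` with respect to `t`. -/
theorem pderiv_evalAt (y : Arcs Q m) (f : BSeries Q m) :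
    pderiv k () (evalAt y f : MvPowerSeries Unit k) =
      ∑ o, evalAt y (partialD Q o f) * pderiv k () (substPoint y o) := by
  rw [evalAt_apply, pderiv_subst (constantCoeff_substPoint y)]
  exact Finset.sum_congr rfl fun o _ => by rw [evalAt_apply]; rfl

/-- Evaluation of a substitution. -/
theorem evalAt_substSeries {y y' : Arcs Q m}
    {a : Option (Fin m) → MvPowerSeries (Option (Fin m)) k}
    (ha : ∀ i, a i ∈ Q.series (Option (Fin m))) (h0 : ∀ i, constantCoeff (a i) = 0)
    (h : ∀ o, evalAt y ⟨a o, ha o⟩ = substPoint y' o) (f : BSeries Q m) :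
    evalAt y (substSeries a ha h0 f) = evalAt y' f := by
  rw [evalAt_apply, evalAt_apply]
  have h1 : (substSeries a ha h0 f).1 = subst a f.1 :=
    substAlgHom_apply (hasSubst_of_constantCoeff_zero h0) _
  rw [h1, subst_comp_subst_apply (hasSubst_of_constantCoeff_zero h0) (hasSubst_substPoint y)]
  congr 1
  ext1 o
  rw [← h o, evalAt_apply]

/-- The coefficients of `f(t, y(t))` are polynomials in the coefficients of `y`. -/
theorem exists_coeff_evalAt_eq (n : ℕ) (f : BSeries Q m) :
    ∃ F : MvPolynomial (Fin m × ℕ) k, ∀ y : Arcs Q m,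
      PowerSeries.coeff n (evalAt y f) = MvPolynomial.eval (coeffs y) F := by
  induction n using Nat.strong_induction_on generalizing f with
  | _ n ih =>
    obtain ⟨c, hc, h⟩ := exists_eq_C_add_sum f.2
    have hf : f = algebraMap k _ (constantCoeff f.1) +
        ∑ o, (⟨c o, hc o⟩ : BSeries Q m) * var Q o := by
      apply Subtype.ext
      rw [AddMemClass.coe_add, AddSubmonoidClass.coe_finsetSum]
      exact h
    let P : Option (Fin m) → ℕ → MvPolynomial (Fin m × ℕ) k := fun o j =>
      o.elim (MvPolynomial.C (PowerSeries.coeff j PowerSeries.X)) fun i => MvPolynomial.X (i, j)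
    have hP : ∀ (y : Arcs Q m) o j, MvPolynomial.eval (coeffs y) (P o j) =
        PowerSeries.coeff j (substPoint y o) := by
      intro y o j
      cases o with
      | none => exact MvPolynomial.eval_C _
      | some i => exact MvPolynomial.eval_X _
    choose F hF using ih
    refine ⟨MvPolynomial.C (PowerSeries.coeff n (PowerSeries.C (constantCoeff f.1))) +
      ∑ o, ∑ p ∈ Finset.HasAntidiagonal.antidiagonal n,
        if hp : p.1 < n then F p.1 hp ⟨c o, hc o⟩ * P o p.2 else 0, fun y => ?_⟩
    conv_lhs => rw [hf]
    rw [map_add, map_add, map_add, map_sum, map_sum, map_sum, MvPolynomial.eval_C, AlgHom.commutes]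
    congr 1
    refine Finset.sum_congr rfl fun o _ => ?_
    rw [map_mul, evalAt_var, map_sum, PowerSeries.coeff_mul]
    refine Finset.sum_congr rfl fun p hp => ?_
    split_ifs with hpn
    · rw [map_mul, hP, hF p.1 hpn]
    · have hp2 : p.2 = 0 := by
        have := Finset.HasAntidiagonal.mem_antidiagonal.mp hp
        omega
      rw [hp2, map_zero, PowerSeries.coeff_zero_eq_constantCoeff]
      exact mul_eq_zero_of_right _ (constantCoeff_substPoint y o)

end Arcs

/-! ### Maps of arcs -/

section ArcMaps

variable {k : Type*} [Field k] {Q : Quality k} {m : ℕ}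

variable (Q m) in
/-- The constant term of an element of `B`. -/
noncomputable def constTerm : BSeries Q m →+* k :=
  MvPowerSeries.constantCoeff.comp (Q.series (Option (Fin m))).val.toRingHom

theorem constTerm_var (o : Option (Fin m)) : constTerm Q m (var Q o) = 0 :=
  MvPowerSeries.constantCoeff_X o

theorem constantCoeff_evalAt (v : Arcs Q m) {f : BSeries Q m} (hf : constTerm Q m f = 0) :
    PowerSeries.constantCoeff (evalAt v f) = 0 := by
  rw [evalAt_apply]
  exact MvPowerSeries.constantCoeff_subst_eq_zero (hasSubst_substPoint v)
    (constantCoeff_substPoint v) hf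

/-- A system `ψ` of series without constant term defines a map of arcs. -/
noncomputable def arcMap (ψ : Fin m → BSeries Q m) (hψ : ∀ i, constTerm Q m (ψ i) = 0)
    (v : Arcs Q m) : Arcs Q m :=
  fun i => ⟨evalAt v (ψ i), evalAt_mem v (ψ i), constantCoeff_evalAt v (hψ i)⟩

theorem constantCoeff_elim {ψ : Fin m → BSeries Q m} (hψ : ∀ i, constTerm Q m (ψ i) = 0) :
    ∀ o : Option (Fin m),
      MvPowerSeries.constantCoeff (o.elim (var Q none) ψ : BSeries Q m).1 = 0 := by
  rintro (- | i)
  · exact constTerm_var (Q := Q) none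
  · exact hψ i

/-- The substitution `y_i ↦ ψ_i`. -/
noncomputable def arcHom (ψ : Fin m → BSeries Q m) (hψ : ∀ i, constTerm Q m (ψ i) = 0) :
    BSeries Q m →+* BSeries Q m :=
  substSeries (fun o : Option (Fin m) => (o.elim (var Q none) ψ : BSeries Q m).1)
    (fun o => (o.elim (var Q none) ψ : BSeries Q m).2) (constantCoeff_elim hψ)

section ArcHom

variable {ψ : Fin m → BSeries Q m} {hψ : ∀ i, constTerm Q m (ψ i) = 0}

theorem arcMap_apply (v : Arcs Q m) (i : Fin m) :
    (arcMap ψ hψ v i : PowerSeries k) = evalAt v (ψ i) := rfl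

theorem evalAt_arcHom (v : Arcs Q m) (f : BSeries Q m) :
    evalAt v (arcHom ψ hψ f) = evalAt (arcMap ψ hψ v) f := by
  refine evalAt_substSeries _ _ (fun o => ?_) f
  rcases o with - | i
  · exact evalAt_var v none
  · rfl

theorem arcHom_apply (f : BSeries Q m) : (arcHom ψ hψ f).1 =
    MvPowerSeries.subst (fun o : Option (Fin m) => (o.elim (var Q none) ψ : BSeries Q m).1) f.1 :=
  MvPowerSeries.substAlgHom_apply
    (MvPowerSeries.hasSubst_of_constantCoeff_zero (constantCoeff_elim hψ)) _

theorem arcHom_var_some (i : Fin m) : arcHom ψ hψ (var Q (some i)) = ψ i := by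
  apply Subtype.ext
  rw [arcHom_apply]
  exact MvPowerSeries.subst_X
    (MvPowerSeries.hasSubst_of_constantCoeff_zero (constantCoeff_elim hψ)) (some i)

theorem arcHom_ofT (g : Q.series Unit) : arcHom ψ hψ (ofT m g) = ofT m g := by
  apply Subtype.ext
  rw [arcHom_apply]
  change MvPowerSeries.subst _ (MvPowerSeries.rename (tEmb m) g.1) =
    MvPowerSeries.rename (tEmb m) g.1
  rw [subst_rename (tEmb m)
    (MvPowerSeries.hasSubst_of_constantCoeff_zero (constantCoeff_elim hψ)),
    MvPowerSeries.rename_eq_subst]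
  rfl

/-- Composition of substitutions. -/
theorem arcHom_arcHom {χ : Fin m → BSeries Q m} (hχ : ∀ i, constTerm Q m (χ i) = 0)
    (f : BSeries Q m) (h : ∀ i, arcHom ψ hψ (χ i) = ψ i) :
    arcHom ψ hψ (arcHom χ hχ f) = arcHom ψ hψ f := by
  apply Subtype.ext
  rw [arcHom_apply, arcHom_apply, arcHom_apply, MvPowerSeries.subst_comp_subst_apply
    (MvPowerSeries.hasSubst_of_constantCoeff_zero (constantCoeff_elim hχ))
    (MvPowerSeries.hasSubst_of_constantCoeff_zero (constantCoeff_elim hψ))]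
  congr 1
  ext1 o
  rw [← arcHom_apply (hψ := hψ)]
  rcases o with - | i
  · rw [arcHom_apply]
    exact MvPowerSeries.subst_X
      (MvPowerSeries.hasSubst_of_constantCoeff_zero (constantCoeff_elim hψ)) none
  · exact congrArg Subtype.val (h i)

theorem constTerm_arcHom (f : BSeries Q m) : constTerm Q m (arcHom ψ hψ f) = constTerm Q m f := by
  have h0 : ∀ f : BSeries Q m, constTerm Q m f = 0 → constTerm Q m (arcHom ψ hψ f) = 0 := by
    intro f hf
    change MvPowerSeries.constantCoeff (arcHom ψ hψ f).1 = 0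
    rw [arcHom_apply]
    exact MvPowerSeries.constantCoeff_subst_eq_zero
      (MvPowerSeries.hasSubst_of_constantCoeff_zero (constantCoeff_elim hψ)) (constantCoeff_elim hψ)
      hf
  have hC : ∀ c : k, constTerm Q m (algebraMap k _ c) = c := fun c => by
    change MvPowerSeries.constantCoeff (algebraMap k (MvPowerSeries (Option (Fin m)) k) c) = c
    rw [MvPowerSeries.algebraMap_apply, MvPowerSeries.constantCoeff_C]
    rfl
  have hCsubst : ∀ c : k, arcHom ψ hψ (algebraMap k _ c) = algebraMap k _ c := by
    intro c
    apply Subtype.ext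
    rw [arcHom_apply]
    change MvPowerSeries.subst _ (algebraMap k (MvPowerSeries (Option (Fin m)) k) c) =
      algebraMap k (MvPowerSeries (Option (Fin m)) k) c
    rw [← MvPowerSeries.substAlgHom_apply
      (MvPowerSeries.hasSubst_of_constantCoeff_zero (constantCoeff_elim hψ)), AlgHom.commutes]
  have h1 := h0 (f - algebraMap k _ (constTerm Q m f)) (by rw [map_sub, hC, sub_self])
  rw [map_sub, map_sub, hCsubst, hC, sub_eq_zero] at h1
  exact h1

theorem constTerm_partialD_arcHom (i : Fin m) (f : BSeries Q m) :
    constTerm Q m (partialD Q (some i) (arcHom ψ hψ f)) =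
      ∑ j, constTerm Q m (partialD Q (some j) f) *
        constTerm Q m (partialD Q (some i) (ψ j)) := by
  have h : partialD Q (some i) (arcHom ψ hψ f) = ∑ o : Option (Fin m),
      arcHom ψ hψ (partialD Q o f) * partialD Q (some i) (o.elim (var Q none) ψ) := by
    apply Subtype.ext
    have h1 : (partialD Q (some i) (arcHom ψ hψ f)).1 =
        MvPowerSeries.pderiv k (some i) (arcHom ψ hψ f).1 := rfl
    rw [h1, arcHom_apply, pderiv_subst (constantCoeff_elim hψ), AddSubmonoidClass.coe_finsetSum]
    refine Finset.sum_congr rfl fun o _ => ?_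
    have h2 : (arcHom ψ hψ (partialD Q o f)).1 = MvPowerSeries.subst
      (fun o : Option (Fin m) => (o.elim (var Q none) ψ : BSeries Q m).1)
        (MvPowerSeries.pderiv k o f.1) := arcHom_apply _
    rw [← h2]
    rfl
  rw [h, Fintype.sum_option, map_add, map_sum]
  have h3 : partialD Q (some i) (var Q none : BSeries Q m) = 0 := by
    rw [partialD_var, if_neg (by simp)]
  change constTerm Q m (_ * partialD Q (some i) (var Q none)) + _ = _
  rw [h3, mul_zero, map_zero, zero_add]
  refine Finset.sum_congr rfl fun j _ => ?_
  rw [map_mul, constTerm_arcHom]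
  rfl

end ArcHom

theorem constTerm_ofT_centered (y : Arcs Q m) (i : Fin m) :
    constTerm Q m (ofT m ⟨y i, (y i).2.1⟩) = 0 :=
  (MvPowerSeries.constantCoeff_rename _ _).trans (y i).2.2

end ArcMaps

end Arquile

namespace Arquile

/-! ### Regular local rings -/

section RegularLocal

open IsLocalRing

variable {R : Type*} [CommRing R]

theorem span_image_le_maximalIdeal [IsLocalRing R] {ι : Type*} {u : ι → R}
    (hu : Ideal.span (Set.range u) = maximalIdeal R) (S : Set ι) :
    Ideal.span (u '' S) ≤ maximalIdeal R :=
  hu ▸ Ideal.span_mono (Set.image_subset_range u S)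

theorem isLocalRing_quotient [IsLocalRing R] {I : Ideal R} (hI : I ≤ maximalIdeal R) :
    IsLocalRing (R ⧸ I) :=
  have : Nontrivial (R ⧸ I) := Ideal.Quotient.nontrivial_iff.mpr fun h =>
    Ideal.IsPrime.ne_top' (top_le_iff.mp (h ▸ hI))
  IsLocalRing.of_surjective' (Ideal.Quotient.mk I) Ideal.Quotient.mk_surjective

/-- If `u` is a regular system of parameters, then the quotient by a part of it is regular, of the
expected dimension. -/
theorem isRegularLocalRing_quotient_span [IsLocalRing R] [IsNoetherianRing R] {ι : Type*}
    [Fintype ι] {u : ι → R} (hu : Ideal.span (Set.range u) = maximalIdeal R)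
    (hdim : (Fintype.card ι : WithBot ℕ∞) ≤ ringKrullDim R) (S : Finset ι) :
    IsRegularLocalRing (R ⧸ Ideal.span (u '' S)) ∧
      ringKrullDim (R ⧸ Ideal.span (u '' S)) = (Fintype.card ι - S.card : ℕ) := by
  classical
  set I := Ideal.span (u '' (S : Set ι)) with hI
  have hIM : I ≤ maximalIdeal R := span_image_le_maximalIdeal hu S
  have := isLocalRing_quotient hIM
  have hle : (maximalIdeal (R ⧸ I)).spanFinrank ≤ Fintype.card ι - S.card := by
    have h1 : maximalIdeal (R ⧸ I) =
        Ideal.span ((Sᶜ.image fun i => Ideal.Quotient.mk I (u i) : Finset (R ⧸ I)) : Set _) := by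
      rw [← map_maximalIdeal_of_surjective (Ideal.Quotient.mk I) Ideal.Quotient.mk_surjective, ← hu,
        Ideal.map_span]
      apply le_antisymm
      · rw [Ideal.span_le]
        rintro _ ⟨_, ⟨i, rfl⟩, rfl⟩
        by_cases hi : i ∈ S
        · rw [Ideal.Quotient.eq_zero_iff_mem.mpr (Ideal.subset_span
            (Set.mem_image_of_mem u (Finset.mem_coe.mpr hi)))]
          exact zero_mem _
        · exact Ideal.subset_span (Finset.mem_coe.mpr (Finset.mem_image_of_mem _ (by simpa using hi)))
      · refine Ideal.span_mono ?_
        intro x hx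
        obtain ⟨i, -, rfl⟩ := Finset.mem_image.mp (Finset.mem_coe.mp hx)
        exact ⟨u i, ⟨i, rfl⟩, rfl⟩
    rw [h1]
    refine (Submodule.spanFinrank_span_le_ncard_of_finite (Finset.finite_toSet _)).trans ?_
    rw [Set.ncard_coe_finset]
    exact Finset.card_image_le.trans_eq (Finset.card_compl S)
  have hge : ((Fintype.card ι - S.card : ℕ) : WithBot ℕ∞) ≤ ringKrullDim (R ⧸ I) := by
    have h1 := ringKrullDim_le_ringKrullDim_quotient_add_card (R := R) (S.image u) (by
      rw [IsLocalRing.ringJacobson_eq_maximalIdeal, Finset.coe_image]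
      exact Ideal.subset_span.trans hIM)
    rw [Finset.coe_image, ← hI] at h1
    have h2 : (Fintype.card ι : WithBot ℕ∞) ≤ ringKrullDim (R ⧸ I) + (S.card : ℕ) :=
      hdim.trans (h1.trans (by gcongr; exact Finset.card_image_le))
    obtain ⟨d, hd⟩ : ∃ d : ℕ, ringKrullDim (R ⧸ I) = d := by
      have h3 := ringKrullDim_lt_top (R := R ⧸ I)
      have h4 : (0 : WithBot ℕ∞) ≤ ringKrullDim (R ⧸ I) := ringKrullDim_nonneg_of_nontrivial
      generalize ringKrullDim (R ⧸ I) = x at h3 h4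
      induction x with
      | bot => simp at h4
      | coe x =>
        induction x with
        | top => simp at h3
        | coe x => exact ⟨x, rfl⟩
    rw [hd] at h2 ⊢
    have h5 : Fintype.card ι ≤ d + S.card := by exact_mod_cast h2
    exact_mod_cast (show Fintype.card ι - S.card ≤ d by omega)
  have hdim' := ringKrullDim_le_spanFinrank_maximalIdeal (R ⧸ I)
  have hle' : ((maximalIdeal (R ⧸ I)).spanFinrank : WithBot ℕ∞) ≤ (Fintype.card ι - S.card : ℕ) := by
    exact_mod_cast hle
  exact ⟨IsRegularLocalRing.of_spanFinrank_maximalIdeal_le _ (hle'.trans hge),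
    le_antisymm (hdim'.trans hle') hge⟩

/-- An element outside the square of the maximal ideal is part of a minimal system of
generators. -/
theorem exists_span_range_update_eq [IsLocalRing R] {ι : Type*} [Fintype ι] [DecidableEq ι]
    {u : ι → R} (hu : Ideal.span (Set.range u) = maximalIdeal R) {x : R} (hx : x ∈ maximalIdeal R)
    (hx2 : x ∉ maximalIdeal R ^ 2) :
    ∃ j, Ideal.span (Set.range (Function.update u j x)) = maximalIdeal R := by
  obtain ⟨a, ha⟩ := (Ideal.mem_span_range_iff_exists_fun).mp (hu ▸ hx)
  obtain ⟨j, hj⟩ : ∃ j, IsUnit (a j) := by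
    by_contra! h
    refine hx2 (ha ▸ Ideal.sum_mem _ fun i _ => ?_)
    rw [pow_two]
    exact Ideal.mul_mem_mul ((mem_maximalIdeal _).mpr (h i)) (hu ▸ Ideal.subset_span ⟨i, rfl⟩)
  refine ⟨j, le_antisymm ?_ ?_⟩
  · rw [Ideal.span_le]
    rintro _ ⟨i, rfl⟩
    by_cases hij : i = j
    · rw [hij, Function.update_self]; exact hx
    · rw [Function.update_of_ne hij]; exact hu ▸ Ideal.subset_span ⟨i, rfl⟩
  · have hne : ∀ i, i ≠ j → u i ∈ Ideal.span (Set.range (Function.update u j x)) := fun i hi =>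
      Ideal.subset_span ⟨i, Function.update_of_ne hi _ _⟩
    have hxm : x ∈ Ideal.span (Set.range (Function.update u j x)) :=
      Ideal.subset_span ⟨j, Function.update_self _ _ _⟩
    rw [← hu, Ideal.span_le]
    rintro _ ⟨i, rfl⟩
    by_cases hij : i = j
    · rw [hij]
      rw [SetLike.mem_coe, ← Ideal.unit_mul_mem_iff_mem _ hj]
      rw [← Finset.add_sum_erase _ _ (Finset.mem_univ j)] at ha
      rw [eq_sub_of_add_eq ha]
      exact sub_mem hxm (Ideal.sum_mem _ fun l hl =>
        Ideal.mul_mem_left _ _ (hne l (Finset.ne_of_mem_erase hl)))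
    · exact hne i hij

theorem exists_span_range_eq_maximalIdeal [IsLocalRing R] [IsNoetherianRing R] {n : ℕ}
    (hn : (maximalIdeal R).spanFinrank = n) :
    ∃ u : Fin n → R, Ideal.span (Set.range u) = maximalIdeal R := by
  have hfg : (maximalIdeal R).FG := IsNoetherian.noetherian _
  have hcard := Submodule.FG.generators_ncard hfg
  rw [hn] at hcard
  have hfin := Submodule.FG.finite_generators hfg
  have := hfin.fintype
  have hc : Fintype.card (Submodule.generators (maximalIdeal R)) = n := by
    rw [← hcard, Set.ncard_eq_toFinset_card', Set.toFinset_card]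
  let e := (Fintype.equivFinOfCardEq hc).symm
  refine ⟨fun i => (e i : R), ?_⟩
  have : Set.range (fun i => (e i : R)) = Submodule.generators (maximalIdeal R) := by
    rw [show (fun i => (e i : R)) = Subtype.val ∘ e from rfl, Set.range_comp, e.range_eq_univ,
      Set.image_univ, Subtype.range_coe]
  rw [this]
  exact Submodule.span_generators _

/-- A regular local ring is a domain. -/
theorem isDomain_of_isRegularLocalRing (n : ℕ) (R : Type*) [CommRing R] [IsRegularLocalRing R]
    (hn : (maximalIdeal R).spanFinrank = n) : IsDomain R := by
  classical
  induction n generalizing R with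
  | zero =>
    obtain ⟨u, hu⟩ := exists_span_range_eq_maximalIdeal hn
    have hM : maximalIdeal R = ⊥ := by
      rw [← hu, Set.range_eq_empty, Ideal.span_empty]
    exact (IsLocalRing.isField_iff_maximalIdeal_eq.mpr hM).isDomain
  | succ n ih =>
    have hdim : ((n + 1 : ℕ) : WithBot ℕ∞) = ringKrullDim R := by
      rw [← hn]
      exact IsRegularLocalRing.spanFinrank_maximalIdeal
    have hfin : (minimalPrimes R).Finite := Ideal.finite_minimalPrimes_of_isNoetherianRing R ⊥
    obtain ⟨x, hx, hx2, hxp⟩ : ∃ x ∈ maximalIdeal R, x ∉ maximalIdeal R ^ 2 ∧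
        ∀ p ∈ minimalPrimes R, x ∉ p := by
      by_contra! h
      have hsub : (maximalIdeal R : Set R) ⊆
          ⋃ p ∈ insert (maximalIdeal R ^ 2) (minimalPrimes R), (p : Set R) := by
        intro x hx
        by_cases hx2 : x ∈ maximalIdeal R ^ 2
        · exact Set.mem_biUnion (Set.mem_insert _ _) hx2
        · obtain ⟨p, hp, hxp⟩ := h x hx hx2
          exact Set.mem_biUnion (Set.mem_insert_of_mem _ hp) hxp
      obtain ⟨p, hp, hMp⟩ := (Ideal.subset_union_prime_finite (hfin.insert (maximalIdeal R ^ 2))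
        (f := id) (maximalIdeal R ^ 2) (maximalIdeal R ^ 2)
        (fun p hp hp1 _ => (Set.mem_insert_iff.mp hp).resolve_left hp1 |>.1.1)).mp hsub
      rcases Set.mem_insert_iff.mp hp with rfl | hp
      · -- Nakayama: the maximal ideal differs from its square
        have h0 : maximalIdeal R = ⊥ := by
          rw [eq_bot_iff]
          refine Submodule.le_of_le_smul_of_le_jacobson_bot (I := maximalIdeal R)
            (IsNoetherian.noetherian _) (IsLocalRing.maximalIdeal_le_jacobson _) ?_
          rw [bot_sup_eq, smul_eq_mul, ← pow_two]
          exact hMp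
        rw [h0, Submodule.spanFinrank_bot] at hn
        omega
      · have hpp : p.IsPrime := hp.1.1
        have hpM : p = maximalIdeal R := le_antisymm (le_maximalIdeal hpp.ne_top) hMp
        have h0 : (maximalIdeal R).height = 0 := by
          rw [← hpM, Ideal.height_eq_zero_iff]
          exact hp
        rw [← IsLocalRing.maximalIdeal_height_eq_ringKrullDim, h0] at hdim
        exact absurd hdim (by exact_mod_cast Nat.succ_ne_zero n)
    obtain ⟨u, hu⟩ := exists_span_range_eq_maximalIdeal hn
    obtain ⟨j, hj⟩ := exists_span_range_update_eq hu hx hx2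
    obtain ⟨hreg, hdim'⟩ := isRegularLocalRing_quotient_span hj
      (by rw [Fintype.card_fin]; exact hdim.le) {j}
    have himg : Function.update u j x '' (({j} : Finset (Fin (n + 1))) : Set _) = {x} := by simp
    rw [himg] at hreg hdim'
    have hdom : IsDomain (R ⧸ Ideal.span {x}) := ih _ (by
      have h1 := hreg.spanFinrank_maximalIdeal
      rw [hdim'] at h1
      simpa using h1)
    have hprime : (Ideal.span {x}).IsPrime := (Ideal.Quotient.isDomain_iff_prime _).mp hdom
    obtain ⟨q, hq, hqx⟩ := Ideal.exists_minimalPrimes_le (bot_le : ⊥ ≤ Ideal.span {x})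
    have hqp : q.IsPrime := hq.1.1
    have hq0 : q = ⊥ := by
      rw [eq_bot_iff]
      refine Submodule.le_of_le_smul_of_le_jacobson_bot (I := maximalIdeal R)
        (IsNoetherian.noetherian _) (IsLocalRing.maximalIdeal_le_jacobson _) ?_
      intro a ha
      obtain ⟨b, rfl⟩ := Ideal.mem_span_singleton'.mp (hqx ha)
      rw [bot_sup_eq, smul_eq_mul, mul_comm b]
      exact Ideal.mul_mem_mul hx ((hqp.mem_or_mem ha).resolve_right (hxp q hq))
    have : (⊥ : Ideal R).IsPrime := hq0 ▸ hqp
    exact IsDomain.of_bot_isPrime R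

/-- Part of a regular system of parameters generates a prime ideal. -/
theorem isPrime_span_image [IsLocalRing R] [IsNoetherianRing R] {ι : Type*} [Fintype ι] {u : ι → R}
    (hu : Ideal.span (Set.range u) = maximalIdeal R)
    (hdim : (Fintype.card ι : WithBot ℕ∞) ≤ ringKrullDim R) (S : Finset ι) :
    (Ideal.span (u '' S)).IsPrime :=
  have := (isRegularLocalRing_quotient_span hu hdim S).1
  (Ideal.Quotient.isDomain_iff_prime _).mp (isDomain_of_isRegularLocalRing _ _ rfl)

theorem card_le_height_span_image [IsLocalRing R] [IsNoetherianRing R] {ι : Type*} [Fintype ι]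
    {u : ι → R} (hu : Ideal.span (Set.range u) = maximalIdeal R)
    (hdim : (Fintype.card ι : WithBot ℕ∞) ≤ ringKrullDim R) (S : Finset ι) :
    (S.card : ℕ∞) ≤ (Ideal.span (u '' S)).height := by
  classical
  induction S using Finset.induction_on with
  | empty => simp
  | insert i S hi ih =>
    have h1 := isPrime_span_image hu hdim S
    have h2 := isPrime_span_image hu hdim (insert i S)
    have hlt : Ideal.span (u '' S) < Ideal.span (u '' (insert i S : Finset ι)) := by
      refine lt_of_le_of_ne (Ideal.span_mono (Set.image_mono (by simp))) fun h => ?_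
      have h3 := (isRegularLocalRing_quotient_span hu hdim S).2
      rw [h, (isRegularLocalRing_quotient_span hu hdim (insert i S)).2] at h3
      have h4 : Fintype.card ι - (insert i S).card = Fintype.card ι - S.card := by exact_mod_cast h3
      have h5 := (insert i S).card_le_univ
      rw [Finset.card_insert_of_notMem hi] at h4 h5
      omega
    rw [Finset.card_insert_of_notMem hi, Nat.cast_add, Nat.cast_one]
    exact (add_le_add_left ih 1).trans (Ideal.height_add_one_le_of_lt_of_isPrime hlt)

/-- If `R / J` is regular and `J` agrees to first order with the ideal generated by part of a
regular system of parameters contained in `J`, then `J` equals this ideal. -/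
theorem eq_span_image_of_isRegularLocalRing_quotient [IsLocalRing R] [IsNoetherianRing R]
    {ι : Type*} [Fintype ι] {u : ι → R} (hu : Ideal.span (Set.range u) = maximalIdeal R)
    (hdim : (Fintype.card ι : WithBot ℕ∞) ≤ ringKrullDim R) (S : Finset ι) {J : Ideal R}
    (hS : Ideal.span (u '' S) ≤ J) (hJ : J ≤ Ideal.span (u '' S) ⊔ maximalIdeal R ^ 2)
    (hreg : IsRegularLocalRing (R ⧸ J)) : J = Ideal.span (u '' S) := by
  classical
  have hdimJ := hreg.spanFinrank_maximalIdeal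
  set n := (maximalIdeal (R ⧸ J)).spanFinrank with hn
  obtain ⟨v, hv⟩ := exists_span_range_eq_maximalIdeal hn.symm
  choose w hw using fun i => Ideal.Quotient.mk_surjective (I := J) (v i)
  -- generators modulo `J`, together with those in `S`, generate the maximal ideal
  have hM : maximalIdeal R ≤ Ideal.span (Set.range w ∪ u '' S) := by
    refine Submodule.le_of_le_smul_of_le_jacobson_bot (I := maximalIdeal R)
      (IsNoetherian.noetherian _) (IsLocalRing.maximalIdeal_le_jacobson _) ?_
    intro x hx
    have h1 : Ideal.Quotient.mk J x ∈ Ideal.map (Ideal.Quotient.mk J) (Ideal.span (Set.range w)) := by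
      rw [Ideal.map_span, ← Set.range_comp, show Ideal.Quotient.mk J ∘ w = v from funext hw, hv,
        ← map_maximalIdeal_of_surjective (Ideal.Quotient.mk J) Ideal.Quotient.mk_surjective]
      exact Ideal.mem_map_of_mem _ hx
    obtain ⟨z, hz, hzx⟩ := (Ideal.mem_map_iff_of_surjective _ Ideal.Quotient.mk_surjective).mp h1
    have h2 : x - z ∈ J := Ideal.Quotient.eq_zero_iff_mem.mp (by rw [map_sub, hzx, sub_self])
    have h3 := hJ h2
    rw [pow_two, ← smul_eq_mul] at h3
    have h4 : Ideal.span (u '' S) ⊔ maximalIdeal R • maximalIdeal R ≤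
        Ideal.span (Set.range w ∪ u '' S) ⊔ maximalIdeal R • maximalIdeal R :=
      sup_le_sup_right (Ideal.span_mono Set.subset_union_right) _
    have h5 : z ∈ Ideal.span (Set.range w ∪ u '' S) ⊔ maximalIdeal R • maximalIdeal R :=
      Submodule.mem_sup_left (Ideal.span_mono Set.subset_union_left hz)
    have := add_mem (h4 h3) h5
    rwa [sub_add_cancel] at this
  have hcard : Fintype.card ι ≤ n + S.card := by
    have hM' : Ideal.span (Set.range w ∪ u '' S) = maximalIdeal R := by
      refine le_antisymm ?_ hM
      have hJM : J ≤ maximalIdeal R := hJ.trans (sup_le (span_image_le_maximalIdeal hu S)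
        (Ideal.pow_le_self two_ne_zero))
      rw [Ideal.span_union, sup_le_iff, Ideal.span_le]
      refine ⟨?_, span_image_le_maximalIdeal hu S⟩
      rintro _ ⟨i, rfl⟩
      have h1 : v i ∈ Ideal.map (Ideal.Quotient.mk J) (maximalIdeal R) := by
        rw [map_maximalIdeal_of_surjective (Ideal.Quotient.mk J) Ideal.Quotient.mk_surjective, ← hv]
        exact Ideal.subset_span ⟨i, rfl⟩
      rw [← hw i, ← Ideal.mem_comap, Ideal.comap_map_of_surjective _ Ideal.Quotient.mk_surjective,
        ← RingHom.ker_eq_comap_bot, Ideal.mk_ker, sup_eq_left.mpr hJM] at h1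
      exact h1
    have hfin : (Set.range w ∪ u '' (S : Set ι)).Finite :=
      (Set.finite_range w).union (S.finite_toSet.image u)
    have h1 := Submodule.spanFinrank_span_le_ncard_of_finite (R := R) hfin
    change (Ideal.span (Set.range w ∪ u '' (S : Set ι))).spanFinrank ≤ _ at h1
    rw [hM'] at h1
    have h2 : (Set.range w ∪ u '' (S : Set ι)).ncard ≤ n + S.card := by
      refine (Set.ncard_union_le _ _).trans (add_le_add ?_ ?_)
      · rw [← Set.image_univ, ← Finset.coe_univ]
        refine (Set.ncard_image_le (Finset.finite_toSet _)).trans ?_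
        rw [Set.ncard_coe_finset, Finset.card_univ, Fintype.card_fin]
      · exact (Set.ncard_image_le S.finite_toSet).trans_eq (Set.ncard_coe_finset S)
    have h3 := hdim.trans (ringKrullDim_le_spanFinrank_maximalIdeal R)
    have h4 : Fintype.card ι ≤ (maximalIdeal R).spanFinrank := by exact_mod_cast h3
    omega
  by_contra hne
  obtain ⟨r, hrJ, hr⟩ := SetLike.exists_of_lt (lt_of_le_of_ne hS (Ne.symm hne))
  obtain ⟨hregS, hdimS⟩ := isRegularLocalRing_quotient_span hu hdim S
  have hdom : IsDomain (R ⧸ Ideal.span (u '' S)) := isDomain_of_isRegularLocalRing _ _ rfl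
  have hr0 : Ideal.Quotient.mk (Ideal.span (u '' S)) r ≠ 0 := fun h =>
    hr (Ideal.Quotient.eq_zero_iff_mem.mp h)
  have h1 := ringKrullDim_quotient_succ_le_of_nonZeroDivisor (mem_nonZeroDivisors_of_ne_zero hr0)
  have h2 : ringKrullDim (R ⧸ J) ≤ ringKrullDim ((R ⧸ Ideal.span (u '' S)) ⧸
      Ideal.span {Ideal.Quotient.mk (Ideal.span (u '' S)) r}) := by
    refine ringKrullDim_le_of_surjective (Ideal.Quotient.lift _ (Ideal.Quotient.factor hS) ?_) ?_
    · intro z hz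
      obtain ⟨z, rfl⟩ := Ideal.mem_span_singleton'.mp hz
      rw [map_mul, Ideal.Quotient.factor_mk, Ideal.Quotient.eq_zero_iff_mem.mpr hrJ, mul_zero]
    · exact Ideal.Quotient.lift_surjective_of_surjective _ _ (Ideal.Quotient.factor_surjective hS)
  rw [hdimS] at h1
  rw [← hdimJ] at h2
  have h3 : ((n : ℕ) : WithBot ℕ∞) + 1 ≤ (Fintype.card ι - S.card : ℕ) :=
    (add_le_add_left h2 1).trans h1
  have h4 : n + 1 ≤ Fintype.card ι - S.card := by exact_mod_cast h3
  omega

/-- Krull's intersection theorem, relative to an ideal. -/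
theorem le_of_forall_le_sup_pow [IsLocalRing R] [IsNoetherianRing R] {I J : Ideal R}
    (hI : I ≤ maximalIdeal R) (h : ∀ N : ℕ, J ≤ I ⊔ maximalIdeal R ^ N) : J ≤ I := by
  have := isLocalRing_quotient hI
  intro x hx
  rw [← Ideal.Quotient.eq_zero_iff_mem, ← Ideal.mem_bot,
    ← Ideal.iInf_pow_eq_bot_of_isLocalRing (maximalIdeal (R ⧸ I)) Ideal.IsPrime.ne_top',
    Submodule.mem_iInf]
  intro N
  obtain ⟨a, ha, b, hb, rfl⟩ := Submodule.mem_sup.mp (h N hx)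
  rw [map_add, Ideal.Quotient.eq_zero_iff_mem.mpr ha, zero_add,
    ← map_maximalIdeal_of_surjective (Ideal.Quotient.mk I) Ideal.Quotient.mk_surjective,
    ← Ideal.map_pow]
  exact Ideal.mem_map_of_mem _ hb

end RegularLocal

end Arquile

namespace Arquile

/-! ### Adapted systems of functions and their dual derivations -/

section Adapted

variable {k : Type*} [Field k] {Q : Quality k} {m : ℕ}

/-- The full Jacobian matrix of a system `u` of `1 + m` elements of `B`, including the derivatives
with respect to `t`. -/
noncomputable def jac (u : Option (Fin m) → BSeries Q m) :
    Matrix (Option (Fin m)) (Option (Fin m)) (BSeries Q m) :=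
  Matrix.of fun a b => partialD Q b (u a)

/-- A system of `1 + m` elements of `B` is adapted to the ideal `I` and the set of indices `S` if
it arises from the system of all variables by replacing those with index in `S` by elements
of `I`. Then `det (jac u)` is a minor of size `|S|` of the relative Jacobian matrix of these
elements. -/
structure IsAdapted (I : Ideal (BSeries Q m)) (S : Finset (Fin m))
    (u : Option (Fin m) → BSeries Q m) : Prop where
  mem : ∀ c ∈ S, u (some c) ∈ I
  eq_none : u none = var Q none
  eq_some : ∀ c ∉ S, u (some c) = var Q (some c)

/-- The derivation dual to the `a`-th entry of the system `u`, multiplied by the Jacobian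
determinant of `u`. -/
noncomputable def adjD (u : Option (Fin m) → BSeries Q m) (a : Option (Fin m)) :
    Derivation k (BSeries Q m) (BSeries Q m) :=
  ∑ c, (jac u).adjugate c a • partialD Q c

theorem adjD_apply (u : Option (Fin m) → BSeries Q m) (a : Option (Fin m)) (f : BSeries Q m) :
    adjD u a f = ∑ c, (jac u).adjugate c a * partialD Q c f := by
  rw [adjD]
  have : ∀ s : Finset (Option (Fin m)),
      (∑ c ∈ s, (jac u).adjugate c a • partialD Q c) f =
        ∑ c ∈ s, (jac u).adjugate c a * partialD Q c f := by
    intro s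
    classical
    induction s using Finset.induction_on with
    | empty => simp
    | insert c s hc ih => rw [Finset.sum_insert hc, Finset.sum_insert hc, ← ih]; rfl
  exact this _

theorem adjD_eq_det (u : Option (Fin m) → BSeries Q m) (a : Option (Fin m)) (f : BSeries Q m) :
    adjD u a f = (jac (Function.update u a f)).det := by
  have h : jac (Function.update u a f) = (jac u).updateRow a fun b => partialD Q b f := by
    ext1 i j
    rcases eq_or_ne i a with rfl | hi
    · simp [jac]
    · simp [jac, hi]
  rw [h, ← Matrix.cramer_transpose_apply, Matrix.cramer_eq_adjugate_mulVec, adjD_apply,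
    ← Matrix.adjugate_transpose]
  rfl

theorem adjD_apply_self (u : Option (Fin m) → BSeries Q m) (a b : Option (Fin m)) :
    adjD u a (u b) = if b = a then (jac u).det else 0 := by
  have h := congrFun (congrFun (jac u).mul_adjugate b) a
  rw [Matrix.mul_apply, Matrix.smul_apply, Matrix.one_apply, smul_eq_mul, mul_ite, mul_one,
    mul_zero] at h
  rw [← h, adjD_apply]
  exact Finset.sum_congr rfl fun c _ => mul_comm _ _

theorem det_mul_partialD (u : Option (Fin m) → BSeries Q m) (b : Option (Fin m))
    (f : BSeries Q m) :
    (jac u).det * partialD Q b f = ∑ a, partialD Q b (u a) * adjD u a f := by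
  have h : ∀ c, ∑ a, (jac u).adjugate c a * partialD Q b (u a) =
      if c = b then (jac u).det else 0 := by
    intro c
    have h := congrFun (congrFun (jac u).adjugate_mul c) b
    rw [Matrix.mul_apply, Matrix.smul_apply, Matrix.one_apply, smul_eq_mul, mul_ite, mul_one,
      mul_zero] at h
    exact h
  calc (jac u).det * partialD Q b f
      = ∑ c, (if c = b then (jac u).det else 0) * partialD Q c f := by simp
    _ = ∑ c, ∑ a, (jac u).adjugate c a * partialD Q b (u a) * partialD Q c f := by
        simp_rw [← h, Finset.sum_mul]
    _ = ∑ a, ∑ c, (jac u).adjugate c a * partialD Q b (u a) * partialD Q c f :=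
        Finset.sum_comm
    _ = _ := by
        refine Finset.sum_congr rfl fun a _ => ?_
        rw [adjD_apply, Finset.mul_sum]
        exact Finset.sum_congr rfl fun c _ => by ring

theorem derivation_apply_eq_sum (E : Derivation k (BSeries Q m) (BSeries Q m))
    (f : BSeries Q m) : E f = ∑ o, E (var Q o) * partialD Q o f := by
  have hs : ∀ (s : Finset (Option (Fin m))) (f : BSeries Q m),
      (∑ o ∈ s, E (var Q o) • partialD Q o) f = ∑ o ∈ s, E (var Q o) * partialD Q o f := by
    intro s f
    classical
    induction s using Finset.induction_on with
    | empty => simp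
    | insert c s hc ih => rw [Finset.sum_insert hc, Finset.sum_insert hc, ← ih]; rfl
  have h : E - ∑ o, E (var Q o) • partialD Q o = 0 := by
    refine derivation_eq_zero fun o' => ?_
    rw [Derivation.sub_apply, hs]
    simp [partialD_var]
  have h' : E f - (∑ o, E (var Q o) • partialD Q o) f = 0 := by
    rw [← Derivation.sub_apply, h, Derivation.zero_apply]
  rw [sub_eq_zero.mp h', hs]

/-- A derivation is determined by its values on a system with nonzero Jacobian determinant. -/
theorem derivation_eq_zero_of_det_ne_zero {u : Option (Fin m) → BSeries Q m}
    (hu : (jac u).det ≠ 0) {E : Derivation k (BSeries Q m) (BSeries Q m)}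
    (hE : ∀ a, E (u a) = 0) : E = 0 := by
  refine derivation_eq_zero fun o => ?_
  have h : (jac u).mulVec (fun o => E (var Q o)) = 0 := by
    ext1 a
    rw [Pi.zero_apply, ← hE a, derivation_apply_eq_sum E (u a), Matrix.mulVec, dotProduct]
    exact Finset.sum_congr rfl fun o _ => mul_comm _ _
  exact congrFun (Matrix.eq_zero_of_mulVec_eq_zero hu h) o

/-- An adapted system whose Jacobian determinant is not in `K`, with the largest possible number
of elements of `I`. -/
structure IsMaxAdapted (I K : Ideal (BSeries Q m)) (S : Finset (Fin m))
    (u : Option (Fin m) → BSeries Q m) : Prop extends IsAdapted I S u where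
  det : (jac u).det ∉ K
  max : ∀ S' u', IsAdapted I S' u' → (jac u').det ∉ K → S'.card ≤ S.card

theorem det_jac_var : (jac (var Q : Option (Fin m) → BSeries Q m)).det = 1 := by
  have : jac (var Q : Option (Fin m) → BSeries Q m) = 1 := by
    ext1 i j
    rw [Matrix.one_apply, ← partialD_var j i]
    rfl
  rw [this, Matrix.det_one]

theorem exists_isMaxAdapted (I : Ideal (BSeries Q m)) {K : Ideal (BSeries Q m)} (hK : K ≠ ⊤) :
    ∃ S u, IsMaxAdapted I K S u := by
  classical
  let A : Set ℕ := {r | ∃ S u, IsAdapted I S u ∧ (jac u).det ∉ K ∧ S.card = r}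
  have hA : A.Nonempty := ⟨0, ∅, var Q, ⟨by simp, rfl, fun _ _ => rfl⟩,
    by rwa [det_jac_var, ← Ideal.ne_top_iff_one], rfl⟩
  have hb : BddAbove A := by
    refine ⟨m, ?_⟩
    rintro r ⟨S, u, -, -, rfl⟩
    simpa using S.card_le_univ
  obtain ⟨S, u, h, hdet, hr⟩ := Nat.sSup_mem hA hb
  exact ⟨S, u, h, hdet, fun S' u' h' hdet' => hr ▸ le_csSup hb ⟨S', u', h', hdet', rfl⟩⟩

theorem IsMaxAdapted.adjD_mem {I K : Ideal (BSeries Q m)} {S : Finset (Fin m)}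
    {u : Option (Fin m) → BSeries Q m} (h : IsMaxAdapted I K S u) {f : BSeries Q m} (hf : f ∈ I)
    {c : Fin m} (hc : c ∉ S) : adjD u (some c) f ∈ K := by
  classical
  by_contra hK
  rw [adjD_eq_det] at hK
  have h1 : IsAdapted I (insert c S) (Function.update u (some c) f) := by
    refine ⟨fun d hd => ?_, ?_, fun d hd => ?_⟩
    · rcases eq_or_ne d c with rfl | hdc
      · simpa using hf
      · rw [Function.update_of_ne (by simpa using hdc)]
        exact h.mem d ((Finset.mem_insert.mp hd).resolve_left hdc)
    · rw [Function.update_of_ne (by simp), h.eq_none]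
    · rw [Finset.mem_insert, not_or] at hd
      rw [Function.update_of_ne (by simpa using hd.1), h.eq_some d hd.2]
  have := h.max _ _ h1 hK
  rw [Finset.card_insert_of_notMem hc] at this
  omega

theorem evalAt_det_mul_pderiv (u : Option (Fin m) → BSeries Q m) (y : Arcs Q m)
    (f : BSeries Q m) :
    (evalAt y (jac u).det : MvPowerSeries Unit k) * MvPowerSeries.pderiv k () (evalAt y f) =
      ∑ a, evalAt y (adjD u a f) * MvPowerSeries.pderiv k () (evalAt y (u a)) := by
  simp_rw [pderiv_evalAt, Finset.mul_sum]
  rw [Finset.sum_comm]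
  refine Finset.sum_congr rfl fun b _ => ?_
  have h := congrArg (evalAt y) (det_mul_partialD u b f)
  rw [map_mul, map_sum] at h
  have h' : (evalAt y (jac u).det : MvPowerSeries Unit k) * evalAt y (partialD Q b f) =
      ∑ a, evalAt y (partialD Q b (u a)) * evalAt y (adjD u a f) := by
    simp_rw [← map_mul]
    exact (by simpa using h)
  rw [← mul_assoc, h', Finset.sum_mul]
  exact Finset.sum_congr rfl fun a _ => by ring

/-- The derivation in the direction of `t` is tangent to the ideal as well: this is the derivative
with respect to `t` of the equation `f(t, y(t)) = 0`. -/
theorem IsMaxAdapted.adjD_none_mem {I K : Ideal (BSeries Q m)} {S : Finset (Fin m)}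
    {u : Option (Fin m) → BSeries Q m} (h : IsMaxAdapted I K S u) {y : Arcs Q m}
    (hI : I ≤ relationIdeal y) (hK : K ≤ relationIdeal y) {f : BSeries Q m} (hf : f ∈ I) :
    adjD u none f ∈ relationIdeal y := by
  rw [mem_relationIdeal]
  have h1 := evalAt_det_mul_pderiv u y f
  rw [mem_relationIdeal.mp (hI hf), map_zero, mul_zero, Fintype.sum_option,
    Finset.sum_eq_zero, add_zero, h.eq_none, evalAt_var] at h1
  · have hX : MvPowerSeries.pderiv k () (substPoint y none) = 1 :=
      MvPowerSeries.pderiv_X_self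
    rw [hX, mul_one] at h1
    exact h1.symm
  · intro c _
    by_cases hc : c ∈ S
    · rw [mem_relationIdeal.mp (hI (h.mem c hc)), map_zero, mul_zero]
    · rw [mem_relationIdeal.mp (hK (h.adjD_mem hf hc)), zero_mul]

/-- The first-order Taylor formula at a point. -/
theorem sub_sum_partialD_mem (y : Arcs Q m) {f : BSeries Q m} (hf : f ∈ relationIdeal y) :
    f - ∑ b, partialD Q (some b) f * centered y b ∈ relationIdeal y ^ 2 := by
  classical
  obtain ⟨c, rfl⟩ := exists_eq_sum_centered hf
  have hp : ∀ b, partialD Q (some b) (∑ i, c i * centered y i) =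
      ∑ i, centered y i * partialD Q (some b) (c i) + c b := by
    intro b
    simp [map_sum, Derivation.leibniz, partialD_centered, Finset.sum_add_distrib, add_comm]
  simp_rw [hp, add_mul, Finset.sum_add_distrib]
  rw [sub_add_cancel_right, neg_mem_iff]
  refine Ideal.sum_mem _ fun b _ => ?_
  rw [pow_two]
  exact Ideal.mul_mem_mul (Ideal.sum_mem _ fun i _ => Ideal.mul_mem_right _ _ (centered_mem y i))
    (centered_mem y b)

/-- The system `u`, translated so as to vanish at the point `y`. -/
noncomputable def localParam (y : Arcs Q m) (u : Option (Fin m) → BSeries Q m) (c : Fin m) :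
    BSeries Q m :=
  u (some c) - evalT y (u (some c))

theorem localParam_mem (y : Arcs Q m) (u : Option (Fin m) → BSeries Q m) (c : Fin m) :
    localParam y u c ∈ relationIdeal y := by
  rw [mem_relationIdeal, localParam, map_sub, evalAt_evalT, sub_self]

theorem localParam_eq {y : Arcs Q m} {u : Option (Fin m) → BSeries Q m} {c : Fin m}
    (h : u (some c) ∈ relationIdeal y) : localParam y u c = u (some c) := by
  have : (⟨evalAt y (u (some c)), evalAt_mem y _⟩ : Q.series Unit) = 0 :=
    Subtype.ext (mem_relationIdeal.mp h)
  rw [localParam, evalT, this, map_zero, sub_zero]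

theorem localParam_sub_mem (y : Arcs Q m) (u : Option (Fin m) → BSeries Q m) (c : Fin m) :
    localParam y u c - ∑ b, partialD Q (some b) (u (some c)) * centered y b ∈
      relationIdeal y ^ 2 := by
  have h := sub_sum_partialD_mem y (localParam_mem y u c)
  have h1 : ∀ b, partialD Q (some b) (localParam y u c) = partialD Q (some b) (u (some c)) := by
    intro b
    rw [localParam, map_sub, evalT, partialD_ofT, sub_zero]
  simpa only [h1] using h

/-- The first-order Taylor formula with respect to the system `u`. -/
theorem det_mul_sub_sum_adjD_mem (y : Arcs Q m) {u : Option (Fin m) → BSeries Q m}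
    (hu : u none = var Q none) {f : BSeries Q m} (hf : f ∈ relationIdeal y) :
    (jac u).det * f - ∑ a, adjD u (some a) f * localParam y u a ∈ relationIdeal y ^ 2 := by
  have h1 := Ideal.mul_mem_left _ (jac u).det (sub_sum_partialD_mem y hf)
  have h2 : ∀ b, (jac u).det * partialD Q (some b) f =
      ∑ a, partialD Q (some b) (u (some a)) * adjD u (some a) f := by
    intro b
    rw [det_mul_partialD, Fintype.sum_option, hu, partialD_var, if_neg (by simp), zero_mul,
      zero_add]
  have h3 : (jac u).det * (f - ∑ b, partialD Q (some b) f * centered y b) =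
      (jac u).det * f - ∑ a, adjD u (some a) f *
        ∑ b, partialD Q (some b) (u (some a)) * centered y b := by
    rw [mul_sub, Finset.mul_sum]
    congr 1
    simp_rw [← mul_assoc, h2, Finset.sum_mul, Finset.mul_sum]
    rw [Finset.sum_comm]
    exact Finset.sum_congr rfl fun a _ => Finset.sum_congr rfl fun b _ => by ring
  rw [h3] at h1
  have h4 : ∑ a, adjD u (some a) f * (localParam y u a -
      ∑ b, partialD Q (some b) (u (some a)) * centered y b) ∈ relationIdeal y ^ 2 :=
    Ideal.sum_mem _ fun a _ => Ideal.mul_mem_left _ _ (localParam_sub_mem y u a)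
  have := sub_mem h1 h4
  simp_rw [mul_sub, Finset.sum_sub_distrib] at this
  convert this using 1
  ring

end Adapted

end Arquile

namespace Arquile

/-! ### The local ring of a point -/

section LocalRing

open IsLocalRing

variable {k : Type*} [Field k] {Q : Quality k} {m : ℕ}

/-- The values of the substitution `y_i ↦ y_i(t)` for the indices `i` in `T`. -/
noncomputable def freeze (y : Arcs Q m) (T : Finset (Fin m)) (i : Fin m) : BSeries Q m :=
  if i ∈ T then ofT m ⟨y i, (y i).2.1⟩ else var Q (some i)

theorem constTerm_freeze (y : Arcs Q m) (T : Finset (Fin m)) (i : Fin m) :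
    constTerm Q m (freeze y T i) = 0 := by
  rw [freeze]
  split_ifs
  exacts [constTerm_ofT_centered y i, constTerm_var _]

/-- The substitution `freeze`, as a ring homomorphism. Its kernel is a prime ideal, and these
kernels form chains of length `m` below the ideal of the point `y`. -/
noncomputable def freezeHom (y : Arcs Q m) (T : Finset (Fin m)) : BSeries Q m →+* BSeries Q m :=
  arcHom (freeze y T) (constTerm_freeze y T)

theorem freezeHom_freezeHom (y : Arcs Q m) {T T' : Finset (Fin m)} (h : T ⊆ T')
    (f : BSeries Q m) : freezeHom y T' (freezeHom y T f) = freezeHom y T' f := by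
  refine arcHom_arcHom _ f fun i => ?_
  by_cases hi : i ∈ T
  · rw [freeze, if_pos hi, arcHom_ofT, freeze, if_pos (h hi)]
  · rw [freeze, if_neg hi, arcHom_var_some]

theorem freezeHom_centered (y : Arcs Q m) (T : Finset (Fin m)) (i : Fin m) :
    freezeHom y T (centered y i) = freeze y T i - ofT m ⟨y i, (y i).2.1⟩ := by
  rw [centered, map_sub, freezeHom, arcHom_ofT, arcHom_var_some]

theorem card_le_height_ker_freezeHom (y : Arcs Q m) (T : Finset (Fin m)) :
    (T.card : ℕ∞) ≤ (RingHom.ker (freezeHom y T)).height := by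
  classical
  induction T using Finset.induction_on with
  | empty => simp
  | insert i T hi ih =>
    have h1 : (RingHom.ker (freezeHom y T)).IsPrime := RingHom.ker_isPrime _
    have h2 : (RingHom.ker (freezeHom y (insert i T))).IsPrime := RingHom.ker_isPrime _
    have hlt : RingHom.ker (freezeHom y T) < RingHom.ker (freezeHom y (insert i T)) := by
      refine lt_of_le_of_ne (fun f hf => ?_) fun h => ?_
      · rw [RingHom.mem_ker] at hf ⊢
        rw [← freezeHom_freezeHom y (Finset.subset_insert i T), hf, map_zero]
      · have h3 : centered y i ∈ RingHom.ker (freezeHom y (insert i T)) := by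
          rw [RingHom.mem_ker, freezeHom_centered, freeze, if_pos (Finset.mem_insert_self i T),
            sub_self]
        rw [← h, RingHom.mem_ker, freezeHom_centered, freeze, if_neg hi] at h3
        have h5 := congrArg (partialD Q (some i)) h3
        rw [map_sub, partialD_ofT, sub_zero, partialD_var, if_pos rfl, map_zero] at h5
        exact one_ne_zero h5
    rw [Finset.card_insert_of_notMem hi, Nat.cast_add, Nat.cast_one]
    exact (add_le_add_left ih 1).trans (Ideal.height_add_one_le_of_lt_of_isPrime hlt)

theorem le_height_relationIdeal (y : Arcs Q m) : (m : ℕ∞) ≤ (relationIdeal y).height := by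
  have h := card_le_height_ker_freezeHom y Finset.univ
  rw [Finset.card_univ, Fintype.card_fin] at h
  refine h.trans (Ideal.height_mono fun f hf => ?_)
  rw [RingHom.mem_ker] at hf
  rw [mem_relationIdeal]
  have h1 : evalAt y (freezeHom y Finset.univ f) = evalAt y f := by
    rw [freezeHom, evalAt_arcHom]
    congr 2
    ext1 i
    apply Subtype.ext
    rw [arcMap_apply, freeze, if_pos (Finset.mem_univ i), evalAt_ofT]
  rw [← h1, hf, map_zero]

variable (L : Type*) [CommRing L] [Algebra (BSeries Q m) L]

theorem card_le_ringKrullDim (y : Arcs Q m) [IsLocalization.AtPrime L (relationIdeal y)] :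
    (Fintype.card (Fin m) : WithBot ℕ∞) ≤ ringKrullDim L := by
  rw [IsLocalization.AtPrime.ringKrullDim_eq_height (relationIdeal y) L, Fintype.card_fin]
  exact_mod_cast le_height_relationIdeal y

section

variable {y : Arcs Q m} [IsLocalization.AtPrime L (relationIdeal y)]

theorem isUnit_algebraMap {s : BSeries Q m} (hs : s ∉ relationIdeal y) :
    IsUnit (algebraMap _ L s) :=
  IsLocalization.map_units L (⟨s, hs⟩ : (relationIdeal y).primeCompl)

variable [IsLocalRing L]

theorem map_relationIdeal : (relationIdeal y).map (algebraMap _ L) = maximalIdeal L :=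
  IsLocalization.AtPrime.map_eq_maximalIdeal (relationIdeal y) L

theorem algebraMap_mem_pow {f : BSeries Q m} {n : ℕ} (hf : f ∈ relationIdeal y ^ n) :
    algebraMap _ L f ∈ maximalIdeal L ^ n := by
  rw [← map_relationIdeal L (y := y), ← Ideal.map_pow]
  exact Ideal.mem_map_of_mem _ hf

end

/-- The system `u` translated to `y`, in the local ring of the point `y`. -/
noncomputable def germParam (y : Arcs Q m) (u : Option (Fin m) → BSeries Q m) (c : Fin m) : L :=
  algebraMap _ _ (localParam y u c)

theorem IsAdapted.span_germParam_le {I : Ideal (BSeries Q m)} {S : Finset (Fin m)}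
    {u : Option (Fin m) → BSeries Q m} (h : IsAdapted I S u) {y : Arcs Q m}
    (hI : I ≤ relationIdeal y) :
    Ideal.span (germParam L y u '' S) ≤ I.map (algebraMap _ L) := by
  rw [Ideal.span_le]
  rintro _ ⟨c, hc, rfl⟩
  rw [germParam, localParam_eq (hI (h.mem c hc))]
  exact Ideal.mem_map_of_mem _ (h.mem c hc)

section

variable {y : Arcs Q m} [IsLocalization.AtPrime L (relationIdeal y)] [IsLocalRing L]

/-- The first-order Taylor formula with respect to the system `u`, in the local ring of `y`. -/
theorem det_mul_eq_add {u : Option (Fin m) → BSeries Q m}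
    (hu : u none = var Q none) {f : BSeries Q m} (hf : f ∈ relationIdeal y) :
    ∃ x ∈ maximalIdeal L ^ 2, algebraMap _ L ((jac u).det * f) =
      ∑ a, algebraMap _ L (adjD u (some a) f) * germParam L y u a + x := by
  refine ⟨_, algebraMap_mem_pow L (det_mul_sub_sum_adjD_mem y hu hf), ?_⟩
  simp only [germParam, ← map_mul, ← map_sum, ← map_add]
  congr 1
  ring

/-- A system with nonvanishing Jacobian determinant at `y` provides a regular system of parameters
of the local ring of `y`. -/
theorem span_range_germParam [IsNoetherianRing L] {u : Option (Fin m) → BSeries Q m}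
    (hu : u none = var Q none) (hdet : (jac u).det ∉ relationIdeal y) :
    Ideal.span (Set.range (germParam L y u)) = maximalIdeal L := by
  apply le_antisymm
  · rw [Ideal.span_le]
    rintro _ ⟨c, rfl⟩
    rw [← map_relationIdeal L (y := y)]
    exact Ideal.mem_map_of_mem _ (localParam_mem y u c)
  · refine Submodule.le_of_le_smul_of_le_jacobson_bot (R := L) (M := L) (I := maximalIdeal L)
      (IsNoetherian.noetherian _) (maximalIdeal_le_jacobson _) ?_
    rw [smul_eq_mul, ← pow_two]
    nth_rw 1 [← map_relationIdeal L (y := y)]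
    rw [Ideal.map_le_iff_le_comap]
    intro f hf
    rw [Ideal.mem_comap, ← Ideal.unit_mul_mem_iff_mem _ (isUnit_algebraMap L hdet), ← map_mul]
    obtain ⟨x, hx, h⟩ := det_mul_eq_add L hu hf
    rw [h]
    exact Submodule.add_mem_sup (Ideal.sum_mem _ fun a _ =>
      Ideal.mul_mem_left _ _ (Ideal.subset_span ⟨a, rfl⟩)) hx

theorem IsMaxAdapted.map_le_sup {I : Ideal (BSeries Q m)} {S : Finset (Fin m)}
    {u : Option (Fin m) → BSeries Q m} (h : IsMaxAdapted I (relationIdeal y) S u)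
    (hI : I ≤ relationIdeal y) :
    I.map (algebraMap _ L) ≤ Ideal.span (germParam L y u '' S) ⊔ maximalIdeal L ^ 2 := by
  rw [Ideal.map_le_iff_le_comap]
  intro f hf
  rw [Ideal.mem_comap, ← Ideal.unit_mul_mem_iff_mem _ (isUnit_algebraMap L h.det), ← map_mul]
  obtain ⟨x, hx, h1⟩ := det_mul_eq_add L h.eq_none (hI hf)
  rw [h1]
  refine Ideal.add_mem _ (Ideal.sum_mem _ fun a _ => ?_) (Ideal.mem_sup_right hx)
  by_cases ha : a ∈ S
  · exact Ideal.mem_sup_left (Ideal.mul_mem_left _ _ (Ideal.subset_span ⟨a, ha, rfl⟩))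
  · refine Ideal.mem_sup_right ?_
    rw [germParam, ← map_mul]
    refine algebraMap_mem_pow L (y := y) ?_
    rw [pow_two]
    exact Ideal.mul_mem_mul (h.adjD_mem hf ha) (localParam_mem y u a)

end

/-- The Jacobian criterion: if `I` is generated near `y` by the elements of an adapted system with
nonvanishing Jacobian determinant, then the quotient by `I` is regular at `y`. -/
theorem IsAdapted.isRegularQuotientAt {I : Ideal (BSeries Q m)} {S : Finset (Fin m)}
    {u : Option (Fin m) → BSeries Q m} (h : IsAdapted I S u) {y : Arcs Q m}
    (hI : I ≤ relationIdeal y) (hdet : (jac u).det ∉ relationIdeal y)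
    (hle : I.map (algebraMap _ (Localization.AtPrime (relationIdeal y))) ≤
      Ideal.span (germParam _ y u '' S)) :
    IsRegularQuotientAt I (relationIdeal y) := by
  rw [IsRegularQuotientAt, le_antisymm hle (h.span_germParam_le _ hI)]
  exact (isRegularLocalRing_quotient_span (span_range_germParam _ h.eq_none hdet)
    (card_le_ringKrullDim _ y) S).1

/-- The converse of the Jacobian criterion: at a regular point, a maximal adapted system generates
the ideal. -/
theorem IsMaxAdapted.map_eq_span_germParam {I : Ideal (BSeries Q m)} {S : Finset (Fin m)}
    {u : Option (Fin m) → BSeries Q m} {y : Arcs Q m} (h : IsMaxAdapted I (relationIdeal y) S u)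
    (hI : I ≤ relationIdeal y) (hreg : IsRegularQuotientAt I (relationIdeal y)) :
    I.map (algebraMap _ (Localization.AtPrime (relationIdeal y))) =
      Ideal.span (germParam _ y u '' S) :=
  eq_span_image_of_isRegularLocalRing_quotient (span_range_germParam _ h.eq_none h.det)
    (card_le_ringKrullDim _ y) S (h.span_germParam_le _ hI) (h.map_le_sup _ hI) hreg

end LocalRing

end Arquile

namespace Arquile

/-! ### Iterated derivations -/

section Iterate

variable {k R : Type*} [CommRing k] [CommRing R] [Algebra k R]

open Finset Nat in
/-- The general Leibniz rule. -/
theorem iterate_derivation_mul (D : Derivation k R R) (n : ℕ) (a b : R) :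
    D^[n] (a * b) = ∑ ij ∈ antidiagonal n, choose n ij.1 • (D^[ij.1] a * D^[ij.2] b) := by
  induction n with
  | zero => simp
  | succ n ih =>
    rw [sum_antidiagonal_choose_succ_nsmul (M := R) (fun i j => D^[i] a * D^[j] b) n]
    simp only [Function.iterate_succ_apply', ih, map_sum, map_nsmul, Derivation.leibniz,
      smul_add, sum_add_distrib, smul_eq_mul]
    congr 1
    refine sum_congr rfl fun ⟨i, j⟩ hij ↦ ?_
    rw [n.choose_symm_of_eq_add (mem_antidiagonal.1 hij).symm, mul_comm]

/-- In characteristic `p`, the `p`-th iterate of a derivation is a derivation. -/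
def iterateDerivation (p : ℕ) [hp : Fact p.Prime] [CharP R p] (D : Derivation k R R) :
    Derivation k R R :=
  Derivation.mk' ((D : R →ₗ[k] R) ^ p) fun a b => by
    have h : ∀ x, ((D : R →ₗ[k] R) ^ p) x = D^[p] x := fun x =>
      Module.End.pow_apply _ _ _
    have hp0 := hp.out.ne_zero
    rw [h, h, h, iterate_derivation_mul, Finset.sum_eq_add (0, p) (p, 0) (by simp [hp0])]
    · simp [mul_comm]
    · rintro ⟨i, j⟩ hij hne
      rw [Finset.HasAntidiagonal.mem_antidiagonal] at hij
      have hi : i ≠ 0 := by rintro rfl; simp_all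
      have hj : j ≠ 0 := by rintro rfl; simp_all
      have hdvd : p ∣ p.choose i := hp.out.dvd_choose_self hi (by omega)
      rw [nsmul_eq_mul, (CharP.cast_eq_zero_iff R p _).mpr hdvd, zero_mul]
    · simp
    · simp

theorem iterateDerivation_apply (p : ℕ) [Fact p.Prime] [CharP R p] (D : Derivation k R R)
    (x : R) : iterateDerivation p D x = D^[p] x :=
  Module.End.pow_apply _ _ _

theorem iterate_derivation_pow_mul {D : Derivation k R R} {u c : R} (hu : D u = c) (hc : D c = 0)
    (i : ℕ) {e : R} (he : D e = 0) : D^[i] (u ^ i * e) = (i.factorial : R) * c ^ i * e := by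
  induction i generalizing e with
  | zero => simp
  | succ i ih =>
    have h1 : D (u ^ (i + 1) * e) = u ^ i * (((i + 1 : ℕ) : R) * (c * e)) := by
      rw [Derivation.leibniz, he, smul_zero, zero_add, Derivation.leibniz_pow, hu]
      simp only [add_tsub_cancel_right, smul_eq_mul, nsmul_eq_mul]
      ring
    have h2 : D (((i + 1 : ℕ) : R) * (c * e)) = 0 := by
      simp [Derivation.leibniz, hc, he]
    rw [Function.iterate_succ_apply, h1, ih h2, Nat.factorial_succ]
    push_cast
    ring

end Iterate

/-! ### Existence of regular points -/

section Existence

open IsLocalRing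

variable {k : Type*} [Field k] {Q : Quality k} {m : ℕ}

/-- The hypotheses under which regularity is shown: an adapted system for `I`, a point `y` where
its Jacobian determinant does not vanish, and the tangency to `I` of those dual derivations which
belong to the remaining directions. -/
structure IsTransversal (I : Ideal (BSeries Q m)) (S : Finset (Fin m))
    (u : Option (Fin m) → BSeries Q m) (y : Arcs Q m) : Prop extends IsAdapted I S u where
  le : I ≤ relationIdeal y
  det : (jac u).det ∉ relationIdeal y
  tangent : ∀ a, (∀ c ∈ S, a ≠ some c) → ∀ f ∈ I, adjD u a f ∈ I

/-- The ideal `I` has a system which is transversal at some point. -/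
theorem exists_isTransversal {Y : Set (Arcs Q m)} (hY : Y.Nonempty) :
    ∃ y ∈ Y, ∃ S u, IsTransversal (vanishingIdeal Y) S u y := by
  have hle : ∀ y ∈ Y, vanishingIdeal Y ≤ relationIdeal y := fun y hy f hf =>
    mem_relationIdeal.mpr (mem_vanishingIdeal.mp hf y hy)
  have hne : vanishingIdeal Y ≠ ⊤ := by
    obtain ⟨y, hy⟩ := hY
    exact fun h => Ideal.IsPrime.ne_top' (top_le_iff.mp (h ▸ hle y hy))
  obtain ⟨S, u, h⟩ := exists_isMaxAdapted (vanishingIdeal Y) hne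
  have hdet := h.det
  rw [mem_vanishingIdeal] at hdet
  push Not at hdet
  obtain ⟨y, hy, hdet⟩ := hdet
  refine ⟨y, hy, S, u, h.toIsAdapted, hle y hy, hdet, fun a ha f hf => ?_⟩
  rcases a with - | c
  · exact mem_vanishingIdeal.mpr fun y' hy' =>
      mem_relationIdeal.mp (h.adjD_none_mem (hle y' hy') (hle y' hy') hf)
  · exact h.adjD_mem hf fun hc => ha c hc rfl

variable {I : Ideal (BSeries Q m)} {S : Finset (Fin m)} {u : Option (Fin m) → BSeries Q m}
  {y : Arcs Q m} (L : Type*) [CommRing L] [Algebra (BSeries Q m) L]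

theorem IsTransversal.germParam_eq (h : IsTransversal I S u y) {c : Fin m} (hc : c ∈ S) :
    germParam L y u c = algebraMap _ L (u (some c)) := by
  rw [germParam, localParam_eq (h.le (h.mem c hc))]

theorem IsTransversal.algebraMap_mul_mem (h : IsTransversal I S u y) {c : Fin m} (hc : c ∈ S)
    (x : BSeries Q m) :
    algebraMap _ L (u (some c) * x) ∈ Ideal.span (germParam L y u '' S) := by
  rw [map_mul, ← h.germParam_eq L hc]
  exact Ideal.mul_mem_right _ _ (Ideal.subset_span ⟨c, hc, rfl⟩)

variable [IsLocalization.AtPrime L (relationIdeal y)] [IsLocalRing L]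

/-- The step of the proof in characteristic zero: `I` is contained in the ideal generated by the
system up to terms of order `N + 1`, provided this holds up to terms of order `N`. The Euler
derivation of the system maps an element `e` of order `N` to `N * det * e` up to terms of higher
order, and it preserves `I` up to the ideal of the system. -/
theorem IsTransversal.map_le_sup_pow_succ [CharZero k] (h : IsTransversal I S u y) {N : ℕ}
    (hN : N ≠ 0)
    (ih : I.map (algebraMap _ L) ≤ Ideal.span (germParam L y u '' S) ⊔ maximalIdeal L ^ N) :
    I.map (algebraMap _ L) ≤ Ideal.span (germParam L y u '' S) ⊔ maximalIdeal L ^ (N + 1) := by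
  classical
  set J := Ideal.span (germParam L y u '' S) ⊔ maximalIdeal L ^ (N + 1) with hJ
  set H : Ideal (BSeries Q m) := Ideal.span ((fun c => u (some c)) '' S) with hH
  set P := relationIdeal y with hP
  -- the Euler derivation
  let E : BSeries Q m → BSeries Q m := fun f => ∑ a, localParam y u a * adjD u (some a) f
  have hEadd : ∀ f f', E (f + f') = E f + E f' := fun f f' => by
    simp only [E, map_add, mul_add, Finset.sum_add_distrib]
  have hEmul : ∀ f f', E (f * f') = f * E f' + f' * E f := fun f f' => by
    simp only [E, Derivation.leibniz, smul_eq_mul, mul_add, Finset.sum_add_distrib, Finset.mul_sum]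
    congr 1 <;> exact Finset.sum_congr rfl fun a _ => by ring
  have hEP : ∀ x ∈ P, (jac u).det * x - E x ∈ P ^ 2 := fun x hx => by
    have := det_mul_sub_sum_adjD_mem y h.eq_none hx
    simpa only [E, mul_comm] using this
  have hEpow : ∀ (n : ℕ) (e : BSeries Q m), e ∈ P ^ n →
      (n : BSeries Q m) * (jac u).det * e - E e ∈ P ^ (n + 1) := by
    intro n
    induction n with
    | zero =>
      intro e _
      simp only [E, Nat.cast_zero, zero_mul, zero_sub, zero_add, pow_one, neg_mem_iff]
      exact Ideal.sum_mem _ fun a _ => Ideal.mul_mem_right _ _ (localParam_mem y u a)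
    | succ n ihn =>
      intro e he
      rw [pow_succ'] at he
      refine Submodule.mul_induction_on he (fun x hx e he => ?_) fun e e' he he' => ?_
      · have h1 := Ideal.mul_mem_mul hx (ihn e he)
        have h2 := Ideal.mul_mem_mul he (hEP x hx)
        rw [← pow_succ'] at h1
        rw [← pow_add] at h2
        have h3 := add_mem h1 h2
        rw [hEmul]
        push_cast
        convert h3 using 1
        ring
      · rw [hEadd]
        convert add_mem he he' using 1
        ring
  have hEH : ∀ f ∈ H, E f ∈ H := by
    intro f hf
    refine Submodule.span_induction ?_ ?_ ?_ ?_ hf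
    · rintro _ ⟨c, hc, rfl⟩
      have : E (u (some c)) = (jac u).det * u (some c) := by
        simp only [E, adjD_apply_self]
        rw [Finset.sum_eq_single c (fun b _ hb => by simp [hb.symm]) (by simp), if_pos rfl,
          localParam_eq (h.le (h.mem c hc)), mul_comm]
      rw [this]
      exact Ideal.mul_mem_left _ _ (Ideal.subset_span ⟨c, hc, rfl⟩)
    · simp [E]
    · intro f f' _ _ hf hf'
      rw [hEadd]
      exact add_mem hf hf'
    · intro a f hfH hf
      rw [smul_eq_mul, hEmul]
      exact add_mem (Ideal.mul_mem_left _ _ hf) (Ideal.mul_mem_right _ _ hfH)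
  have hHJ : ∀ f ∈ H, algebraMap _ L f ∈ J := by
    intro f hf
    have h1 : H.map (algebraMap _ L) ≤ Ideal.span (germParam L y u '' S) := by
      rw [hH, Ideal.map_span, Ideal.span_le]
      rintro _ ⟨_, ⟨c, hc, rfl⟩, rfl⟩
      simpa using h.algebraMap_mul_mem L hc 1
    exact Ideal.mem_sup_left (h1 (Ideal.mem_map_of_mem _ hf))
  rw [Ideal.map_le_iff_le_comap]
  intro f hf
  have hsup : Ideal.span (germParam L y u '' S) ⊔ maximalIdeal L ^ N =
      (H ⊔ P ^ N).map (algebraMap _ L) := by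
    rw [Ideal.map_sup, Ideal.map_pow, hP, map_relationIdeal L, hH, Ideal.map_span,
      ← Set.image_comp]
    congr 2
    refine Set.image_congr fun c hc => ?_
    exact h.germParam_eq L hc
  have h1 := ih (Ideal.mem_map_of_mem _ hf)
  rw [hsup, IsLocalization.algebraMap_mem_map_algebraMap_iff P.primeCompl L] at h1
  obtain ⟨s, hs, h1⟩ := h1
  obtain ⟨η, hη, e, he, hsf⟩ := Submodule.mem_sup.mp h1
  -- the Euler derivative of `s * f`
  have h2 : algebraMap _ L (E (s * f)) ∈ J := by
    rw [map_sum]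
    refine Ideal.sum_mem _ fun a _ => ?_
    by_cases ha : a ∈ S
    · rw [localParam_eq (h.le (h.mem a ha))]
      exact Ideal.mem_sup_left (h.algebraMap_mul_mem L ha _)
    · have h3 := ih (Ideal.mem_map_of_mem (algebraMap _ L) (h.tangent (some a)
        (fun c hc hac => ha (Option.some_injective _ hac ▸ hc)) _ (I.mul_mem_left s hf)))
      obtain ⟨x, hx, z, hz, hxz⟩ := Submodule.mem_sup.mp h3
      rw [map_mul, ← hxz, mul_add]
      refine Submodule.add_mem_sup (Ideal.mul_mem_left _ _ hx) ?_
      rw [pow_succ']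
      refine Ideal.mul_mem_mul ?_ hz
      simpa using algebraMap_mem_pow L (n := 1) (by simpa using localParam_mem y u a)
  have h3 : algebraMap _ L ((N : BSeries Q m) * (jac u).det * e) ∈ J := by
    have h4 := Ideal.mem_sup_right (S := Ideal.span (germParam L y u '' S))
      (algebraMap_mem_pow L (hEpow N e he))
    have h5 : (N : BSeries Q m) * (jac u).det * e =
        ((N : BSeries Q m) * (jac u).det * e - E e) + E (s * f) - E η := by
      rw [← hsf, hEadd]
      ring
    rw [h5, map_sub, map_add]
    exact sub_mem (add_mem h4 h2) (hHJ _ (hEH η hη))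
  have hunit : IsUnit (algebraMap _ L ((N : BSeries Q m) * (jac u).det)) := by
    rw [map_mul]
    refine IsUnit.mul ?_ (isUnit_algebraMap L h.det)
    rw [← map_natCast (algebraMap k (BSeries Q m))]
    exact ((IsUnit.mk0 (N : k) (Nat.cast_ne_zero.mpr hN)).map (algebraMap k _)).map _
  rw [map_mul, Ideal.unit_mul_mem_iff_mem _ hunit] at h3
  rw [Ideal.mem_comap, ← Ideal.unit_mul_mem_iff_mem _ (isUnit_algebraMap L hs), ← map_mul, ← hsf,
    map_add]
  exact add_mem (hHJ η hη) h3

theorem IsTransversal.map_le_of_charZero [IsNoetherianRing L] [CharZero k]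
    (h : IsTransversal I S u y) : I.map (algebraMap _ L) ≤ Ideal.span (germParam L y u '' S) := by
  have hIM : I.map (algebraMap _ L) ≤ maximalIdeal L := by
    rw [← map_relationIdeal L (y := y)]
    exact Ideal.map_mono h.le
  refine le_of_forall_le_sup_pow ((h.span_germParam_le L h.le).trans hIM) fun N => ?_
  induction N with
  | zero => simp
  | succ N ih =>
    rcases eq_or_ne N 0 with rfl | hN
    · rw [zero_add, pow_one]
      exact hIM.trans le_sup_right
    · exact h.map_le_sup_pow_succ L hN ih

/-- The derivation dual to the `a`-th entry of the system `u`, multiplied by the `p`-th power of the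
Jacobian determinant, which is a constant for all derivations in characteristic `p`. -/
noncomputable def powD (p : ℕ) (u : Option (Fin m) → BSeries Q m) (a : Option (Fin m)) :
    Derivation k (BSeries Q m) (BSeries Q m) :=
  (jac u).det ^ (p - 1) • adjD u a

section PowD

variable (p : ℕ)

theorem powD_apply (u : Option (Fin m) → BSeries Q m) (a : Option (Fin m)) (f : BSeries Q m) :
    powD p u a f = (jac u).det ^ (p - 1) * adjD u a f := rfl

instance charP_series [CharP k p] (σ : Type*) : CharP (Q.series σ) p :=
  charP_of_injective_algebraMap (algebraMap k (Q.series σ)).injective p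

theorem derivation_pow_eq_zero [CharP k p] (D : Derivation k (BSeries Q m) (BSeries Q m))
    (f : BSeries Q m) : D (f ^ p) = 0 := by
  rw [Derivation.leibniz_pow, ← Nat.cast_smul_eq_nsmul (BSeries Q m), CharP.cast_eq_zero, zero_smul]

variable [hp : Fact p.Prime]

theorem powD_apply_self (u : Option (Fin m) → BSeries Q m) (a b : Option (Fin m)) :
    powD p u a (u b) = if b = a then (jac u).det ^ p else 0 := by
  rw [powD_apply, adjD_apply_self, mul_ite, mul_zero, ← pow_succ,
    Nat.sub_add_cancel hp.out.one_le]

variable [CharP k p]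

theorem powD_comm {u : Option (Fin m) → BSeries Q m} (hu : (jac u).det ≠ 0)
    (a b : Option (Fin m)) (f : BSeries Q m) :
    powD p u a (powD p u b f) = powD p u b (powD p u a f) := by
  have h : ⁅powD p u a, powD p u b⁆ = 0 := by
    refine derivation_eq_zero_of_det_ne_zero hu fun c => ?_
    rw [Derivation.commutator_apply, powD_apply_self, powD_apply_self]
    have h0 : ∀ (D : Derivation k (BSeries Q m) (BSeries Q m)) (q : Prop) [Decidable q],
        D (if q then (jac u).det ^ p else 0) = 0 := by
      intro D q _
      split_ifs
      · exact derivation_pow_eq_zero p D _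
      · exact map_zero D
    rw [h0, h0, sub_zero]
  have h1 := DFunLike.congr_fun h f
  rw [Derivation.commutator_apply, Derivation.zero_apply, sub_eq_zero] at h1
  exact h1

theorem powD_iterate_eq_zero {u : Option (Fin m) → BSeries Q m} (hu : (jac u).det ≠ 0)
    (a : Option (Fin m)) (f : BSeries Q m) : (powD p u a)^[p] f = 0 := by
  have h : iterateDerivation p (powD p u a) = 0 := by
    refine derivation_eq_zero_of_det_ne_zero hu fun c => ?_
    obtain ⟨q, hq⟩ : ∃ q, p = q + 1 + 1 := ⟨p - 2, by have := hp.out.two_le; omega⟩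
    have h0 : powD p u a (powD p u a (u c)) = 0 := by
      rw [powD_apply_self]
      split_ifs
      · exact derivation_pow_eq_zero p _ _
      · exact map_zero _
    have h1 : (powD p u a)^[p] (u c) = (powD p u a)^[q] (powD p u a (powD p u a (u c))) := by
      rw [← Function.iterate_succ_apply, ← Function.iterate_succ_apply]
      exact congrArg (fun n => (powD p u a)^[n] (u c)) hq
    rw [iterateDerivation_apply, h1, h0]
    exact Function.iterate_fixed (map_zero _) q
  rw [← iterateDerivation_apply, h, Derivation.zero_apply]

/-- The elements of `I` belong to the ideal of the system up to the maximal ideal times `I`: an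
element which is annihilated by all `powD p u a` is a `p`-th power, and the directions are
processed one at a time, using that `powD p u a` is nilpotent. The finite set `T` consists of the
directions not yet processed. -/
theorem IsTransversal.algebraMap_mem_of_charP [PerfectRing k p] (h : IsTransversal I S u y)
    (hI : I.IsRadical) (T : Finset (Option (Fin m))) {f : BSeries Q m} (hf : f ∈ I)
    (hT : ∀ b ∉ T, powD p u b f = 0) :
    algebraMap _ L f ∈
      Ideal.span (germParam L y u '' S) ⊔ maximalIdeal L * I.map (algebraMap _ L) := by
  classical
  have hu : (jac u).det ≠ 0 := fun h0 => h.det (h0 ▸ zero_mem _)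
  induction T using Finset.induction_on generalizing f with
  | empty =>
    have h1 : ∀ b, MvPowerSeries.pderiv k b f.1 = 0 := by
      intro b
      have h2 : ∀ a, adjD u a f = 0 := fun a => by
        have := hT a (by simp)
        rw [powD_apply] at this
        exact (mul_eq_zero.mp this).resolve_left (pow_ne_zero _ hu)
      have h3 := det_mul_partialD u b f
      simp only [h2, mul_zero, Finset.sum_const_zero] at h3
      exact congrArg Subtype.val ((mul_eq_zero.mp h3).resolve_left hu)
    obtain ⟨c, hc, hcf⟩ := exists_pow_eq p f.2 h1
    have hcf' : (⟨c, hc⟩ : BSeries Q m) ^ p = f := Subtype.ext hcf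
    have hcI : (⟨c, hc⟩ : BSeries Q m) ∈ I := hI ⟨p, hcf' ▸ hf⟩
    obtain ⟨q, hq⟩ : ∃ q, p = q + 1 + 1 := ⟨p - 2, by have := hp.out.two_le; omega⟩
    rw [← hcf', hq, pow_succ, pow_succ, map_mul]
    refine Ideal.mem_sup_right (Ideal.mul_mem_mul ?_ (Ideal.mem_map_of_mem _ hcI))
    rw [← map_relationIdeal L (y := y)]
    exact Ideal.mem_map_of_mem _ (Ideal.mul_mem_left _ _ (h.le hcI))
  | insert a T ha ih =>
    set D := powD p u a with hD
    have hcomm : ∀ (b : Option (Fin m)) (i : ℕ) (f : BSeries Q m), powD p u b f = 0 →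
        powD p u b (D^[i] f) = 0 := by
      intro b i f hf
      induction i with
      | zero => exact hf
      | succ i ih => rw [Function.iterate_succ_apply', powD_comm p hu, ih, map_zero]
    suffices H : ∀ i ≤ p, ∀ f ∈ I, (∀ b ∉ insert a T, powD p u b f = 0) → D^[i] f = 0 →
        algebraMap _ L f ∈
          Ideal.span (germParam L y u '' S) ⊔ maximalIdeal L * I.map (algebraMap _ L) from
      H p le_rfl f hf hT (powD_iterate_eq_zero p hu a f)
    intro i
    induction i with
    | zero =>
      intro _ f _ _ h0
      have h0 : f = 0 := h0
      rw [h0, map_zero]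
      exact zero_mem _
    | succ i ihi =>
      intro hi f hf hfT hDf
      have heT : ∀ b ∉ T, powD p u b (D^[i] f) = 0 := by
        intro b hb
        rcases eq_or_ne b a with rfl | hba
        · rw [← Function.iterate_succ_apply' (⇑D) i f, hDf]
        · exact hcomm b i f (hfT b (by simp [hba, hb]))
      rcases Nat.eq_zero_or_pos i with rfl | hi0
      · exact ih hf heT
      set e := D^[i] f with he
      -- the correction of `f` by a multiple of `e`, which has lower degree in direction `a`
      have hmem : u a ^ i * e ∈ I ∧ algebraMap _ L (u a ^ i * e) ∈
          Ideal.span (germParam L y u '' S) ⊔ maximalIdeal L * I.map (algebraMap _ L) := by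
        obtain ⟨i, rfl⟩ := Nat.exists_eq_succ_of_ne_zero hi0.ne'
        by_cases haS : ∀ c ∈ S, a ≠ some c
        · have heI : e ∈ I := by
            have : ∀ j, D^[j] f ∈ I := by
              intro j
              induction j with
              | zero => exact hf
              | succ j ihj =>
                rw [Function.iterate_succ_apply', hD, powD_apply]
                exact Ideal.mul_mem_left _ _ (h.tangent a haS _ ihj)
            exact this _
          refine ⟨Ideal.mul_mem_left _ _ heI, ?_⟩
          rw [map_mul]
          exact Ideal.mul_mem_left _ _ (ih heI heT)
        · push Not at haS
          obtain ⟨c, hc, rfl⟩ := haS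
          rw [pow_succ', mul_assoc]
          exact ⟨Ideal.mul_mem_right _ _ (h.mem c hc),
            Ideal.mem_sup_left (h.algebraMap_mul_mem L hc _)⟩
      have hγ : ∀ b, powD p u b ((jac u).det ^ p) = 0 := fun b => derivation_pow_eq_zero p _ _
      have h1 := ihi (by omega)
        (((i.factorial : BSeries Q m) * ((jac u).det ^ p) ^ i) * f - u a ^ i * e)
        (sub_mem (Ideal.mul_mem_left _ _ hf) hmem.1) (fun b hb => by
          have hba : b ≠ a := fun hba => hb (by simp [hba])
          have h5 := heT b fun hbT => hb (Finset.mem_insert_of_mem hbT)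
          simp [Derivation.leibniz, Derivation.leibniz_pow, hfT b hb, h5, powD_apply_self,
            hba.symm, hγ]) (by
          have h2 : ∀ (j : ℕ) (x : BSeries Q m),
              D^[j] (((i.factorial : BSeries Q m) * ((jac u).det ^ p) ^ i) * x) =
              ((i.factorial : BSeries Q m) * ((jac u).det ^ p) ^ i) * D^[j] x := by
            intro j x
            induction j with
            | zero => rfl
            | succ j ihj =>
              rw [Function.iterate_succ_apply', ihj, Derivation.leibniz, Derivation.leibniz,
                Derivation.leibniz_pow, hγ, Function.iterate_succ_apply']
              simp
          have h3 : D (u a) = (jac u).det ^ p := by rw [hD, powD_apply_self, if_pos rfl]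
          rw [iterate_map_sub, h2, iterate_derivation_pow_mul h3 (hγ a) i (heT a ha), ← he,
            sub_self])
      rw [map_sub] at h1
      have h4 := add_mem h1 hmem.2
      rw [sub_add_cancel, map_mul, Ideal.unit_mul_mem_iff_mem] at h4
      · exact h4
      rw [map_mul]
      refine IsUnit.mul ?_ ?_
      · rw [← map_natCast (algebraMap k (BSeries Q m))]
        refine ((IsUnit.mk0 (i.factorial : k) ?_).map (algebraMap k _)).map _
        rw [Ne, CharP.cast_eq_zero_iff k p, hp.out.dvd_factorial]
        omega
      · exact isUnit_algebraMap L fun hm =>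
          h.det (Ideal.IsPrime.mem_of_pow_mem inferInstance _
            (Ideal.IsPrime.mem_of_pow_mem inferInstance _ hm))

end PowD

/-- The ideal `I` is generated near `y` by the elements of a transversal system. -/
theorem IsTransversal.map_le [IsNoetherianRing L] [PerfectField k] (h : IsTransversal I S u y)
    (hI : I.IsRadical) : I.map (algebraMap _ L) ≤ Ideal.span (germParam L y u '' S) := by
  classical
  obtain ⟨p, hp⟩ := CharP.exists k
  rcases CharP.char_is_prime_or_zero k p with hp' | rfl
  · have : Fact p.Prime := ⟨hp'⟩
    have : ExpChar k p := ExpChar.prime hp'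
    refine Submodule.le_of_le_smul_of_le_jacobson_bot (R := L) (M := L) (I := maximalIdeal L)
      (IsNoetherian.noetherian _) (maximalIdeal_le_jacobson _) ?_
    rw [smul_eq_mul]
    nth_rw 1 [Ideal.map_le_iff_le_comap]
    exact fun f hf => h.algebraMap_mem_of_charP L p hI Finset.univ hf (by simp)
  · have : CharZero k := CharP.charP_to_charZero k
    exact h.map_le_of_charZero L

theorem isRadical_vanishingIdeal (Y : Set (Arcs Q m)) : (vanishingIdeal Y).IsRadical := by
  rintro f ⟨n, hn⟩
  rw [mem_vanishingIdeal] at hn ⊢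
  exact fun y hy => eq_zero_of_pow_eq_zero (by rw [← map_pow]; exact hn y hy)

/-- Every nonempty set of arcs has a regular point. -/
theorem exists_isArqRegularAt [PerfectField k] {Y : Set (Arcs Q m)} (hY : Y.Nonempty) :
    ∃ y ∈ Y, IsArqRegularAt Y y := by
  obtain ⟨y, hy, S, u, h⟩ := exists_isTransversal hY
  exact ⟨y, hy, h.toIsAdapted.isRegularQuotientAt h.le h.det
    (h.map_le (Localization.AtPrime (relationIdeal y)) (isRadical_vanishingIdeal Y))⟩

end Existence

end Arquile

namespace Arquile

/-! ### Minors of the relative Jacobian matrix -/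

section Minors

variable {k : Type*} [Field k] {Q : Quality k} {m : ℕ}

/-- The Jacobian determinant of an adapted system is a minor of the relative Jacobian matrix. -/
theorem det_jac_eq {r : ℕ} {u : Option (Fin m) → BSeries Q m} (cols : Fin r ↪o Fin m)
    (h0 : u none = var Q none) (h1 : ∀ c, (∀ i, cols i ≠ c) → u (some c) = var Q (some c)) :
    (jac u).det = (Matrix.of fun i j : Fin r =>
      partialD Q (some (cols j)) (u (some (cols i)))).det := by
  classical
  let p : Option (Fin m) → Prop := fun o => ∀ i, some (cols i) ≠ o
  have hvar : ∀ o, p o → u o = var Q o := by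
    intro o ho
    rcases o with - | c
    · exact h0
    · exact h1 c fun i hi => ho i (congrArg some hi)
  rw [Matrix.twoBlockTriangular_det' (jac u) p]
  · have hone : (jac u).toSquareBlockProp p = 1 := by
      ext1 a b
      change partialD Q b.1 (u a.1) = _
      rw [hvar a.1 a.2, partialD_var, Matrix.one_apply]
      simp only [Subtype.ext_iff]
    have hbij : Function.Bijective fun i : Fin r =>
        (⟨some (cols i), fun h => h i rfl⟩ : {o // ¬ p o}) := by
      constructor
      · intro i j hij
        exact cols.injective (Option.some_injective _ (congrArg Subtype.val hij))
      · rintro ⟨o, ho⟩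
        simp only [p, not_forall, not_not] at ho
        obtain ⟨i, rfl⟩ := ho
        exact ⟨i, rfl⟩
    rw [hone, Matrix.det_one, one_mul,
      ← Matrix.det_submatrix_equiv_self (Equiv.ofBijective _ hbij)]
    rfl
  · intro a ha b hb
    change partialD Q b (u a) = 0
    rw [hvar a ha, partialD_var, if_neg]
    rintro rfl
    exact hb ha

theorem val_det_partialD {N r : ℕ} (F : Fin N → BSeries Q m) (rows : Fin r → Fin N)
    (cols : Fin r → Fin m) :
    ((Matrix.of fun i j : Fin r => partialD Q (some (cols j)) (F (rows i))).det :
      MvPowerSeries (Option (Fin m)) k) = ((relJacobian F).submatrix rows cols).det := by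
  rw [← Subalgebra.coe_val, AlgHom.map_det]
  rfl

theorem isRelJacobianMinor_det_jac {N : ℕ} {F : Fin N → BSeries Q m} {I : Ideal (BSeries Q m)}
    {S : Finset (Fin m)} {u : Option (Fin m) → BSeries Q m} (h : IsAdapted I S u)
    (rows : Fin S.card ↪o Fin N) (hrows : ∀ i, F (rows i) = u (some (S.orderEmbOfFin rfl i))) :
    IsRelJacobianMinor F (jac u).det := by
  refine ⟨S.card, rows, S.orderEmbOfFin rfl, ?_⟩
  rw [← val_det_partialD, det_jac_eq (S.orderEmbOfFin rfl) h.eq_none fun c hc => ?_]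
  · simp_rw [hrows]
  · refine h.eq_some c fun hcS => ?_
    have : c ∈ Set.range (S.orderEmbOfFin rfl) := by simpa using hcS
    obtain ⟨i, hi⟩ := this
    exact hc i hi

end Minors

/-! ### The singular locus -/

section SingularLocus

variable {k : Type*} [Field k] {Q : Quality k} {m : ℕ}

theorem le_relationIdeal {Y : Set (Arcs Q m)} {y : Arcs Q m} (hy : y ∈ Y) :
    vanishingIdeal Y ≤ relationIdeal y := fun _ hf =>
  mem_relationIdeal.mpr (mem_vanishingIdeal.mp hf y hy)

theorem IsAdapted.image_eq {I : Ideal (BSeries Q m)} {S : Finset (Fin m)}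
    {u : Option (Fin m) → BSeries Q m} (h : IsAdapted I S u) {y : Arcs Q m}
    (hI : I ≤ relationIdeal y) (L : Type*) [CommRing L] [Algebra (BSeries Q m) L] :
    Ideal.span (germParam L y u '' S) =
      (Ideal.span ((fun c => u (some c)) '' (S : Set (Fin m)))).map (algebraMap _ L) := by
  rw [Ideal.map_span, ← Set.image_comp]
  congr 1
  refine Set.image_congr fun c hc => ?_
  rw [germParam, localParam_eq (hI (h.mem c hc))]
  rfl

theorem IsAdapted.map_le_of_mul_mem {I : Ideal (BSeries Q m)} {S : Finset (Fin m)}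
    {u : Option (Fin m) → BSeries Q m} (h : IsAdapted I S u) {s : BSeries Q m}
    (hs : ∀ f ∈ I, s * f ∈ Ideal.span ((fun c => u (some c)) '' (S : Set (Fin m))))
    {y : Arcs Q m} (hI : I ≤ relationIdeal y) (hsy : s ∉ relationIdeal y) (L : Type*) [CommRing L]
    [Algebra (BSeries Q m) L] [IsLocalization.AtPrime L (relationIdeal y)] :
    I.map (algebraMap _ L) ≤ Ideal.span (germParam L y u '' S) := by
  rw [Ideal.map_le_iff_le_comap]
  intro f hf
  rw [Ideal.mem_comap, ← Ideal.unit_mul_mem_iff_mem _ (isUnit_algebraMap L hsy), ← map_mul,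
    h.image_eq hI]
  exact Ideal.mem_map_of_mem _ (hs f hf)

/-- If `s` multiplies `I` into the ideal generated by the elements of `I` of an adapted system, then
all points of `Y` where neither `s` nor the Jacobian determinant vanish are regular. -/
theorem IsAdapted.isArqRegularAt {Y : Set (Arcs Q m)} {S : Finset (Fin m)}
    {u : Option (Fin m) → BSeries Q m} (h : IsAdapted (vanishingIdeal Y) S u) {s : BSeries Q m}
    (hs : ∀ f ∈ vanishingIdeal Y,
      s * f ∈ Ideal.span ((fun c => u (some c)) '' (S : Set (Fin m))))
    {y : Arcs Q m} (hy : y ∈ Y) (hsy : s ∉ relationIdeal y)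
    (hdet : (jac u).det ∉ relationIdeal y) : IsArqRegularAt Y y :=
  h.isRegularQuotientAt (le_relationIdeal hy) hdet
    (h.map_le_of_mul_mem hs (le_relationIdeal hy) hsy (Localization.AtPrime (relationIdeal y)))

/-- The factors `s` at the indices in `S`, and `1` at the other indices. -/
noncomputable def rowScale (S : Finset (Fin m)) (s : BSeries Q m) (o : Option (Fin m)) :
    BSeries Q m :=
  o.elim 1 fun c => if c ∈ S then s else 1

theorem rowScale_of_notMem {S : Finset (Fin m)} {s : BSeries Q m} {c : Fin m} (hc : c ∉ S) :
    rowScale S s (some c) = 1 := if_neg hc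

/-- Multiplying the elements of `I` in an adapted system by `s` multiplies the Jacobian determinant
by `s ^ |S|`, modulo `I`. -/
theorem evalAt_det_jac_mul {I : Ideal (BSeries Q m)} {S : Finset (Fin m)}
    {u : Option (Fin m) → BSeries Q m} (h : IsAdapted I S u) (s : BSeries Q m) {y : Arcs Q m}
    (hI : I ≤ relationIdeal y) :
    evalAt y (jac fun o => rowScale S s o * u o).det =
      evalAt y s ^ S.card * evalAt y (jac u).det := by
  classical
  have h1 : (evalAt y).mapMatrix (jac fun o => rowScale S s o * u o) =
      Matrix.diagonal (fun o => evalAt y (rowScale S s o)) * (evalAt y).mapMatrix (jac u) := by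
    ext1 a b
    rw [Matrix.diagonal_mul]
    change evalAt y (partialD Q b (rowScale S s a * u a)) =
      evalAt y (rowScale S s a) * evalAt y (partialD Q b (u a))
    rw [← map_mul, Derivation.leibniz, map_add, smul_eq_mul, smul_eq_mul, add_eq_left]
    rcases a with - | c
    · change evalAt y (u none * partialD Q b 1) = 0
      rw [Derivation.map_one_eq_zero, mul_zero, map_zero]
    · by_cases hc : c ∈ S
      · rw [map_mul, mem_relationIdeal.mp (hI (h.mem c hc)), zero_mul]
      · rw [rowScale_of_notMem hc, Derivation.map_one_eq_zero, mul_zero, map_zero]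
  have h2 : ∏ o, rowScale S s o = s ^ S.card := by
    rw [Fintype.prod_option]
    simp [rowScale, Finset.prod_ite_mem]
  rw [AlgHom.map_det, h1, Matrix.det_mul, Matrix.det_diagonal, ← AlgHom.map_det, ← map_prod, h2,
    map_pow]

theorem exists_isMaxAdapted_relationIdeal (I : Ideal (BSeries Q m)) (y : Arcs Q m) :
    ∃ S u, IsMaxAdapted I (relationIdeal y) S u :=
  exists_isMaxAdapted I Ideal.IsPrime.ne_top'

/-- At a regular point, some multiple of the ideal by an element not vanishing at the point is
contained in the ideal generated by the elements of a maximal adapted system. -/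
theorem IsMaxAdapted.exists_mul_mem {Y : Set (Arcs Q m)} {S : Finset (Fin m)}
    {u : Option (Fin m) → BSeries Q m} {y : Arcs Q m}
    (h : IsMaxAdapted (vanishingIdeal Y) (relationIdeal y) S u) (hy : y ∈ arqReg Y) :
    ∃ s ∉ relationIdeal y,
      ∀ f ∈ vanishingIdeal Y, s * f ∈ Ideal.span ((fun c => u (some c)) '' (S : Set (Fin m))) := by
  classical
  set P := relationIdeal y with hP
  have h1 := h.map_eq_span_germParam (le_relationIdeal hy.1) hy.2
  set J := Ideal.span ((fun c => u (some c)) '' (S : Set (Fin m))) with hJ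
  have h3 : ∀ f ∈ vanishingIdeal Y, ∃ s ∉ P, s * f ∈ J := by
    intro f hf
    have h4 := Ideal.mem_map_of_mem (algebraMap _ (Localization.AtPrime P)) hf
    rw [h1, h.image_eq (le_relationIdeal hy.1),
      IsLocalization.algebraMap_mem_map_algebraMap_iff P.primeCompl] at h4
    exact h4
  obtain ⟨G, hG⟩ := (IsNoetherian.noetherian (vanishingIdeal Y) : (vanishingIdeal Y).FG)
  have h4 : ∀ g : G, ∃ s ∉ P, s * g.1 ∈ J := fun g => h3 g.1 (hG ▸ Ideal.subset_span g.2)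
  choose s hs hsJ using h4
  refine ⟨∏ g, s g, fun hmem => ?_, fun f hf => ?_⟩
  · obtain ⟨g, -, hg⟩ := (Ideal.IsPrime.prod_mem_iff (p := P)).mp hmem
    exact hs g hg
  · have h5 : vanishingIdeal Y ≤ Submodule.comap (LinearMap.mulLeft _ (∏ g, s g)) J := by
      rw [← hG, Submodule.span_le]
      intro g hg
      change (∏ g, s g) * g ∈ J
      rw [← Finset.mul_prod_erase _ _ (Finset.mem_univ (⟨g, hg⟩ : G)), mul_right_comm]
      exact Ideal.mul_mem_right _ _ (hsJ ⟨g, hg⟩)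
    exact h5 hf

/-- Every regular point of `Y` has a neighbourhood of regular points which is the complement in `Y`
of the zero set of the Jacobian determinant of an adapted system. -/
theorem exists_isAdapted_of_mem_arqReg {Y : Set (Arcs Q m)} {y : Arcs Q m} (hy : y ∈ arqReg Y) :
    ∃ S u, IsAdapted (vanishingIdeal Y) S u ∧ (jac u).det ∉ relationIdeal y ∧
      ∀ y' ∈ Y, (jac u).det ∉ relationIdeal y' → y' ∈ arqReg Y := by
  classical
  obtain ⟨S, u, h⟩ := exists_isMaxAdapted_relationIdeal (vanishingIdeal Y) y
  obtain ⟨s, hs, hsI⟩ := h.exists_mul_mem hy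
  rcases S.eq_empty_or_nonempty with rfl | hS
  · refine ⟨∅, u, h.toIsAdapted, h.det, fun y' hy' hdet => ⟨hy', ?_⟩⟩
    have h0 : ∀ f ∈ vanishingIdeal Y, f = 0 := fun f hf => by
      have := hsI f hf
      rw [Finset.coe_empty, Set.image_empty, Ideal.span_empty, Ideal.mem_bot] at this
      exact (mul_eq_zero.mp this).resolve_left fun hs0 => hs (hs0 ▸ zero_mem _)
    exact h.toIsAdapted.isArqRegularAt (s := 1)
      (fun f hf => by rw [h0 f hf, mul_zero]; exact zero_mem _) hy'
      (fun h1 => Ideal.IsPrime.one_notMem inferInstance h1) hdet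
  · have hdet := fun (y' : Arcs Q m) (hy' : y' ∈ Y) =>
      evalAt_det_jac_mul h.toIsAdapted s (le_relationIdeal hy')
    refine ⟨S, fun o => rowScale S s o * u o,
      ⟨fun c hc => ?_, ?_, fun c hc => ?_⟩, ?_, fun y' hy' hne => ⟨hy', ?_⟩⟩
    · exact Ideal.mul_mem_left _ _ (h.mem c hc)
    · exact (one_mul _).trans h.eq_none
    · rw [rowScale_of_notMem hc, one_mul, h.eq_some c hc]
    · rw [mem_relationIdeal, hdet y hy.1]
      exact mul_ne_zero (pow_ne_zero _ fun h0 => hs (mem_relationIdeal.mpr h0))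
        fun h0 => h.det (mem_relationIdeal.mpr h0)
    · rw [mem_relationIdeal, hdet y' hy'] at hne
      refine h.toIsAdapted.isArqRegularAt hsI hy' (fun h0 => hne ?_) fun h0 => hne ?_
      · rw [mem_relationIdeal.mp h0, zero_pow (Finset.card_pos.mpr hS).ne', zero_mul]
      · rw [mem_relationIdeal.mp h0, mul_zero]

/-- The singular locus is defined by finitely many Jacobian determinants of adapted systems. -/
theorem exists_arqSing_eq (Y : Set (Arcs Q m)) :
    ∃ (q : ℕ) (S : Fin q → Finset (Fin m)) (u : Fin q → Option (Fin m) → BSeries Q m),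
      (∀ j, IsAdapted (vanishingIdeal Y) (S j) (u j)) ∧
      arqSing Y = {y | y ∈ Y ∧ ∀ j, evalAt y (jac (u j)).det = 0} := by
  classical
  let G : Set (BSeries Q m) := {g | ∃ S u, IsAdapted (vanishingIdeal Y) S u ∧ g = (jac u).det ∧
      ∀ y' ∈ Y, g ∉ relationIdeal y' → y' ∈ arqReg Y}
  obtain ⟨T, hTG, hT⟩ := (Submodule.fg_span_iff_fg_span_finset_subset G).mp
    (IsNoetherian.noetherian (Ideal.span G))
  have h1 : ∀ j : Fin T.card, ((T.equivFin.symm j : T) : BSeries Q m) ∈ G := fun j =>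
    hTG (T.equivFin.symm j).2
  choose S u hu hg hreg using h1
  refine ⟨T.card, S, u, hu, ?_⟩
  ext y
  constructor
  · rintro ⟨hy, hyr⟩
    refine ⟨hy, fun j => ?_⟩
    by_contra hne
    refine hyr (hreg j y hy fun h0 => hne ?_)
    rw [← hg j]
    exact mem_relationIdeal.mp h0
  · rintro ⟨hy, h0⟩
    refine ⟨hy, fun hyr => ?_⟩
    obtain ⟨S', u', ha, hdet, hr⟩ := exists_isAdapted_of_mem_arqReg hyr
    refine hdet ?_
    have h2 : Ideal.span G ≤ relationIdeal y := by
      change Submodule.span _ G ≤ _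
      rw [hT, Submodule.span_le]
      intro g hgT
      have := h0 (T.equivFin ⟨g, hgT⟩)
      rw [← hg, Equiv.symm_apply_apply] at this
      exact mem_relationIdeal.mpr this
    exact h2 (Ideal.subset_span ⟨S', u', ha, rfl, hr⟩)

theorem isArquileClosed_arqSing {n : ℕ} (f : Fin n → BSeries Q m) :
    IsArquileClosed (arqSing (zeroLocus f)) := by
  obtain ⟨q, S, u, -, h⟩ := exists_arqSing_eq (zeroLocus f)
  refine ⟨n + q, Fin.append f fun j => (jac (u j)).det, ?_⟩
  rw [h]
  ext y
  constructor
  · rintro ⟨hy, hj⟩ i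
    refine Fin.addCases (fun i => ?_) (fun i => ?_) i
    · rw [Fin.append_left]
      exact hy i
    · rw [Fin.append_right]
      exact hj i
  · intro hy
    refine ⟨fun i => ?_, fun j => ?_⟩
    · have := hy (Fin.castAdd q i)
      rwa [Fin.append_left] at this
    · have := hy (Fin.natAdd n j)
      rwa [Fin.append_right] at this

theorem arqSing_ssubset [PerfectField k] {Y : Set (Arcs Q m)} (hY : Y.Nonempty) :
    arqSing Y ⊂ Y := by
  refine ⟨Set.sdiff_subset, fun h => ?_⟩
  obtain ⟨y, hy, hr⟩ := exists_isArqRegularAt hY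
  exact (h hy).2 ⟨hy, hr⟩

theorem isCutOutByMinors_append {n : ℕ} (f : Fin n → BSeries Q m) :
    ∃ (l : ℕ) (h : Fin l → BSeries Q m),
      Ideal.span (Set.range (Fin.append f h)) = vanishingIdeal (zeroLocus f) ∧
      IsCutOutByMinors (Fin.append f h) (zeroLocus f) (arqSing (zeroLocus f)) := by
  classical
  obtain ⟨q, S, u, hu, hsing⟩ := exists_arqSing_eq (zeroLocus f)
  obtain ⟨G, hG⟩ := (IsNoetherian.noetherian (vanishingIdeal (zeroLocus f)) :
    (vanishingIdeal (zeroLocus f)).FG)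
  let gens : Fin G.card → BSeries Q m := fun i => (G.equivFin.symm i : G)
  let blocks : Fin (q * m) → BSeries Q m := fun i =>
    if (finProdFinEquiv.symm i).2 ∈ S (finProdFinEquiv.symm i).1 then
      u (finProdFinEquiv.symm i).1 (some (finProdFinEquiv.symm i).2) else 0
  refine ⟨G.card + q * m, Fin.append gens blocks, le_antisymm ?_ ?_, q, fun j => (jac (u j)).det,
    fun j => ?_, hsing⟩
  · rw [Ideal.span_le]
    rintro _ ⟨i, rfl⟩
    refine Fin.addCases (fun i => ?_) (fun i => ?_) i
    · rw [Fin.append_left]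
      exact mem_vanishingIdeal.mpr fun y hy => hy i
    · rw [Fin.append_right]
      refine Fin.addCases (fun i => ?_) (fun i => ?_) i
      · rw [Fin.append_left, ← hG]
        exact Ideal.subset_span (G.equivFin.symm i).2
      · rw [Fin.append_right]
        change (if _ then _ else _) ∈ vanishingIdeal (zeroLocus f)
        split_ifs with hi
        · exact (hu _).mem _ hi
        · exact zero_mem _
  · rw [← hG]
    refine Ideal.span_mono fun g hg => ⟨Fin.natAdd n (Fin.castAdd (q * m) (G.equivFin ⟨g, hg⟩)), ?_⟩
    rw [Fin.append_right, Fin.append_left]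
    change ((G.equivFin.symm _ : G) : BSeries Q m) = g
    rw [Equiv.symm_apply_apply]
  · refine isRelJacobianMinor_det_jac (hu j) (OrderEmbedding.ofStrictMono (fun i => Fin.natAdd n
      (Fin.natAdd G.card (finProdFinEquiv (j, (S j).orderEmbOfFin rfl i)))) fun i i' hii => ?_)
      fun i => ?_
    · have : (S j).orderEmbOfFin rfl i < (S j).orderEmbOfFin rfl i' :=
        ((S j).orderEmbOfFin rfl).lt_iff_lt.mpr hii
      rw [Fin.lt_def] at this ⊢
      simpa using this
    · change Fin.append f (Fin.append gens blocks) (Fin.natAdd n (Fin.natAdd G.card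
        (finProdFinEquiv (j, (S j).orderEmbOfFin rfl i)))) = _
      rw [Fin.append_right, Fin.append_right]
      simp only [blocks, Equiv.symm_apply_apply]
      rw [if_pos ((S j).orderEmbOfFin_mem rfl i)]

end SingularLocus

end Arquile

namespace Arquile

/-! ### Equidimensional ideals -/

theorem exists_det_submatrix_ne_zero {R : Type*} [CommRing R] {r n : ℕ}
    {A : Matrix (Fin r) (Fin n) R} {F : Matrix (Fin n) (Fin r) R} (h : (A * F).det ≠ 0) :
    ∃ rows : Fin r ↪o Fin n, (F.submatrix rows id).det ≠ 0 := by
  classical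
  have h1 : (A * F).det = ∑ p : Fin r → Fin n, (∏ i, A i (p i)) * (F.submatrix p id).det := by
    have h2 : A * F = fun i => ∑ j, A i j • F j := by
      ext i c
      simp [Matrix.mul_apply, Finset.sum_apply]
    change Matrix.detRowAlternating.toMultilinearMap (A * F) = _
    rw [h2, MultilinearMap.map_sum]
    refine Finset.sum_congr rfl fun p _ => ?_
    rw [MultilinearMap.map_smul_univ, smul_eq_mul]
    rfl
  rw [h1] at h
  obtain ⟨p, -, hp⟩ := Finset.exists_ne_zero_of_sum_ne_zero h
  have hp' := right_ne_zero_of_mul hp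
  have hinj : Function.Injective p := by
    intro i j hij
    by_contra hne
    exact hp' (Matrix.det_zero_of_row_eq hne (by ext c; simp [hij]))
  have hcard : (Finset.univ.image p).card = r := by
    rw [Finset.card_image_of_injective _ hinj, Finset.card_univ, Fintype.card_fin]
  let e := (Finset.univ.image p).orderEmbOfFin hcard
  have hrange : ∀ i, ∃ j, e j = p i := fun i => by
    have : p i ∈ Set.range e := by
      rw [Finset.range_orderEmbOfFin]
      simp
    exact this
  choose σ hσ using hrange
  have hσinj : Function.Injective σ := fun i j hij => hinj (by rw [← hσ i, ← hσ j, hij])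
  let τ : Equiv.Perm (Fin r) := Equiv.ofBijective σ (Finite.injective_iff_bijective.mp hσinj)
  refine ⟨e, fun h0 => hp' ?_⟩
  have h3 : F.submatrix p id = (F.submatrix e id).submatrix τ id := by
    ext i c
    change F (p i) c = F (e (σ i)) c
    rw [hσ]
  rw [h3, Matrix.det_permute, h0, mul_zero]

section Equidimensional

variable {k : Type*} [Field k] {Q : Quality k} {m : ℕ}

theorem IsMaxAdapted.exists_height_eq_aux {I : Ideal (BSeries Q m)} {S : Finset (Fin m)}
    {u : Option (Fin m) → BSeries Q m} {y : Arcs Q m} (h : IsMaxAdapted I (relationIdeal y) S u)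
    (L : Type*) [CommRing L] [Algebra (BSeries Q m) L]
    [IsLocalization.AtPrime L (relationIdeal y)] [IsLocalRing L] [IsNoetherianRing L]
    (hJ : I.map (algebraMap _ L) = Ideal.span (germParam L y u '' S)) :
    ∃ p ∈ I.minimalPrimes, p.height = S.card := by
  classical
  set J := Ideal.span (germParam L y u '' S) with hJdef
  have hprime : J.IsPrime :=
    isPrime_span_image (span_range_germParam L h.eq_none h.det) (card_le_ringKrullDim L y) S
  have h1 : (S.card : ℕ∞) ≤ J.height :=
    card_le_height_span_image (span_range_germParam L h.eq_none h.det)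
      (card_le_ringKrullDim L y) S
  have h2 : J.height ≤ S.card := by
    have h3 : J = Ideal.span ((S.image (germParam L y u) : Finset L) : Set L) := by
      rw [Finset.coe_image]
    have h4 : J ∈ (Ideal.span ((S.image (germParam L y u) : Finset L) : Set L)).minimalPrimes := by
      rw [← h3, Ideal.minimalPrimes_eq_subsingleton_self]
      rfl
    exact (Ideal.height_le_card_of_mem_minimalPrimes_span_finset h4).trans
      (by exact_mod_cast Finset.card_image_le)
  refine ⟨J.comap (algebraMap _ L), ⟨⟨inferInstance, ?_⟩, fun q hq hqp => ?_⟩, ?_⟩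
  · rw [← Ideal.map_le_iff_le_comap, hJ]
  · have hqP : q ≤ relationIdeal y := by
      refine hqp.trans ?_
      rw [← IsLocalization.AtPrime.under_maximalIdeal L (relationIdeal y)]
      exact Ideal.comap_mono (IsLocalRing.le_maximalIdeal hprime.ne_top)
    have hdisj : Disjoint ((relationIdeal y).primeCompl : Set (BSeries Q m)) q := by
      rw [Set.disjoint_left]
      exact fun x hx hxq => hx (hqP hxq)
    have h5 := IsLocalization.under_map_of_isPrime_disjoint (relationIdeal y).primeCompl L hq.1 hdisj
    change J.comap (algebraMap _ L) ≤ q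
    rw [← h5, ← hJ]
    exact Ideal.comap_mono (Ideal.map_mono hq.2)
  · exact (IsLocalization.height_under (relationIdeal y).primeCompl J).trans (le_antisymm h2 h1)

/-- Near a regular point, the ideal is a prime ideal of height the size of a maximal adapted
system. -/
theorem IsMaxAdapted.exists_height_eq {Y : Set (Arcs Q m)} {S : Finset (Fin m)}
    {u : Option (Fin m) → BSeries Q m} {y : Arcs Q m}
    (h : IsMaxAdapted (vanishingIdeal Y) (relationIdeal y) S u) (hy : y ∈ arqReg Y) :
    ∃ p ∈ (vanishingIdeal Y).minimalPrimes, p.height = S.card :=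
  h.exists_height_eq_aux (Localization.AtPrime (relationIdeal y))
    (h.map_eq_span_germParam (le_relationIdeal hy.1) hy.2)

/-- If the number of elements of an adapted system with nonvanishing Jacobian determinant is the
height of a minimal prime ideal of `I` contained in the ideal of the point, then these elements
generate `I` near this point. -/
theorem IsAdapted.map_le_of_height_le {I : Ideal (BSeries Q m)} {S : Finset (Fin m)}
    {u : Option (Fin m) → BSeries Q m} {y : Arcs Q m} (h : IsAdapted I S u)
    (hdet : (jac u).det ∉ relationIdeal y) {q : Ideal (BSeries Q m)} (hq : q ∈ I.minimalPrimes)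
    (hqP : q ≤ relationIdeal y) (hht : q.height ≤ S.card)
    (L : Type*) [CommRing L] [Algebra (BSeries Q m) L]
    [IsLocalization.AtPrime L (relationIdeal y)] [IsLocalRing L] [IsNoetherianRing L] :
    I.map (algebraMap _ L) ≤ Ideal.span (germParam L y u '' S) := by
  have hqprime : q.IsPrime := hq.1.1
  have hIq : I ≤ q := hq.1.2
  have hprime := isPrime_span_image (span_range_germParam L h.eq_none hdet)
    (card_le_ringKrullDim L y) S
  have h1 := card_le_height_span_image (span_range_germParam L h.eq_none hdet)
    (card_le_ringKrullDim L y) S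
  have hdisj : Disjoint ((relationIdeal y).primeCompl : Set (BSeries Q m)) q := by
    rw [Set.disjoint_left]
    exact fun x hx hxq => hx (hqP hxq)
  have hqL : (q.map (algebraMap _ L)).IsPrime :=
    IsLocalization.isPrime_of_isPrime_disjoint (relationIdeal y).primeCompl L q hqprime hdisj
  have h2 : (q.map (algebraMap _ L)).height ≤ S.card :=
    (IsLocalization.height_map_of_disjoint (relationIdeal y).primeCompl q hdisj).trans_le hht
  have h3 : Ideal.span (germParam L y u '' S) ≤ q.map (algebraMap _ L) :=
    (h.span_germParam_le L (hIq.trans hqP)).trans (Ideal.map_mono hIq)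
  have h4 : Ideal.span (germParam L y u '' S) = q.map (algebraMap _ L) := by
    by_contra hne
    have h5 := (Ideal.height_add_one_le_of_lt_of_isPrime (lt_of_le_of_ne h3 hne)).trans h2
    have h6 := (add_le_add_left h1 1).trans h5
    have h7 : S.card + 1 ≤ S.card := by exact_mod_cast h6
    omega
  rw [h4]
  exact Ideal.map_mono hIq

/-- The system obtained from the variables by replacing the variables with index in `cols` by the
components of `f` with index in `rows`. -/
noncomputable def minorSystem {n r : ℕ} (f : Fin n → BSeries Q m) (rows : Fin r ↪o Fin n)
    (cols : Fin r ↪o Fin m) : Option (Fin m) → BSeries Q m :=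
  Function.extend (fun i => some (cols i)) (fun i => f (rows i)) (var Q)

theorem minorSystem_some {n r : ℕ} (f : Fin n → BSeries Q m) (rows : Fin r ↪o Fin n)
    (cols : Fin r ↪o Fin m) (i : Fin r) : minorSystem f rows cols (some (cols i)) = f (rows i) :=
  ((Option.some_injective _).comp cols.injective).extend_apply (fun i => f (rows i)) (var Q) i

theorem isAdapted_minorSystem {n r : ℕ} {f : Fin n → BSeries Q m} {I : Ideal (BSeries Q m)}
    (hf : ∀ j, f j ∈ I) (rows : Fin r ↪o Fin n) (cols : Fin r ↪o Fin m) :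
    IsAdapted I (Finset.univ.map cols.toEmbedding) (minorSystem f rows cols) where
  mem c hc := by
    obtain ⟨i, -, rfl⟩ := Finset.mem_map.mp hc
    have h := minorSystem_some f rows cols i
    exact (congrArg (· ∈ I) h).mpr (hf _)
  eq_none := Function.extend_apply' _ _ _ (by simp)
  eq_some c hc := Function.extend_apply' _ _ _ (by
    rintro ⟨i, hi⟩
    exact hc (Finset.mem_map.mpr ⟨i, Finset.mem_univ i, Option.some_injective _ hi⟩))

theorem det_jac_minorSystem {n r : ℕ} (f : Fin n → BSeries Q m) (rows : Fin r ↪o Fin n)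
    (cols : Fin r ↪o Fin m) : (jac (minorSystem f rows cols)).det =
      (Matrix.of fun i j : Fin r => partialD Q (some (cols j)) (f (rows i))).det := by
  rw [det_jac_eq (u := minorSystem f rows cols) cols (Function.extend_apply' _ _ _ (by simp))
    fun c hc => Function.extend_apply' _ _ _ fun ⟨i, hi⟩ => hc i (Option.some_injective _ hi)]
  simp_rw [minorSystem_some]

/-- At a point where an adapted system of elements of `I` has nonvanishing Jacobian determinant,
a minor of the same size of the Jacobian matrix of generators of `I` does not vanish. -/
theorem IsAdapted.exists_minor_ne_zero {n r : ℕ} {f : Fin n → BSeries Q m} {S : Finset (Fin m)}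
    {u : Option (Fin m) → BSeries Q m} {y : Arcs Q m}
    (h : IsAdapted (Ideal.span (Set.range f)) S u) (hI : Ideal.span (Set.range f) ≤ relationIdeal y)
    (hdet : (jac u).det ∉ relationIdeal y) (hr : S.card = r) :
    ∃ (rows : Fin r ↪o Fin n) (cols : Fin r ↪o Fin m), evalAt y
      (Matrix.of fun i j : Fin r => partialD Q (some (cols j)) (f (rows i))).det ≠ 0 := by
  classical
  let cols := S.orderEmbOfFin hr
  have h1 : ∀ i, ∃ b : Fin n → BSeries Q m, ∑ j, b j * f j = u (some (cols i)) := fun i =>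
    Ideal.mem_span_range_iff_exists_fun.mp (h.mem _ (S.orderEmbOfFin_mem hr i))
  choose b hb using h1
  have hf : ∀ j, evalAt y (f j) = 0 := fun j =>
    mem_relationIdeal.mp (hI (Ideal.subset_span ⟨j, rfl⟩))
  have h2 := hdet
  rw [mem_relationIdeal, det_jac_eq cols h.eq_none fun c hc => h.eq_some c fun hcS => by
    have : c ∈ Set.range cols := by rwa [Finset.range_orderEmbOfFin]
    obtain ⟨i, hi⟩ := this
    exact hc i hi, AlgHom.map_det] at h2
  have h3 : (evalAt y).mapMatrix
      (Matrix.of fun i j : Fin r => partialD Q (some (cols j)) (u (some (cols i)))) =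
      (Matrix.of fun i j => evalAt y (b i j)) *
        (Matrix.of fun i j => evalAt y (partialD Q (some (cols j)) (f i))) := by
    ext1 i j
    rw [Matrix.mul_apply]
    change evalAt y (partialD Q (some (cols j)) (u (some (cols i)))) =
      ∑ l, evalAt y (b i l) * evalAt y (partialD Q (some (cols j)) (f l))
    rw [← hb, map_sum, map_sum]
    refine Finset.sum_congr rfl fun l _ => ?_
    rw [Derivation.leibniz, map_add, smul_eq_mul, smul_eq_mul, map_mul, map_mul, hf, zero_mul,
      add_zero]
  rw [h3] at h2
  obtain ⟨rows, hrows⟩ := exists_det_submatrix_ne_zero h2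
  refine ⟨rows, cols, ?_⟩
  rw [AlgHom.map_det]
  exact hrows

theorem isCutOutByMinors_of_height_eq [PerfectField k] {n : ℕ} {f : Fin n → BSeries Q m}
    (hY : (zeroLocus f).Nonempty)
    (hf : Ideal.span (Set.range f) = vanishingIdeal (zeroLocus f))
    (hht : ∀ p ∈ (vanishingIdeal (zeroLocus f)).minimalPrimes,
      ∀ p' ∈ (vanishingIdeal (zeroLocus f)).minimalPrimes, p.height = p'.height) :
    IsCutOutByMinors f (zeroLocus f) (arqSing (zeroLocus f)) := by
  classical
  obtain ⟨y₀, hy₀, hreg₀⟩ := exists_isArqRegularAt hY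
  obtain ⟨S₀, u₀, hmax₀⟩ := exists_isMaxAdapted_relationIdeal (vanishingIdeal (zeroLocus f)) y₀
  obtain ⟨p₀, hp₀, hht₀⟩ := hmax₀.exists_height_eq ⟨hy₀, hreg₀⟩
  set r := S₀.card with hr
  obtain ⟨q, ⟨e⟩⟩ := Finite.exists_equiv_fin ((Fin r ↪o Fin n) × (Fin r ↪o Fin m))
  let g : (Fin r ↪o Fin n) × (Fin r ↪o Fin m) → BSeries Q m := fun rc =>
    (Matrix.of fun i j : Fin r => partialD Q (some (rc.2 j)) (f (rc.1 i))).det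
  refine ⟨q, fun j => g (e.symm j), fun j => ⟨r, (e.symm j).1, (e.symm j).2,
    val_det_partialD f _ _⟩, ?_⟩
  ext y
  constructor
  · rintro ⟨hy, hsing⟩
    refine ⟨hy, fun j => ?_⟩
    by_contra hne
    refine hsing ⟨hy, ?_⟩
    set rc := e.symm j
    have hle := le_relationIdeal hy
    have hadapt := isAdapted_minorSystem (I := vanishingIdeal (zeroLocus f))
      (fun j => hf ▸ Ideal.subset_span (Set.mem_range_self j)) rc.1 rc.2
    have hdet : (jac (minorSystem f rc.1 rc.2)).det ∉ relationIdeal y := by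
      rw [det_jac_minorSystem, mem_relationIdeal]
      exact hne
    obtain ⟨p, hp, hpP⟩ := Ideal.exists_minimalPrimes_le hle
    refine hadapt.isRegularQuotientAt hle hdet (hadapt.map_le_of_height_le hdet hp hpP ?_
      (Localization.AtPrime (relationIdeal y)))
    rw [hht p hp p₀ hp₀, hht₀, Finset.card_map, Finset.card_univ, Fintype.card_fin]
  · rintro ⟨hy, h0⟩
    refine ⟨hy, fun hreg => ?_⟩
    obtain ⟨S, u, hmax⟩ := exists_isMaxAdapted_relationIdeal (vanishingIdeal (zeroLocus f)) y
    obtain ⟨p, hp, hpS⟩ := hmax.exists_height_eq hreg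
    have hcard : S.card = r := by
      rw [hht p hp p₀ hp₀, hht₀] at hpS
      exact_mod_cast hpS.symm
    have hadapt := hmax.toIsAdapted
    rw [← hf] at hadapt
    obtain ⟨rows, cols, hne⟩ := hadapt.exists_minor_ne_zero (hf ▸ le_relationIdeal hy) hmax.det hcard
    have := h0 (e (rows, cols))
    refine hne ?_
    simpa only [Equiv.symm_apply_apply] using this

end Equidimensional

end Arquile

namespace Arquile

/-! ### The implicit function theorem for arcs -/

section Implicit

variable {k : Type*} [Field k] {Q : Quality k} {m : ℕ}

theorem evalAt_eq_of_freeOf {S : Set (Option (Fin m))} {f : BSeries Q m} (hf : FreeOf S f.1)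
    {v v' : Arcs Q m} (h : ∀ i, some i ∉ S → v i = v' i) : evalAt v f = evalAt v' f := by
  rw [evalAt_apply, evalAt_apply, ← freeOf_iff.mp hf, subst_rename _ (hasSubst_substPoint v),
    subst_rename _ (hasSubst_substPoint v')]
  congr 1
  ext1 o
  obtain ⟨o, ho⟩ := o
  rcases o with - | i
  · rfl
  · exact congrArg Subtype.val (h i ho)

/-- The implicit function theorem for one equation. -/
theorem exists_implicit {i : Fin m} {H : BSeries Q m} (h0 : constTerm Q m H = 0)
    (h1 : constTerm Q m (partialD Q (some i) H) ≠ 0) :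
    ∃ r : BSeries Q m, constTerm Q m r = 0 ∧
      (∀ v v' : Arcs Q m, (∀ j, j ≠ i → v j = v' j) → evalAt v r = evalAt v' r) ∧
      ∀ v : Arcs Q m, evalAt v H = 0 ↔ (v i : PowerSeries k) = evalAt v r := by
  have hreg : IsRegularIn (some i) 1 H.1 := by
    refine ⟨fun j hj => ?_, ?_⟩
    · obtain rfl : j = 0 := by omega
      rw [Finsupp.single_zero]
      exact h0
    · intro h2
      refine h1 ?_
      change MvPowerSeries.coeff 0 (MvPowerSeries.pderiv k (some i) H.1) = 0
      rw [MvPowerSeries.coeff_pderiv, zero_add, h2, zero_mul]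
  obtain ⟨q, hq, r, hr, hqr, hdeg⟩ := exists_weierstrass hreg H.2 (series_X Q (some i))
  have heq : var Q (some i) = ⟨q, hq⟩ * H + ⟨r, hr⟩ := Subtype.ext hqr
  have hfree : FreeOf {some i} r := degreeInLT_one_iff.mp hdeg
  have hr0 : constTerm Q m ⟨r, hr⟩ = 0 := by
    have := congrArg (constTerm Q m) heq
    rwa [constTerm_var, map_add, map_mul, h0, mul_zero, zero_add, eq_comm] at this
  have hpr : partialD Q (some i) ⟨r, hr⟩ = 0 := by
    apply Subtype.ext
    ext n
    change MvPowerSeries.coeff n (MvPowerSeries.pderiv k (some i) r) = 0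
    rw [MvPowerSeries.coeff_pderiv]
    by_contra hne
    have := hfree _ (left_ne_zero_of_mul hne) (some i) rfl
    simp at this
  have hq0 : MvPowerSeries.constantCoeff q ≠ 0 := by
    intro hq0
    have h3 := congrArg (fun x => constTerm Q m (partialD Q (some i) x)) heq
    have hq0' : constTerm Q m ⟨q, hq⟩ = 0 := hq0
    simp only [partialD_var, if_true, map_one, map_add, Derivation.leibniz, smul_eq_mul, map_mul,
      hq0', h0, hpr, zero_mul, add_zero] at h3
    exact one_ne_zero h3
  obtain ⟨q', hq', hqq⟩ := exists_series_mul_eq_one hq hq0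
  refine ⟨⟨r, hr⟩, hr0, fun v v' h => evalAt_eq_of_freeOf hfree fun j hj =>
    h j fun hji => hj (by rw [hji]; rfl), fun v => ?_⟩
  have h4 := congrArg (evalAt v) heq
  rw [evalAt_var, map_add, map_mul] at h4
  change (v i : PowerSeries k) = _ at h4
  have h5 : evalAt v ⟨q, hq⟩ ≠ 0 := by
    intro h5
    have h6 : (⟨q', hq'⟩ * ⟨q, hq⟩ : BSeries Q m) = 1 := Subtype.ext hqq
    have := congrArg (evalAt v) h6
    rw [map_mul, h5, mul_zero, map_one] at this
    exact zero_ne_one this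
  rw [h4, add_eq_right, mul_eq_zero, or_iff_right h5]

/-- The implicit function theorem: a system of equations whose linear part in the variables with
index in `S` is the identity can be solved for these variables. The solutions `φ` are independent
of the variables with index in `S`, in the sense that their values at arcs are. -/
theorem exists_implicit_system (S : Finset (Fin m)) (H : Fin m → BSeries Q m)
    (h0 : ∀ c ∈ S, constTerm Q m (H c) = 0)
    (h1 : ∀ c ∈ S, ∀ b ∈ S, constTerm Q m (partialD Q (some b) (H c)) = if b = c then 1 else 0) :
    ∃ φ : Fin m → BSeries Q m, (∀ c, constTerm Q m (φ c) = 0) ∧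
      (∀ c ∈ S, ∀ v v' : Arcs Q m, (∀ j, j ∉ S → v j = v' j) →
        evalAt v (φ c) = evalAt v' (φ c)) ∧
      ∀ v : Arcs Q m, (∀ c ∈ S, evalAt v (H c) = 0) ↔
        ∀ c ∈ S, (v c : PowerSeries k) = evalAt v (φ c) := by
  classical
  induction S using Finset.induction_on with
  | empty => exact ⟨0, fun c => map_zero _, by simp, by simp⟩
  | insert i S hi ih =>
    obtain ⟨φ, hφ0, hφS, hφ⟩ := ih (fun c hc => h0 c (Finset.mem_insert_of_mem hc))
      fun c hc b hb => h1 c (Finset.mem_insert_of_mem hc) b (Finset.mem_insert_of_mem hb)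
    -- substitute the solution of the other equations in the equation with index `i`
    let ψ : Fin m → BSeries Q m := fun j => if j ∈ S then φ j else var Q (some j)
    have hψ : ∀ j, constTerm Q m (ψ j) = 0 := fun j => by
      simp only [ψ]
      split_ifs
      exacts [hφ0 j, constTerm_var _]
    have hψv : ∀ v : Arcs Q m, (∀ c ∈ S, (v c : PowerSeries k) = evalAt v (φ c)) →
        arcMap ψ hψ v = v := by
      intro v hv
      ext1 j
      apply Subtype.ext
      rw [arcMap_apply]
      simp only [ψ]
      split_ifs with hj
      · exact (hv j hj).symm
      · exact evalAt_var v _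
    have hψS : ∀ v v' : Arcs Q m, (∀ j, j ∉ S → v j = v' j) → arcMap ψ hψ v = arcMap ψ hψ v' := by
      intro v v' h
      ext1 j
      apply Subtype.ext
      rw [arcMap_apply, arcMap_apply]
      simp only [ψ]
      split_ifs with hj
      · exact hφS j hj v v' h
      · rw [evalAt_var, evalAt_var]
        exact congrArg Subtype.val (h j hj)
    obtain ⟨r, hr0, hri, hr⟩ := exists_implicit (i := i) (H := arcHom ψ hψ (H i))
      (by rw [constTerm_arcHom, h0 i (Finset.mem_insert_self i S)]) (by
        rw [constTerm_partialD_arcHom, Finset.sum_eq_single i]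
        · rw [h1 i (Finset.mem_insert_self i S) i (Finset.mem_insert_self i S), if_pos rfl, one_mul]
          simp only [ψ, if_neg hi]
          rw [partialD_var, if_pos rfl, map_one]
          exact one_ne_zero
        · intro j _ hj
          by_cases hjS : j ∈ S
          · rw [h1 i (Finset.mem_insert_self i S) j (Finset.mem_insert_of_mem hjS), if_neg hj,
              zero_mul]
          · simp only [ψ, if_neg hjS]
            rw [partialD_var, if_neg (by simpa using hj), map_zero, mul_zero]
        · simp)
    -- remove the variables with index in `S` from `r`
    let ζ : Fin m → BSeries Q m := fun j => if j ∈ S then 0 else var Q (some j)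
    have hζ : ∀ j, constTerm Q m (ζ j) = 0 := fun j => by
      simp only [ζ]
      split_ifs
      exacts [map_zero _, constTerm_var _]
    have hζv : ∀ (v : Arcs Q m) (j : Fin m), j ∉ S → arcMap ζ hζ v j = v j := by
      intro v j hj
      apply Subtype.ext
      rw [arcMap_apply]
      simp only [ζ, if_neg hj]
      exact evalAt_var v _
    have hζS : ∀ (v : Arcs Q m) (j : Fin m), j ∈ S → (arcMap ζ hζ v j : PowerSeries k) = 0 := by
      intro v j hj
      rw [arcMap_apply]
      simp only [ζ, if_pos hj]
      exact map_zero _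
    set φi : BSeries Q m := arcHom ζ hζ r with hφi
    have hφi0 : constTerm Q m φi = 0 := by rw [hφi, constTerm_arcHom, hr0]
    have hφiS : ∀ v v' : Arcs Q m, (∀ j, j ∉ insert i S → v j = v' j) →
        evalAt v φi = evalAt v' φi := by
      intro v v' h
      rw [hφi, evalAt_arcHom, evalAt_arcHom]
      refine hri _ _ fun j hj => ?_
      by_cases hjS : j ∈ S
      · exact Subtype.ext ((hζS v j hjS).trans (hζS v' j hjS).symm)
      · rw [hζv v j hjS, hζv v' j hjS, h j (by simp [hj, hjS])]
    have hφiv : ∀ v : Arcs Q m, (∀ c ∈ S, (v c : PowerSeries k) = evalAt v (φ c)) →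
        (evalAt v (H i) = 0 ↔ (v i : PowerSeries k) = evalAt v φi) := by
      intro v hv
      have h2 := hr (arcMap ζ hζ v)
      rw [evalAt_arcHom, hψS _ v fun j hj => hζv v j hj, hψv v hv, hζv v i hi,
        ← evalAt_arcHom] at h2
      exact h2
    -- insert the solution for the variable with index `i` in the other solutions
    let χ : Fin m → BSeries Q m := fun j => if j = i then φi else var Q (some j)
    have hχ : ∀ j, constTerm Q m (χ j) = 0 := fun j => by
      simp only [χ]
      split_ifs
      exacts [hφi0, constTerm_var _]
    have hχi : ∀ v : Arcs Q m, (arcMap χ hχ v i : PowerSeries k) = evalAt v φi := by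
      intro v
      rw [arcMap_apply]
      simp only [χ, if_true]
    have hχj : ∀ (v : Arcs Q m) (j : Fin m), j ≠ i → arcMap χ hχ v j = v j := by
      intro v j hj
      apply Subtype.ext
      rw [arcMap_apply]
      simp only [χ, if_neg hj]
      exact evalAt_var v _
    have hχv : ∀ v : Arcs Q m, (v i : PowerSeries k) = evalAt v φi → arcMap χ hχ v = v := by
      intro v hv
      ext1 j
      rcases eq_or_ne j i with rfl | hj
      · exact Subtype.ext ((hχi v).trans hv.symm)
      · exact hχj v j hj
    refine ⟨fun c => if c = i then φi else arcHom χ hχ (φ c), fun c => ?_, fun c hc v v' h => ?_,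
      fun v => ?_⟩
    · beta_reduce
      split_ifs
      · exact hφi0
      · rw [constTerm_arcHom, hφ0]
    · beta_reduce
      split_ifs with hci
      · exact hφiS v v' h
      · rw [evalAt_arcHom, evalAt_arcHom]
        refine hφS c ((Finset.mem_insert.mp hc).resolve_left hci) _ _ fun j hj => ?_
        rcases eq_or_ne j i with rfl | hji
        · exact Subtype.ext ((hχi v).trans ((hφiS v v' h).trans (hχi v').symm))
        · rw [hχj v j hji, hχj v' j hji, h j (by simp [hj, hji])]
    · rw [Finset.forall_mem_insert, Finset.forall_mem_insert, hφ v]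
      beta_reduce
      rw [if_pos rfl]
      have h3 : (v i : PowerSeries k) = evalAt v φi →
          ∀ c ∈ S, evalAt v (if c = i then φi else arcHom χ hχ (φ c)) = evalAt v (φ c) := by
        intro hv c hc
        rw [if_neg (show c ≠ i from fun hci => hi (hci ▸ hc)), evalAt_arcHom, hχv v hv]
      constructor
      · rintro ⟨h4, h5⟩
        have h6 := (hφiv v h5).mp h4
        exact ⟨h6, fun c hc => (h5 c hc).trans (h3 h6 c hc).symm⟩
      · rintro ⟨h4, h5⟩
        have h6 : ∀ c ∈ S, (v c : PowerSeries k) = evalAt v (φ c) := fun c hc =>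
          (h5 c hc).trans (h3 h4 c hc)
        exact ⟨(hφiv v h6).mpr h4, h6⟩

end Implicit

end Arquile

namespace Arquile

/-! ### Neighbourhoods of regular points -/

section Neighbourhood

variable {k : Type*} [Field k] {Q : Quality k} {m : ℕ}

theorem exists_eq_X_pow_mul {n : ℕ} {a : PowerSeries k} (ha : a ∈ Q.series Unit)
    (h : PowerSeries.X ^ n ∣ a) : ∃ c ∈ Q.series Unit, a = PowerSeries.X ^ n * c := by
  induction n generalizing a with
  | zero => exact ⟨a, ha, by simp⟩
  | succ n ih =>
    obtain ⟨c, hc, hac⟩ := exists_eq_C_add_sum (Q := Q) (σ := Unit) ha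
    have h0 : MvPowerSeries.constantCoeff (a : MvPowerSeries Unit k) = 0 :=
      PowerSeries.X_dvd_iff.mp ((dvd_pow_self _ n.succ_ne_zero).trans h)
    have hac' : a = PowerSeries.X * c () := by
      refine hac.trans ?_
      rw [h0, map_zero, zero_add, Fintype.sum_unique, mul_comm]
      rfl
    have h1 : PowerSeries.X ^ n ∣ (c () : PowerSeries k) := by
      rw [hac', pow_succ'] at h
      exact (mul_dvd_mul_iff_left PowerSeries.X_ne_zero).mp h
    obtain ⟨b, hb, hcb⟩ := ih (hc ()) h1
    refine ⟨b, hb, ?_⟩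
    rw [pow_succ', mul_assoc, ← hcb]
    exact hac'

/-- A nonzero series in one variable is a power of the variable up to a unit. -/
theorem exists_mul_eq_X_pow {a : PowerSeries k} (ha : a ∈ Q.series Unit) (h0 : a ≠ 0) :
    ∃ (e : ℕ), ∃ w ∈ Q.series Unit, w * a = PowerSeries.X ^ e := by
  have h2 := PowerSeries.coeff_order h0
  obtain ⟨c, hc, hac⟩ := exists_eq_X_pow_mul (n := a.order.toNat) ha PowerSeries.X_pow_order_dvd
  generalize a.order.toNat = e at h2 hac
  subst hac
  have h3 := PowerSeries.coeff_X_pow_mul c e 0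
  rw [zero_add] at h3
  rw [h3, PowerSeries.coeff_zero_eq_constantCoeff_apply] at h2
  obtain ⟨w, hw, hwc⟩ := exists_series_mul_eq_one (Q := Q) (σ := Unit) hc h2
  have hwc' : (w * c : PowerSeries k) = 1 := hwc
  exact ⟨e, w, hw, by rw [mul_left_comm, hwc', mul_one]⟩

/-- The components of the dilation `v ↦ y + t ^ ε * v` around `y`. -/
noncomputable def dilateSeries (y : Arcs Q m) (ε : Fin m → ℕ) (i : Fin m) : BSeries Q m :=
  ofT m ⟨y i, (y i).2.1⟩ + var Q none ^ ε i * var Q (some i)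

theorem constTerm_dilateSeries (y : Arcs Q m) (ε : Fin m → ℕ) (i : Fin m) :
    constTerm Q m (dilateSeries y ε i) = 0 := by
  rw [dilateSeries, map_add, map_mul, constTerm_ofT_centered, constTerm_var, mul_zero, add_zero]

/-- The dilation `v ↦ y + t ^ ε * v` around the arc `y`. -/
noncomputable def dilate (y : Arcs Q m) (ε : Fin m → ℕ) : Arcs Q m → Arcs Q m :=
  arcMap (dilateSeries y ε) (constTerm_dilateSeries y ε)

theorem dilate_apply (y : Arcs Q m) (ε : Fin m → ℕ) (v : Arcs Q m) (i : Fin m) :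
    (dilate y ε v i : PowerSeries k) =
      (y i : PowerSeries k) + PowerSeries.X ^ ε i * (v i : PowerSeries k) := by
  rw [dilate, arcMap_apply, dilateSeries, map_add, evalAt_ofT, map_mul, map_pow, evalAt_var,
    evalAt_var]
  rfl

theorem evalAt_centered_dilate (y : Arcs Q m) (ε : Fin m → ℕ) (v : Arcs Q m) (i : Fin m) :
    evalAt (dilate y ε v) (centered y i) = PowerSeries.X ^ ε i * (v i : PowerSeries k) := by
  rw [evalAt_centered, dilate_apply, add_sub_cancel_left]

theorem exists_dilate_eq {y y' : Arcs Q m} {ε : Fin m → ℕ}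
    (h : ∀ i, PowerSeries.X ^ (ε i + 1) ∣ (y' i : PowerSeries k) - (y i : PowerSeries k)) :
    ∃ v, dilate y ε v = y' := by
  have h1 : ∀ i, ∃ c : Centered Q,
      (y' i : PowerSeries k) - (y i : PowerSeries k) = PowerSeries.X ^ ε i * (c : PowerSeries k) := by
    intro i
    obtain ⟨c, hc, hcy⟩ := exists_eq_X_pow_mul (sub_mem (y' i).2.1 (y i).2.1) (h i)
    have hX : (PowerSeries.X * c : PowerSeries k) ∈ Q.series Unit := mul_mem (series_X Q ()) hc
    exact ⟨⟨PowerSeries.X * c, hX, by simp⟩, by rw [hcy, pow_succ, mul_assoc]⟩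
  choose c hc using h1
  refine ⟨c, ?_⟩
  ext1 i
  apply Subtype.ext
  rw [dilate_apply, ← hc, add_sub_cancel]

theorem dvd_dilate_sub (y : Arcs Q m) (ε : Fin m → ℕ) (v : Arcs Q m) (i : Fin m) :
    PowerSeries.X ^ (ε i + 1) ∣ (dilate y ε v i : PowerSeries k) - (y i : PowerSeries k) := by
  rw [dilate_apply, add_sub_cancel_left, pow_succ]
  exact mul_dvd_mul_left _ (PowerSeries.X_dvd_iff.mpr (v i).2.2)

theorem dilate_injective (y : Arcs Q m) (ε : Fin m → ℕ) :
    Function.Injective (dilate y ε) := by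
  intro v v' h
  ext1 i
  apply Subtype.ext
  have h1 := congrArg Subtype.val (congrFun h i)
  rw [dilate_apply, dilate_apply, add_right_inj] at h1
  exact mul_left_cancel₀ (pow_ne_zero _ PowerSeries.X_ne_zero) h1

/-- Second-order expansion at the point `y`. -/
theorem exists_eq_second_order (y : Arcs Q m) {h : BSeries Q m} (hy : h ∈ relationIdeal y) :
    ∃ q : Fin m → Fin m → BSeries Q m, h = ∑ b, evalT y (partialD Q (some b) h) * centered y b +
      ∑ b, ∑ b', q b b' * (centered y b * centered y b') := by
  obtain ⟨c, hc⟩ := exists_eq_sum_centered hy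
  choose q hq using fun b => exists_eq_evalT_add y (c b)
  have h1 : ∀ b, evalT y (c b) = evalT y (partialD Q (some b) h) := by
    intro b
    have h2 : evalAt y (partialD Q (some b) h) = evalAt y (c b) := by
      rw [hc]
      simp [Derivation.leibniz, partialD_centered, Finset.sum_add_distrib, evalAt_centered]
    rw [evalT, evalT]
    congr 2
    exact h2.symm
  refine ⟨q, ?_⟩
  simp_rw [← h1]
  rw [← Finset.sum_add_distrib]
  conv_lhs => rw [hc]
  refine Finset.sum_congr rfl fun b _ => ?_
  conv_lhs => rw [hq b]
  rw [add_mul, Finset.sum_mul]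
  congr 1
  exact Finset.sum_congr rfl fun b' _ => by ring

/-- The exponents of the dilation: `e` for the variables with index in `S`, and `2 * e` for the
others. If the linear part of an equation in the former variables has coefficients divisible by
`t ^ e`, then after dilation the whole equation is divisible by `t ^ (2 * e)`. -/
def weight (S : Finset (Fin m)) (e : ℕ) (i : Fin m) : ℕ := if i ∈ S then e else 2 * e

/-- If the Jacobian matrix of the system `h` at `y` has the inverse `t ^ (-e) * M`, then the
components of `M * h` are, after dilation, divisible by `t ^ (2 * e)`, and the quotients have the
identity as linear part in the variables with index in `S`. -/
theorem exists_normal_form (y : Arcs Q m) (S : Finset (Fin m)) (e : ℕ) {h : Fin m → BSeries Q m}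
    (hy : ∀ d ∈ S, h d ∈ relationIdeal y) (M : Fin m → Fin m → Q.series Unit)
    (hM : ∀ c ∈ S, ∀ b ∈ S, ∑ d ∈ S, (M c d : PowerSeries k) *
      evalAt y (partialD Q (some b) (h d)) = if b = c then PowerSeries.X ^ e else 0) :
    ∃ H : Fin m → BSeries Q m, (∀ c ∈ S, constTerm Q m (H c) = 0) ∧
      (∀ c ∈ S, ∀ b ∈ S, constTerm Q m (partialD Q (some b) (H c)) = if b = c then 1 else 0) ∧
      ∀ (v : Arcs Q m), ∀ c ∈ S, ∑ d ∈ S, (M c d : PowerSeries k) *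
        evalAt (dilate y (weight S e) v) (h d) = PowerSeries.X ^ (2 * e) * evalAt v (H c) := by
  classical
  choose! q hq using fun d hd => exists_eq_second_order y (hy d hd)
  let lin : Fin m → Fin m → BSeries Q m := fun c b =>
    if b ∈ S then (if b = c then 1 else 0) else
      ∑ d ∈ S, ofT m (M c d) * evalT y (partialD Q (some b) (h d))
  let quad : Fin m → Fin m → Fin m → BSeries Q m := fun c b b' =>
    (∑ d ∈ S, ofT m (M c d) * arcHom (dilateSeries y (weight S e))
      (constTerm_dilateSeries y (weight S e)) (q d b b')) *
        var Q none ^ (weight S e b + weight S e b' - 2 * e)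
  refine ⟨fun c => ∑ b, lin c b * var Q (some b) +
    ∑ b, ∑ b', quad c b b' * (var Q (some b) * var Q (some b')), fun c hc => ?_,
    fun c hc b hb => ?_, fun v c hc => ?_⟩
  · simp [constTerm_var]
  · have h1 : ∀ b', constTerm Q m (partialD Q (some b) (var Q (some b'))) =
        if b' = b then 1 else 0 := by
      intro b'
      by_cases hb' : b' = b
      · rw [partialD_var, if_pos (congrArg some hb'), if_pos hb', map_one]
      · rw [partialD_var, if_neg (by simpa using hb'), if_neg hb', map_zero]
    simp only [map_add, map_sum, Derivation.leibniz, smul_eq_mul, map_mul, constTerm_var, h1,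
      mul_zero, zero_mul, add_zero, mul_ite, mul_one]
    rw [Finset.sum_ite_eq' Finset.univ b, if_pos (Finset.mem_univ b)]
    simp only [lin, if_pos hb]
    split_ifs <;> simp
  · have hx : ∀ b, evalAt (dilate y (weight S e) v) (centered y b) =
        PowerSeries.X ^ weight S e b * (v b : PowerSeries k) := evalAt_centered_dilate y _ v
    have hvar : ∀ b, evalAt v (var Q (some b)) = (v b : PowerSeries k) := fun b => evalAt_var v _
    have hlin : ∀ b, ∑ d ∈ S, (M c d : PowerSeries k) * (evalAt y (partialD Q (some b) (h d)) *
        (PowerSeries.X ^ weight S e b * (v b : PowerSeries k))) =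
        PowerSeries.X ^ (2 * e) * (evalAt v (lin c b) * (v b : PowerSeries k)) := by
      intro b
      simp_rw [← mul_assoc]
      rw [← Finset.sum_mul, ← Finset.sum_mul]
      congr 1
      simp only [lin]
      by_cases hb : b ∈ S
      · rw [hM c hc b hb, if_pos hb, weight, if_pos hb]
        split_ifs
        · rw [map_one, mul_one, two_mul, pow_add]
        · rw [map_zero, mul_zero, zero_mul]
      · rw [if_neg hb, weight, if_neg hb, map_sum, mul_comm]
        congr 1
        refine Finset.sum_congr rfl fun d _ => ?_
        rw [map_mul, evalAt_ofT, evalAt_evalT]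
    have hquad : ∀ b b', ∑ d ∈ S, (M c d : PowerSeries k) *
        (evalAt (dilate y (weight S e) v) (q d b b') *
          (PowerSeries.X ^ weight S e b * (v b : PowerSeries k) *
            (PowerSeries.X ^ weight S e b' * (v b' : PowerSeries k)))) =
        PowerSeries.X ^ (2 * e) *
          (evalAt v (quad c b b') * ((v b : PowerSeries k) * (v b' : PowerSeries k))) := by
      intro b b'
      have hw : 2 * e + (weight S e b + weight S e b' - 2 * e) = weight S e b + weight S e b' := by
        have : ∀ i, e ≤ weight S e i := fun i => by
          rw [weight]
          split_ifs <;> omega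
        have h1 := this b
        have h2 := this b'
        omega
      have hq' : evalAt v (quad c b b') = (∑ d ∈ S, (M c d : PowerSeries k) *
          evalAt (dilate y (weight S e) v) (q d b b')) *
          PowerSeries.X ^ (weight S e b + weight S e b' - 2 * e) := by
        simp only [quad]
        rw [map_mul, map_pow, evalAt_var, map_sum]
        congr 1
        refine Finset.sum_congr rfl fun d _ => ?_
        rw [map_mul, evalAt_ofT, evalAt_arcHom]
        rfl
      have hX := pow_add (PowerSeries.X : PowerSeries k) (2 * e)
        (weight S e b + weight S e b' - 2 * e)
      rw [hw, pow_add] at hX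
      rw [hq', Finset.sum_mul, Finset.sum_mul, Finset.mul_sum]
      refine Finset.sum_congr rfl fun d _ => ?_
      linear_combination (M c d : PowerSeries k) *
        evalAt (dilate y (weight S e) v) (q d b b') * (v b : PowerSeries k) *
          (v b' : PowerSeries k) * hX
    have hexp : ∀ d ∈ S, evalAt (dilate y (weight S e) v) (h d) =
        ∑ b, evalAt y (partialD Q (some b) (h d)) *
          (PowerSeries.X ^ weight S e b * (v b : PowerSeries k)) +
        ∑ b, ∑ b', evalAt (dilate y (weight S e) v) (q d b b') *
          (PowerSeries.X ^ weight S e b * (v b : PowerSeries k) *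
            (PowerSeries.X ^ weight S e b' * (v b' : PowerSeries k))) := by
      intro d hd
      conv_lhs => rw [hq d hd]
      simp only [map_add, map_sum, map_mul, evalAt_evalT, hx]
    rw [Finset.sum_congr rfl fun d hd => by rw [hexp d hd]]
    simp only [map_add, map_sum, map_mul, hvar, mul_add, Finset.mul_sum, Finset.sum_add_distrib]
    congr 1
    · rw [Finset.sum_comm]
      exact Finset.sum_congr rfl fun b _ => hlin b
    · rw [Finset.sum_comm]
      refine Finset.sum_congr rfl fun b _ => ?_
      rw [Finset.sum_comm]
      exact Finset.sum_congr rfl fun b' _ => hquad b b'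

end Neighbourhood

end Arquile

namespace Arquile

section Chart

variable {k : Type*} [Field k] {Q : Quality k} {m : ℕ}

/-- Up to the factor `det (jac u)`, the adjugate of the Jacobian matrix of an adapted system inverts
the matrix of the derivatives of its elements in `I` in the directions of `S`. -/
theorem IsAdapted.sum_adjugate_mul {I : Ideal (BSeries Q m)} {S : Finset (Fin m)}
    {u : Option (Fin m) → BSeries Q m} (h : IsAdapted I S u) {c b : Fin m} (hb : b ∈ S) :
    ∑ d ∈ S, (jac u).adjugate (some c) (some d) * partialD Q (some b) (u (some d)) =
      if b = c then (jac u).det else 0 := by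
  classical
  have h1 := congrFun (congrFun (jac u).adjugate_mul (some c)) (some b)
  rw [Matrix.mul_apply, Matrix.smul_apply, Matrix.one_apply, smul_eq_mul, mul_ite, mul_one,
    mul_zero, Fintype.sum_option] at h1
  have h2 : jac u none (some b) = 0 := by
    change partialD Q (some b) (u none) = 0
    rw [h.eq_none, partialD_var, if_neg (by simp)]
  have h3 : ∑ d ∈ S, (jac u).adjugate (some c) (some d) * partialD Q (some b) (u (some d)) =
      ∑ d, (jac u).adjugate (some c) (some d) * jac u (some d) (some b) := by
    refine Finset.sum_subset (Finset.subset_univ S) fun d _ hd => ?_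
    rw [h.eq_some d hd, partialD_var, if_neg, mul_zero]
    intro hdb
    exact hd (Option.some_injective _ hdb ▸ hb)
  rw [h2, mul_zero, zero_add] at h1
  rw [h3, h1]
  simp only [Option.some.injEq, eq_comm]

/-- Near a regular point, the set `Y` is a graph in suitable coordinates. -/
theorem exists_chart {n : ℕ} {f : Fin n → BSeries Q m} {y : Arcs Q m}
    (hy : y ∈ arqReg (zeroLocus f)) :
    ∃ (S : Finset (Fin m)) (e : ℕ) (φ : Fin m → BSeries Q m), (∀ c, constTerm Q m (φ c) = 0) ∧
      (∀ c ∈ S, ∀ v v' : Arcs Q m, (∀ j, j ∉ S → v j = v' j) →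
        evalAt v (φ c) = evalAt v' (φ c)) ∧
      ∀ v : Arcs Q m, dilate y (weight S e) v ∈ zeroLocus f ↔
        ∀ c ∈ S, (v c : PowerSeries k) = evalAt v (φ c) := by
  classical
  obtain ⟨S, u, h⟩ := exists_isMaxAdapted_relationIdeal (vanishingIdeal (zeroLocus f)) y
  obtain ⟨s, hs, hsI⟩ := h.exists_mul_mem hy
  have hI := le_relationIdeal hy.1
  have hsy : evalAt y s ≠ 0 := fun h0 => hs (mem_relationIdeal.mpr h0)
  have hgy : evalAt y (jac u).det ≠ 0 := fun h0 => h.det (mem_relationIdeal.mpr h0)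
  obtain ⟨e, w, hw, hwe⟩ := exists_mul_eq_X_pow (mul_mem (evalAt_mem y s) (evalAt_mem y _))
    (mul_ne_zero hsy hgy)
  let M : Fin m → Fin m → Q.series Unit := fun c d =>
    ⟨w * (evalAt y s * evalAt y ((jac u).adjugate (some c) (some d))),
      mul_mem hw (mul_mem (evalAt_mem y _) (evalAt_mem y _))⟩
  have hM : ∀ c ∈ S, ∀ b ∈ S, ∑ d ∈ S, (M c d : PowerSeries k) *
      evalAt y (partialD Q (some b) (u (some d))) = if b = c then PowerSeries.X ^ e else 0 := by
    intro c _ b hb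
    have h1 := congrArg (fun x => w * (evalAt y s * evalAt y x)) (h.sum_adjugate_mul (c := c) hb)
    simp only [map_sum, map_mul, Finset.mul_sum] at h1
    have h2 : w * (evalAt y s * evalAt y (if b = c then (jac u).det else 0)) =
        if b = c then PowerSeries.X ^ e else 0 := by
      split_ifs
      · exact hwe
      · rw [map_zero, mul_zero, mul_zero]
    rw [← h2, ← h1]
    refine Finset.sum_congr rfl fun d _ => ?_
    simp only [M]
    ring
  obtain ⟨H, hH0, hH1, hH⟩ := exists_normal_form y S e (h := fun d => u (some d))
    (fun d hd => hI (h.mem d hd)) M hM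
  obtain ⟨φ, hφ0, hφS, hφ⟩ := exists_implicit_system S H hH0 hH1
  refine ⟨S, e, φ, hφ0, hφS, fun v => ?_⟩
  rw [← hφ v]
  constructor
  · intro hv c hc
    have h1 := hH v c hc
    rw [Finset.sum_eq_zero fun d hd => by
      rw [mem_vanishingIdeal.mp (h.mem d hd) _ hv, mul_zero]] at h1
    exact (mul_eq_zero.mp h1.symm).resolve_left (pow_ne_zero _ PowerSeries.X_ne_zero)
  · intro hv j
    have hdet : (Matrix.of fun c d : S => (M c d : PowerSeries k)).det ≠ 0 := by
      have h1 : (Matrix.of fun c d : S => (M c d : PowerSeries k)) *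
          (Matrix.of fun d b : S => evalAt y (partialD Q (some (b : Fin m)) (u (some d)))) =
          (PowerSeries.X ^ e : PowerSeries k) • 1 := by
        ext1 c b
        rw [Matrix.mul_apply, Matrix.smul_apply, Matrix.one_apply, smul_eq_mul, mul_ite, mul_one,
          mul_zero]
        refine (Finset.sum_coe_sort S fun d => (M c d : PowerSeries k) *
          evalAt y (partialD Q (some (b : Fin m)) (u (some d)))).trans ?_
        rw [hM c c.2 b b.2]
        simp only [Subtype.ext_iff, eq_comm]
      intro h0
      have h2 := congrArg Matrix.det h1
      rw [Matrix.det_mul, h0, zero_mul, Matrix.det_smul, Matrix.det_one, mul_one] at h2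
      exact pow_ne_zero _ (pow_ne_zero _ PowerSeries.X_ne_zero) h2.symm
    have hu : ∀ d ∈ S, evalAt (dilate y (weight S e) v) (u (some d)) = 0 := by
      have h1 : (Matrix.of fun c d : S => (M c d : PowerSeries k)).mulVec
          (fun d => evalAt (dilate y (weight S e) v) (u (some d))) = 0 := by
        ext1 c
        refine (Finset.sum_coe_sort S fun d => (M c d : PowerSeries k) *
          evalAt (dilate y (weight S e) v) (u (some d))).trans ?_
        rw [hH v c c.2, hv c c.2, mul_zero]
        rfl
      exact fun d hd => congrFun (Matrix.eq_zero_of_mulVec_eq_zero hdet h1) ⟨d, hd⟩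
    -- the multiplier `s` does not vanish at the dilated arcs, having order at most `e` at `y`
    have hsv : evalAt (dilate y (weight S e) v) s ≠ 0 := by
      intro h0
      obtain ⟨c, hc⟩ := exists_eq_evalT_add y s
      rw [hc, map_add, evalAt_evalT, map_sum] at h0
      have h1 : PowerSeries.X ^ (e + 1) ∣ evalAt y s := by
        rw [eq_neg_of_add_eq_zero_left h0, dvd_neg]
        refine Finset.dvd_sum fun b _ => ?_
        rw [map_mul, evalAt_centered]
        refine dvd_mul_of_dvd_right (dvd_trans (pow_dvd_pow _ ?_) (dvd_dilate_sub y _ v b)) _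
        rw [weight]
        split_ifs <;> omega
      have h2 : PowerSeries.X ^ (e + 1) ∣ (PowerSeries.X ^ e : PowerSeries k) := by
        rw [← hwe]
        exact dvd_mul_of_dvd_right (dvd_mul_of_dvd_left h1 _) _
      have h3 := (pow_dvd_pow_iff PowerSeries.X_ne_zero PowerSeries.X_prime.not_isUnit).mp h2
      omega
    have hfI : f j ∈ vanishingIdeal (zeroLocus f) := mem_vanishingIdeal.mpr fun y' hy' => hy' j
    have h1 : Ideal.span ((fun c => u (some c)) '' (S : Set (Fin m))) ≤
        relationIdeal (dilate y (weight S e) v) := by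
      rw [Ideal.span_le]
      rintro _ ⟨d, hd, rfl⟩
      exact mem_relationIdeal.mpr (hu d hd)
    have h2 := mem_relationIdeal.mp (h1 (hsI _ hfI))
    rw [map_mul] at h2
    exact (mul_eq_zero.mp h2).resolve_left hsv

end Chart

/-! ### Textile charts -/

section Textile

variable {k : Type*} [Field k] {Q : Quality k} {m : ℕ}

theorem eval_bind₁_coeffs {s : ℕ} (z : Arcs Q s) (E : Fin m × ℕ → MvPolynomial (Fin s × ℕ) k)
    (F : MvPolynomial (Fin m × ℕ) k) : MvPolynomial.eval (coeffs z) (MvPolynomial.bind₁ E F) =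
      MvPolynomial.eval (fun p => MvPolynomial.eval (coeffs z) (E p)) F :=
  MvPolynomial.eval₂Hom_bind₁ _ _ _ _

/-- The points of `Y` whose components agree with those of `y` up to order `ε i`; these are the
points of `Y` in the image of the dilation `v ↦ y + t ^ ε * v`. -/
def closePoints {n : ℕ} (f : Fin n → BSeries Q m) (y : Arcs Q m) (ε : Fin m → ℕ) :
    Set (Arcs Q m) :=
  {y' | y' ∈ zeroLocus f ∧
    ∀ i, PowerSeries.X ^ (ε i + 1) ∣ (y' i : PowerSeries k) - (y i : PowerSeries k)}

theorem isTextileClosed_closePoints {n : ℕ} (f : Fin n → BSeries Q m) (y : Arcs Q m)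
    (ε : Fin m → ℕ) : IsTextileClosed (closePoints f y ε) := by
  choose F hF using fun (j : Fin n) (l : ℕ) => exists_coeff_evalAt_eq l (f j)
  refine ⟨(Set.range fun p : Fin n × ℕ => F p.1 p.2) ∪
    {G | ∃ (i : Fin m) (l : ℕ), l ≤ ε i ∧ G = MvPolynomial.X (i, l) -
      MvPolynomial.C (PowerSeries.coeff l (y i : PowerSeries k))}, ?_⟩
  ext y'
  constructor
  · rintro ⟨h1, h2⟩ G (⟨p, rfl⟩ | ⟨i, l, hl, rfl⟩)
    · rw [← hF, h1 p.1, map_zero]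
    · have := PowerSeries.X_pow_dvd_iff.mp (h2 i) l (Nat.lt_succ_of_le hl)
      rwa [map_sub, MvPolynomial.eval_X, MvPolynomial.eval_C, coeffs, ← map_sub]
  · intro h
    refine ⟨fun j => ?_, fun i => ?_⟩
    · ext l
      rw [hF, h _ (Or.inl ⟨(j, l), rfl⟩), map_zero]
    · rw [PowerSeries.X_pow_dvd_iff]
      intro l hl
      have := h _ (Or.inr ⟨i, l, Nat.le_of_lt_succ hl, rfl⟩)
      rwa [map_sub, MvPolynomial.eval_X, MvPolynomial.eval_C, coeffs, ← map_sub] at this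

theorem IsTextileClosed.isTextileLocallyClosed {W : Set (Arcs Q m)} (h : IsTextileClosed W) :
    IsTextileLocallyClosed W :=
  ⟨W, ∅, h, ⟨{1}, by ext; simp⟩, by simp⟩

theorem isTAdicOpenIn_closePoints {n : ℕ} (f : Fin n → BSeries Q m) (y : Arcs Q m)
    (ε : Fin m → ℕ) : IsTAdicOpenIn (zeroLocus f) (closePoints f y ε) := by
  refine ⟨fun y' h => h.1, fun y' h => ⟨Finset.univ.sup ε + 1, fun y'' hy'' hd => ⟨hy'', fun i => ?_⟩⟩⟩
  have h1 : (PowerSeries.X : PowerSeries k) ^ (ε i + 1) ∣ PowerSeries.X ^ (Finset.univ.sup ε + 1) :=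
    pow_dvd_pow _ (Nat.succ_le_succ (Finset.le_sup (Finset.mem_univ i)))
  have h2 := dvd_add (h1.trans (hd i)) (h.2 i)
  rwa [sub_add_sub_cancel] at h2

/-- The arc `0` in the line. -/
def zeroArc : Centered Q := ⟨0, zero_mem _, map_zero _⟩

/-- The arc with the components `z` outside of `S`, and `0` at the indices in `S`. -/
def pad {s : ℕ} {S : Finset (Fin m)} (ρ : Fin s ≃ {i // i ∉ S}) (z : Arcs Q s) : Arcs Q m :=
  fun i => if h : i ∈ S then zeroArc else z (ρ.symm ⟨i, h⟩)

/-- The point of the graph of `φ` over `z`. -/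
noncomputable def liftGraph {s : ℕ} {S : Finset (Fin m)} (ρ : Fin s ≃ {i // i ∉ S})
    (φ : Fin m → BSeries Q m) (hφ : ∀ c, constTerm Q m (φ c) = 0) (z : Arcs Q s) : Arcs Q m :=
  fun i => if i ∈ S then arcMap φ hφ (pad ρ z) i else pad ρ z i

section Graph

variable {s : ℕ} {S : Finset (Fin m)} (ρ : Fin s ≃ {i // i ∉ S}) {φ : Fin m → BSeries Q m}
  (hφ : ∀ c, constTerm Q m (φ c) = 0)

theorem liftGraph_apply_equiv (z : Arcs Q s) (j : Fin s) : liftGraph ρ φ hφ z (ρ j) = z j := by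
  rw [liftGraph, if_neg (ρ j).2, pad, dif_neg (ρ j).2]
  simp

theorem liftGraph_mem
    (hS : ∀ c ∈ S, ∀ v v' : Arcs Q m, (∀ j, j ∉ S → v j = v' j) →
      evalAt v (φ c) = evalAt v' (φ c)) (z : Arcs Q s) {c : Fin m} (hc : c ∈ S) :
    (liftGraph ρ φ hφ z c : PowerSeries k) = evalAt (liftGraph ρ φ hφ z) (φ c) := by
  have h1 : (liftGraph ρ φ hφ z c : PowerSeries k) = evalAt (pad ρ z) (φ c) := by
    rw [liftGraph, if_pos hc, arcMap_apply]
  rw [h1]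
  exact hS c hc _ _ fun j hj => by rw [liftGraph, if_neg hj]

theorem liftGraph_eq
    (hS : ∀ c ∈ S, ∀ v v' : Arcs Q m, (∀ j, j ∉ S → v j = v' j) →
      evalAt v (φ c) = evalAt v' (φ c)) {v : Arcs Q m}
    (hv : ∀ c ∈ S, (v c : PowerSeries k) = evalAt v (φ c)) :
    liftGraph ρ φ hφ (fun j => v (ρ j)) = v := by
  have h1 : ∀ i, i ∉ S → pad ρ (fun j => v (ρ j)) i = v i := fun i hi => by
    rw [pad, dif_neg hi]
    simp
  ext1 i
  by_cases hi : i ∈ S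
  · apply Subtype.ext
    rw [liftGraph, if_pos hi, arcMap_apply, hv i hi]
    exact hS i hi _ _ h1
  · rw [liftGraph, if_neg hi, h1 i hi]

theorem exists_coeffs_liftGraph_eq (i : Fin m) (l : ℕ) :
    ∃ F : MvPolynomial (Fin s × ℕ) k, ∀ z : Arcs Q s,
      PowerSeries.coeff l (liftGraph ρ φ hφ z i : PowerSeries k) =
        MvPolynomial.eval (coeffs z) F := by
  let E : Fin m × ℕ → MvPolynomial (Fin s × ℕ) k := fun p =>
    if h : p.1 ∈ S then 0 else MvPolynomial.X (ρ.symm ⟨p.1, h⟩, p.2)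
  have hE : ∀ z : Arcs Q s, coeffs (pad ρ z) = fun p => MvPolynomial.eval (coeffs z) (E p) := by
    intro z
    ext1 p
    simp only [coeffs, pad, E]
    split_ifs
    · rw [map_zero]
      exact map_zero _
    · rw [MvPolynomial.eval_X]
      rfl
  by_cases hi : i ∈ S
  · obtain ⟨F, hF⟩ := exists_coeff_evalAt_eq l (φ i)
    refine ⟨MvPolynomial.bind₁ E F, fun z => ?_⟩
    rw [eval_bind₁_coeffs, ← hE, ← hF, liftGraph, if_pos hi, arcMap_apply]
  · refine ⟨E (i, l), fun z => ?_⟩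
    rw [← congrFun (hE z) (i, l), liftGraph, if_neg hi]
    rfl

end Graph

/-- Every regular point has a textile locally closed neighbourhood which is textile isomorphic to a
free module. -/
theorem exists_textile_neighbourhood {n : ℕ} {f : Fin n → BSeries Q m} {y : Arcs Q m}
    (hy : y ∈ arqReg (zeroLocus f)) :
    ∃ (s : ℕ) (W : Set (Arcs Q m)), y ∈ W ∧ IsTAdicOpenIn (zeroLocus f) W ∧
      IsTextileLocallyClosed W ∧ TextileIsomorphic W (Set.univ : Set (Arcs Q s)) := by
  classical
  obtain ⟨S, e, φ, hφ, hS, hiff⟩ := exists_chart hy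
  set ε := weight S e with hε
  let ρ : Fin (Fintype.card {i // i ∉ S}) ≃ {i // i ∉ S} := (Fintype.equivFin _).symm
  refine ⟨Fintype.card {i // i ∉ S}, closePoints f y ε, ⟨hy.1, fun i => by simp⟩,
    isTAdicOpenIn_closePoints f y ε, (isTextileClosed_closePoints f y ε).isTextileLocallyClosed, ?_⟩
  choose g hg using fun y' : closePoints f y ε => exists_dilate_eq y'.2.2
  have hgv : ∀ y', ∀ c ∈ S, (g y' c : PowerSeries k) = evalAt (g y') (φ c) := fun y' =>
    (hiff _).mp (by rw [hg]; exact y'.2.1)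
  have hmem : ∀ z, dilate y ε (liftGraph ρ φ hφ z) ∈ closePoints f y ε := fun z =>
    ⟨(hiff _).mpr fun c hc => liftGraph_mem ρ hφ hS z hc, dvd_dilate_sub y ε _⟩
  let Φ : closePoints f y ε ≃ (Set.univ : Set (Arcs Q (Fintype.card {i // i ∉ S}))) :=
    { toFun := fun y' => ⟨fun j => g y' (ρ j), trivial⟩
      invFun := fun z => ⟨dilate y ε (liftGraph ρ φ hφ z.1), hmem z.1⟩
      left_inv := fun y' => Subtype.ext (by
        change dilate y ε (liftGraph ρ φ hφ fun j => g y' (ρ j)) = y'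
        rw [liftGraph_eq ρ hφ hS (hgv y'), hg])
      right_inv := fun z => Subtype.ext (by
        have h1 : g ⟨dilate y ε (liftGraph ρ φ hφ z.1), hmem z.1⟩ = liftGraph ρ φ hφ z.1 :=
          dilate_injective y ε (hg _)
        ext1 j
        change g ⟨dilate y ε (liftGraph ρ φ hφ z.1), hmem z.1⟩ (ρ j) = z.1 j
        rw [h1, liftGraph_apply_equiv]) }
  refine ⟨Φ, ⟨fun p => MvPolynomial.X ((ρ p.1 : Fin m), p.2 + ε (ρ p.1)) - MvPolynomial.C
    (PowerSeries.coeff (p.2 + ε (ρ p.1)) (y (ρ p.1) : PowerSeries k)), fun y' p => ?_⟩, ?_⟩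
  · have h1 := congrArg (fun v : Arcs Q m => PowerSeries.coeff (p.2 + ε (ρ p.1))
      (v (ρ p.1) : PowerSeries k)) (hg y')
    simp only [dilate_apply, map_add, PowerSeries.coeff_X_pow_mul] at h1
    rw [map_sub, MvPolynomial.eval_X, MvPolynomial.eval_C, coeffs, coeffs, ← h1,
      add_sub_cancel_left]
    rfl
  · choose G hG using exists_coeffs_liftGraph_eq ρ hφ
    refine ⟨fun p => MvPolynomial.C (PowerSeries.coeff p.2 (y p.1 : PowerSeries k)) +
      if ε p.1 ≤ p.2 then G p.1 (p.2 - ε p.1) else 0, fun z p => ?_⟩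
    change PowerSeries.coeff p.2 (dilate y ε (liftGraph ρ φ hφ z.1) p.1 : PowerSeries k) = _
    rw [dilate_apply, map_add, PowerSeries.coeff_X_pow_mul', map_add, MvPolynomial.eval_C]
    split_ifs
    · rw [hG]
    · rw [map_zero]

end Textile

end Arquile


theorem mainTheorem2 {k : Type*} [Field k] [PerfectField k] (Q : Arquile.Quality k)
    (m n : ℕ) (f : Fin n → Arquile.BSeries Q m) (hY : (Arquile.zeroLocus f).Nonempty) :
    (Arquile.IsArquileClosed (Arquile.arqSing (Arquile.zeroLocus f)) ∧
      Arquile.arqSing (Arquile.zeroLocus f) ⊂ Arquile.zeroLocus f ∧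
      (∃ (l : ℕ) (h : Fin l → Arquile.BSeries Q m),
        Ideal.span (Set.range (Fin.append f h)) =
          Arquile.vanishingIdeal (Arquile.zeroLocus f) ∧
        Arquile.IsCutOutByMinors (Fin.append f h) (Arquile.zeroLocus f)
          (Arquile.arqSing (Arquile.zeroLocus f))) ∧
      (Ideal.span (Set.range f) = Arquile.vanishingIdeal (Arquile.zeroLocus f) →
        (∀ p ∈ (Arquile.vanishingIdeal (Arquile.zeroLocus f)).minimalPrimes,
          ∀ p' ∈ (Arquile.vanishingIdeal (Arquile.zeroLocus f)).minimalPrimes,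
            p.height = p'.height) →
        Arquile.IsCutOutByMinors f (Arquile.zeroLocus f)
          (Arquile.arqSing (Arquile.zeroLocus f)))) ∧
    (∀ y ∈ Arquile.arqReg (Arquile.zeroLocus f),
      ∃ (s : ℕ) (W : Set (Arquile.Arcs Q m)),
        y ∈ W ∧ Arquile.IsTAdicOpenIn (Arquile.zeroLocus f) W ∧
        Arquile.IsTextileLocallyClosed W ∧
        Arquile.TextileIsomorphic W (Set.univ : Set (Arquile.Arcs Q s))) := by
  refine ⟨⟨Arquile.isArquileClosed_arqSing f, Arquile.arqSing_ssubset hY,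
    Arquile.isCutOutByMinors_append f, fun hf hht =>
      Arquile.isCutOutByMinors_of_height_eq hY hf hht⟩,
    fun y hy => Arquile.exists_textile_neighbourhood hy⟩
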